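/- **Setting.** Let $\Lambda\in\mathbb R$ and let $\mathcal H:\mathbb C\to\mathbb R$ be of class $C^{3,1}_{loc}$ (three times continuously differentiable with locally Lipschitz third derivative). Use coordinates $(U,V,x,y)$ on $\mathbb R^4$, $Z=x+iy$, with the Wirtinger derivatives $\partial_Z=\frac12(\partial_x-i\partial_y)$, $\partial_{\bar Z}=\frac12(\partial_x+i\partial_y)$. Put $U^+=\max(0,U)$, $G=\mathcal H-Z\partial_Z\mathcal H-\bar Z\partial_{\bar Z}\mathcal H$, $p_0=1+\frac\Lambda6|Z|^2$ and $P=1+\frac\Lambda6(|Z|^2-UV-U^+G)$. The impulsive wave metric is $$g=\frac{2\,\big|dZ+U^+(\partial^2_{Z\bar Z}\mathcal H\,dZ+\partial^2_{\bar Z\bar Z}\mathcal H\,d\bar Z)\big|^2-2\,dU\,dV}{P^2},$$ and $M_\Lambda\subset\mathbb R^4$ is the set where $P\neq0$ and $g$ has signature $(-,+,+,+)$. Let $\rho\in C_c^\infty((-1,1);[0,\infty))$ be even with $\int\rho=1$, let $\rho_\varepsilon(u)=\varepsilon^{-1}\rho(u/\varepsilon)$, and let $\Theta=1_{[0,\infty)}$.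 Let $\kappa_\varepsilon,\zeta_\varepsilon,\iota_\varepsilon$ be the functions of $U$ that vanish near $-\infty$ and satisfy $$\kappa_\varepsilon''=\rho_\varepsilon\,(\rho_\varepsilon*U^+),\qquad \zeta_\varepsilon''=(\rho_\varepsilon*\Theta)^2-\rho_\varepsilon*\Theta,\qquad \iota_\varepsilon''=U\rho_\varepsilon .$$ With $q=(\partial^2_{Z\bar Z}\mathcal H)^2+|\partial^2_{\bar Z\bar Z}\mathcal H|^2$ set $$A=4q-\frac{\Lambda^2G^2}{18\,p_0^2},\qquad B=2q,\qquad E=-\frac{\Lambda^2\,G\,V}{18\,p_0^2},$$ $$P_\varepsilon=1+\tfrac\Lambda6\big(|Z|^2-UV-(\rho_\varepsilon*U^+)G\big),\qquad g_\varepsilon=P_\varepsilon^{-2}\big(-2\,dU\,dV+\tilde g^\varepsilon_{33}\,dZ^2+2\tilde g^\varepsilon_{34}\,dZ\,d\bar Z+\tilde g^\varepsilon_{44}\,d\bar Z^2\big),$$ where $$\tilde g^\varepsilon_{33}=2\,\partial^2_{ZZ}\mathcal H\,(\rho_\varepsilon*U^+)+2\,\partial^2_{Z\bar Z}\mathcal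 H\,\partial^2_{ZZ}\mathcal H\,(\rho_\varepsilon*(U^+)^2),\qquad \tilde g^\varepsilon_{44}=\overline{\tilde g^\varepsilon_{33}},$$ $$\tilde g^\varepsilon_{34}=1+2\,\partial^2_{Z\bar Z}\mathcal H\,(\rho_\varepsilon*U^+)+q\,(\rho_\varepsilon*(U^+)^2)+A\kappa_\varepsilon+B\zeta_\varepsilon+E\iota_\varepsilon .$$ **Proposition.** Assume that $$-2\,\partial^2_{Z\bar Z}\mathcal H-\frac{\Lambda\,G}{3\,(1+\frac\Lambda6|Z|^2)}\ \ge\ 0\qquad\text{wherever } 1+\tfrac\Lambda6|Z|^2\neq0 .$$ Let $K\subset M_\Lambda$ be compact and assume that $1+\frac\Lambda6|Z|^2\neq0$ at the points of $K$ with $U>0$ (automatic if $\Lambda\ge0$). Then: 1. $g_\varepsilon\to g$ uniformly on $K$ as $\varepsilon\downarrow0$. 2. There are constants $c_\varepsilon>0$ with $c_\varepsilon\to0$ as $\varepsilon\downarrow0$ such that, for all sufficiently small $\varepsilon>0$, $g_\varepsilon$ is Lorentzian at every point of $K$ and of class $C^1$ near every point of $K$, and $\mathrm{Ric}_{g_\varepsilon}\ge\Lambda-c_\varepsilon$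 on $K$ in the following sense: at every point of $K$ over which $D^3\mathcal H$ is differentiable (this holds at almost every point of $\mathbb R^4$), $g_\varepsilon$ is twice differentiable and $$\mathrm{Ric}_{g_\varepsilon}(X,X)\ \ge\ \Lambda\,g_\varepsilon(X,X)-c_\varepsilon\,|X|^2\qquad\text{for all } X\in\mathbb R^4,$$ $|X|$ being the Euclidean norm in the coordinates $(U,V,x,y)$. For $\Lambda=0$ the hypothesis reads $\partial^2_{Z\bar Z}\mathcal H\le0$ and the conclusion $\mathrm{Ric}_{g_\varepsilon}\ge-c_\varepsilon$. -/

import Mathlib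

open Filter Topology MeasureTheory
open scoped ContDiff Matrix

noncomputable section

namespace IPPWave

/-! ### Profile functions and Wirtinger derivatives -/

/-- `H ∈ C^{3,1}_loc`: three times continuously differentiable, with locally Lipschitz
third derivative. -/
def IsC31Loc (H : ℂ → ℝ) : Prop :=
  ContDiff ℝ 3 H ∧ LocallyLipschitz (iteratedFDeriv ℝ 3 H)

/-- The Wirtinger derivative `∂_Z = (∂_x - i ∂_y) / 2`. -/
def dZ (f : ℂ → ℂ) (z : ℂ) : ℂ :=
  (fderiv ℝ f z 1 - Complex.I * fderiv ℝ f z Complex.I) / 2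

/-- The Wirtinger derivative `∂_{Z̄} = (∂_x + i ∂_y) / 2`. -/
def dZbar (f : ℂ → ℂ) (z : ℂ) : ℂ :=
  (fderiv ℝ f z 1 + Complex.I * fderiv ℝ f z Complex.I) / 2

/-- A real profile, regarded as complex valued. -/
def toC (H : ℂ → ℝ) (z : ℂ) : ℂ := (H z : ℂ)

/-- `∂²_{Z,Z} H`. -/
def HZZ (H : ℂ → ℝ) (z : ℂ) : ℂ := dZ (dZ (toC H)) z

/-- `∂²_{Z̄,Z̄} H`. -/
def HZbZb (H : ℂ → ℝ) (z : ℂ) : ℂ := dZbar (dZbar (toC H)) z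

/-- `∂²_{Z,Z̄} H`, a quarter of the Laplacian; it is real because `H` is real. -/
def HZZb (H : ℂ → ℝ) (z : ℂ) : ℝ := (dZ (dZbar (toC H)) z).re

/-- `G = H - Z ∂_Z H - Z̄ ∂_{Z̄} H`; it is real because `H` is real. -/
def G (H : ℂ → ℝ) (z : ℂ) : ℝ :=
  (toC H z - z * dZ (toC H) z - (starRingEnd ℂ) z * dZbar (toC H) z).re

/-- `1 + (Λ/6) |Z|²`. -/
def bgFactor (Λ : ℝ) (z : ℂ) : ℝ := 1 + Λ / 6 * Complex.normSq z

/-! ### The functions of `U` -/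

/-- `U⁺ = max (0, U)`. -/
def uPlus (u : ℝ) : ℝ := max 0 u

/-- The Heaviside function. -/
def heaviside (u : ℝ) : ℝ := Set.indicator (Set.Ici 0) (fun _ => (1 : ℝ)) u

/-- A smooth even mollifier `ρ ∈ C_c^∞((-1,1); [0,∞))` with integral one. -/
structure IsMollifier (ρ : ℝ → ℝ) : Prop where
  smooth : ContDiff ℝ ∞ ρ
  support_subset : tsupport ρ ⊆ Set.Ioo (-1) 1
  nonneg : ∀ x, 0 ≤ ρ x
  even : ∀ x, ρ (-x) = ρ x
  integral_eq_one : ∫ x, ρ x = 1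

/-- `ρ_ε (x) = ρ (x / ε) / ε`. -/
def rhoEps (ρ : ℝ → ℝ) (ε x : ℝ) : ℝ := ρ (x / ε) / ε

/-- The convolution `ρ_ε * f`. -/
def mollify (ρ : ℝ → ℝ) (ε : ℝ) (f : ℝ → ℝ) (u : ℝ) : ℝ :=
  ∫ t, rhoEps ρ ε t * f (u - t)

/-- The primitive vanishing at `-∞`. -/
def primitive (f : ℝ → ℝ) (x : ℝ) : ℝ := ∫ u in Set.Iic x, f u

/-- `σ_ε = (ρ_ε * Θ)² - ρ_ε * Θ`. -/
def sigmaEps (ρ : ℝ → ℝ) (ε u : ℝ) : ℝ :=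
  mollify ρ ε heaviside u ^ 2 - mollify ρ ε heaviside u

/-- `ζ_ε`, the second primitive of `σ_ε`. -/
def zetaEps (ρ : ℝ → ℝ) (ε : ℝ) : ℝ → ℝ := primitive (primitive (sigmaEps ρ ε))

/-- `κ_ε`, the second primitive of `(ρ_ε * U⁺) ρ_ε`. -/
def kappaEps (ρ : ℝ → ℝ) (ε : ℝ) : ℝ → ℝ :=
  primitive (primitive (fun u => mollify ρ ε uPlus u * rhoEps ρ ε u))

/-- `ι_ε`, the second primitive of `U ρ_ε`. -/
def iotaEps (ρ : ℝ → ℝ) (ε : ℝ) : ℝ → ℝ :=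
  primitive (primitive (fun u => u * rhoEps ρ ε u))

/-! ### Metrics on `ℝ⁴`, coordinates `(U, V, x, y)` -/

/-- `Z = x + i y`. -/
def zCoord (p : Fin 4 → ℝ) : ℂ := ⟨p 2, p 3⟩

/-- The coefficient matrix, with respect to `(dU, dV, dZ, dZ̄)`, of a metric of the form
`-2 dU dV + g₃₃ dZ² + 2 g₃₄ dZ dZ̄ + g₄₄ dZ̄²`. -/
def blockMatrix (g33 g34 g44 : ℂ) : Matrix (Fin 4) (Fin 4) ℂ :=
  !![0, -1, 0, 0;
     -1, 0, 0, 0;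
     0, 0, g33, g34;
     0, 0, g34, g44]

/-- The change of coframe `(dU, dV, dZ, dZ̄)ᵀ = frameChange (dU, dV, dx, dy)ᵀ`. -/
def frameChange : Matrix (Fin 4) (Fin 4) ℂ :=
  !![1, 0, 0, 0;
     0, 1, 0, 0;
     0, 0, 1, Complex.I;
     0, 0, 1, -Complex.I]

/-- The coefficient matrix with respect to `(dU, dV, dx, dy)` of the symmetric form whose matrix
with respect to `(dU, dV, dZ, dZ̄)` is `g`; the entries are real whenever `g₃₄` is real and
`g₄₄` is the conjugate of `g₃₃`. -/
def toRealFrame (g : Matrix (Fin 4) (Fin 4) ℂ) : Matrix (Fin 4) (Fin 4) ℝ :=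
  (frameChangeᵀ * g * frameChange).map Complex.re

/-- The denominator `P = 1 + (Λ/6) (Z Z̄ - U V - U⁺ G)`. -/
def P (Λ : ℝ) (H : ℂ → ℝ) (p : Fin 4 → ℝ) : ℝ :=
  1 + Λ / 6 * (Complex.normSq (zCoord p) - p 0 * p 1 - uPlus (p 0) * G H (zCoord p))

/-- The continuous impulsive wave metric
`(2 |dZ + U⁺ (∂²_{Z,Z̄}H dZ + ∂²_{Z̄,Z̄}H dZ̄)|² - 2 dU dV) / P²`. -/
def waveMetric (Λ : ℝ) (H : ℂ → ℝ) (p : Fin 4 → ℝ) : Matrix (Fin 4) (Fin 4) ℝ :=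
  let z := zCoord p
  let w := uPlus (p 0)
  (1 / P Λ H p ^ 2) • toRealFrame (blockMatrix
    (2 * HZZ H z * w + 2 * HZZb H z * HZZ H z * w ^ 2)
    (1 + 2 * HZZb H z * w + (HZZb H z ^ 2 + Complex.normSq (HZbZb H z)) * w ^ 2)
    (2 * HZbZb H z * w + 2 * HZZb H z * HZbZb H z * w ^ 2))

/-- Signature `(-,+,+,+)`: congruent to `diag(-1,1,1,1)`. -/
def IsLorentzian (M : Matrix (Fin 4) (Fin 4) ℝ) : Prop :=
  ∃ S : Matrix (Fin 4) (Fin 4) ℝ, IsUnit S.det ∧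
    Sᵀ * M * S = Matrix.diagonal ![-1, 1, 1, 1]

/-- `M_Λ`, the set where the wave metric is defined and Lorentzian. -/
def lorentzDomain (Λ : ℝ) (H : ℂ → ℝ) : Set (Fin 4 → ℝ) :=
  {p | P Λ H p ≠ 0 ∧ IsLorentzian (waveMetric Λ H p)}

/-! ### The regularised metrics -/

/-- `P_ε = 1 + (Λ/6) (Z Z̄ - U V - (ρ_ε * U⁺) G)`. -/
def PEps (Λ : ℝ) (H : ℂ → ℝ) (ρ : ℝ → ℝ) (ε : ℝ) (p : Fin 4 → ℝ) : ℝ :=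
  1 + Λ / 6 * (Complex.normSq (zCoord p) - p 0 * p 1
    - mollify ρ ε uPlus (p 0) * G H (zCoord p))

/-- `A = 4 ((∂²_{Z,Z̄}H)² + |∂²_{Z̄,Z̄}H|²) - (Λ²/18) G² / (1 + (Λ/6)|Z|²)²`. -/
def coeffA (Λ : ℝ) (H : ℂ → ℝ) (z : ℂ) : ℝ :=
  (Λ / 3 * G H z * (-(Λ / 6) * G H z + 4 * HZZb H z * bgFactor Λ z)
    - 4 * Λ / 3 * G H z * bgFactor Λ z * HZZb H z
    + 4 * bgFactor Λ z ^ 2 * (HZZb H z ^ 2 + Complex.normSq (HZbZb H z)))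
    / bgFactor Λ z ^ 2

/-- `B = 2 ((∂²_{Z,Z̄}H)² + |∂²_{Z̄,Z̄}H|²)`. -/
def coeffB (H : ℂ → ℝ) (z : ℂ) : ℝ :=
  2 * (HZZb H z ^ 2 + Complex.normSq (HZbZb H z))

/-- `E = -(Λ²/18) G V / (1 + (Λ/6)|Z|²)²`. -/
def coeffE (Λ : ℝ) (H : ℂ → ℝ) (V : ℝ) (z : ℂ) : ℝ :=
  -(Λ ^ 2 / 18) * G H z * V / bgFactor Λ z ^ 2

/-- The mollified and corrected metric `g_ε`. -/
def approxMetric (Λ : ℝ) (H : ℂ → ℝ) (ρ : ℝ → ℝ) (ε : ℝ) (p : Fin 4 → ℝ) :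
    Matrix (Fin 4) (Fin 4) ℝ :=
  let z := zCoord p
  let w := mollify ρ ε uPlus (p 0)
  let s := mollify ρ ε (fun u => uPlus u ^ 2) (p 0)
  (1 / PEps Λ H ρ ε p ^ 2) • toRealFrame (blockMatrix
    (2 * HZZ H z * w + 2 * HZZb H z * HZZ H z * s)
    (1 + 2 * HZZb H z * w + (HZZb H z ^ 2 + Complex.normSq (HZbZb H z)) * s
      + coeffA Λ H z * kappaEps ρ ε (p 0) + coeffB H z * zetaEps ρ ε (p 0)
      + coeffE Λ H (p 1) z * iotaEps ρ ε (p 0))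
    (2 * HZbZb H z * w + 2 * HZZb H z * HZbZb H z * s))

/-! ### Curvature of a metric given by its coefficient matrix -/

/-- The partial derivative `∂_i f`. -/
def pd (i : Fin 4) (f : (Fin 4 → ℝ) → ℝ) (p : Fin 4 → ℝ) : ℝ :=
  fderiv ℝ f p (Pi.single i 1)

/-- Christoffel symbols of the first kind,
`Γ_{ij,k} = (∂_i g_{jk} + ∂_j g_{ik} - ∂_k g_{ij}) / 2`. -/
def christoffel (g : (Fin 4 → ℝ) → Matrix (Fin 4) (Fin 4) ℝ) (i j k : Fin 4)
    (p : Fin 4 → ℝ) : ℝ :=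
  (pd i (fun q => g q j k) p + pd j (fun q => g q i k) p - pd k (fun q => g q i j) p) / 2

/-- `R_{ijkl} = ∂_i Γ_{jk,l} - ∂_j Γ_{ik,l}
  + g^{st} (Γ_{ik,s} Γ_{jl,t} - Γ_{il,s} Γ_{jk,t})`. -/
def riemann (g : (Fin 4 → ℝ) → Matrix (Fin 4) (Fin 4) ℝ) (i j k l : Fin 4)
    (p : Fin 4 → ℝ) : ℝ :=
  pd i (christoffel g j k l) p - pd j (christoffel g i k l) p
    + ∑ s, ∑ t, (g p)⁻¹ s t *
        (christoffel g i k s p * christoffel g j l t p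
          - christoffel g i l s p * christoffel g j k t p)

/-- `Ric_{ij} = g^{kl} R_{kijl}`. -/
def ricci (g : (Fin 4 → ℝ) → Matrix (Fin 4) (Fin 4) ℝ) (p : Fin 4 → ℝ) :
    Matrix (Fin 4) (Fin 4) ℝ :=
  Matrix.of fun i j => ∑ k, ∑ l, (g p)⁻¹ k l * riemann g k i j l p

/-- `Ric_g ≥ κ - c` at `p`: as quadratic forms `Ric_g ≥ κ g - c e`, where `e` is the Euclidean
metric of the coordinates. -/
def RicciGEAt (g : (Fin 4 → ℝ) → Matrix (Fin 4) (Fin 4) ℝ) (κ c : ℝ)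
    (p : Fin 4 → ℝ) : Prop :=
  ∀ X : Fin 4 → ℝ, κ * (X ⬝ᵥ (g p *ᵥ X)) - c * (X ⬝ᵥ X) ≤ X ⬝ᵥ (ricci g p *ᵥ X)

/-- All coefficients of `g` are of class `C¹` near `p`. -/
def IsC1At (g : (Fin 4 → ℝ) → Matrix (Fin 4) (Fin 4) ℝ) (p : Fin 4 → ℝ) : Prop :=
  ∀ i j, ContDiffAt ℝ 1 (fun q => g q i j) p

/-- All coefficients of `g` are twice differentiable at `p`. -/
def IsTwiceDifferentiableAt (g : (Fin 4 → ℝ) → Matrix (Fin 4) (Fin 4) ℝ)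
    (p : Fin 4 → ℝ) : Prop :=
  ∀ i j, DifferentiableAt ℝ (fderiv ℝ (fun q => g q i j)) p

end IPPWave

end

noncomputable section

namespace IPPWave

section

/-! ### Primitives -/

/-! Write M for half the real Hessian of H and w, θ, s for the mollifications of U⁺, Θ, (U⁺)². In
real coordinates g_ε = m / P_ε² with m = -2 dU dV + 2((1 + c) + 2wM + sM²), where c = Aκ + Bζ + Eι
is the correction. If c = 0 and s = w², the transverse part is 2S² with S = 1 + wM, and S is the
differential of x ↦ x + (w/2)∇H at fixed U. So m behaves like a flat metric off the wave front and P
has Hessian (Λ/6) m. The conformal formula `ricci_conformal` then yields Ric = Λ g.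

To make "up to O(ε)" exact, every ingredient of the two-jet of g_ε at a point becomes an entry of
the structure `Atoms`, reciprocals included. The Ricci tensor `ricJ` is then a polynomial in the
atoms and commutes with ring homomorphisms (`map_ricJ`). The atoms are viewed in the ring of bounded
functions of (ε, p), 0 < ε ≤ δ, p ∈ K, and are reduced modulo the ideal of functions O(ε). There the
correctors and their first derivatives vanish, s = w², wθ = w and Uθ = w (`isReduced_atoms`). The
Einstein equation for all components but UU becomes a polynomial identity (`IsReduced.ricJ_eq`), and
lifting it back gives a uniform bound Cε (`exists_ricJ_bound`).

The component UU contains ρ_ε itself, of size 1/ε, which does not belong to that ring. Second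
U-derivatives enter no other component (`ricJ_withSecond`), so they are set to zero in `realAtoms`
and restored in `fullAtoms`. By `ricJ_zero_zero_withSecond` the component UU equals ρ_ε (-tr M -
(Λ/3) G / p₀) + `restUU`. The bracket is the quantity that the hypothesis makes nonnegative. In
`restUU` only the products ρ_ε w, ρ_ε U, θ² - θ survive at order one, and A, E, B are precisely the
coefficients for which κ'', ι'', ζ'' cancel them (`restUU_eq_zero`). Hence the component UU is at
least -Cε, and since g_UU = 0, `quadratic_ge` assembles the Ricci bound.

The same quotient gives g_ε → g at rate ε, since the atoms entering the metric agree modulo O(ε)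
with those of the wave metric (`map_modSmall_eq_limit`). Nondegeneracy of g on the compact set K is
inherited by g_ε for small ε (`exists_nondegenerate`). -/

theorem primitive_eq_zero {f : ℝ → ℝ} {a u : ℝ} (hf : ∀ x ≤ a, f x = 0) (hu : u ≤ a) :
    primitive f u = 0 := by
  rw [primitive]
  exact setIntegral_eq_zero_of_forall_eq_zero fun x hx => hf x (le_trans hx hu)

theorem primitive_eq_intervalIntegral {f : ℝ → ℝ} (hc : Continuous f) {a : ℝ}
    (hf : ∀ x ≤ a, f x = 0) (u : ℝ) : primitive f u = ∫ x in a..u, f x := by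
  have h0 : IntegrableOn f (Set.Iic a) :=
    (integrableOn_zero (μ := volume)).congr_fun (fun x hx => (hf x hx).symm) measurableSet_Iic
  have hu : IntegrableOn f (Set.Iic u) := by
    refine (h0.union (hc.integrableOn_Icc (a := a) (b := u))).mono_set fun x hx => ?_
    rcases le_total x a with h | h
    · exact Or.inl h
    · exact Or.inr ⟨h, hx⟩
  rw [← intervalIntegral.integral_Iic_sub_Iic h0 hu]
  have := primitive_eq_zero hf le_rfl
  rw [primitive] at this
  rw [this, sub_zero, primitive]

theorem hasDerivAt_primitive {f : ℝ → ℝ} (hc : Continuous f) {a : ℝ}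
    (hf : ∀ x ≤ a, f x = 0) (u : ℝ) : HasDerivAt (primitive f) (f u) u := by
  rw [show primitive f = fun u => ∫ x in a..u, f x from
    funext (primitive_eq_intervalIntegral hc hf)]
  exact intervalIntegral.integral_hasDerivAt_right (hc.intervalIntegrable _ _)
    (hc.stronglyMeasurableAtFilter _ _) hc.continuousAt

theorem continuous_primitive {f : ℝ → ℝ} (hc : Continuous f) {a : ℝ}
    (hf : ∀ x ≤ a, f x = 0) : Continuous (primitive f) :=
  continuous_iff_continuousAt.mpr fun u => (hasDerivAt_primitive hc hf u).continuousAt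

theorem abs_primitive_le {f : ℝ → ℝ} (hc : Continuous f) {a C : ℝ}
    (hf : ∀ x ≤ a, f x = 0) (hb : ∀ x, |f x| ≤ C) (u : ℝ) :
    |primitive f u| ≤ C * max 0 (u - a) := by
  rcases le_total u a with h | h
  · rw [primitive_eq_zero hf h, abs_zero, max_eq_left (by linarith), mul_zero]
  · rw [primitive_eq_intervalIntegral hc hf, max_eq_right (by linarith)]
    have := intervalIntegral.norm_integral_le_of_norm_le_const (a := a) (b := u) (C := C)
      (f := f) fun x _ => hb x
    rwa [Real.norm_eq_abs, abs_of_nonneg (by linarith : 0 ≤ u - a)] at this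

theorem primitive_eq_of_le {f : ℝ → ℝ} (hc : Continuous f) {a b : ℝ}
    (hf : ∀ x ≤ a, f x = 0) (hf' : ∀ x, b ≤ x → f x = 0) {u : ℝ} (hu : b ≤ u) :
    primitive f u = primitive f b := by
  rw [primitive_eq_intervalIntegral hc hf, primitive_eq_intervalIntegral hc hf,
    ← intervalIntegral.integral_add_adjacent_intervals (hc.intervalIntegrable a b)
      (hc.intervalIntegrable b u)]
  have : ∫ x in b..u, f x = 0 := by
    rw [intervalIntegral.integral_congr (g := fun _ => (0 : ℝ))]
    · simp
    · intro x hx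
      rw [Set.uIcc_of_le hu] at hx
      exact hf' x hx.1
  rw [this, add_zero]

theorem abs_primitive_le_of_abs_le {f g : ℝ → ℝ} (hc : Continuous f) (hg : Continuous g) {a : ℝ}
    (hf : ∀ x ≤ a, f x = 0) (hga : ∀ x ≤ a, g x = 0) (hb : ∀ x, |f x| ≤ g x) (u : ℝ) :
    |primitive f u| ≤ primitive g u := by
  rcases le_total u a with h | h
  · rw [primitive_eq_zero hf h, primitive_eq_zero hga h, abs_zero]
  · rw [primitive_eq_intervalIntegral hc hf, primitive_eq_intervalIntegral hg hga]
    exact intervalIntegral.norm_integral_le_of_norm_le (f := f) h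
      (Eventually.of_forall fun x _ => hb x) (hg.intervalIntegrable _ _)

/-! ### The mollified functions of `U` -/

section Mollifier

set_option linter.unusedSectionVars false

variable {ρ : ℝ → ℝ} (hρ : IsMollifier ρ) {ε : ℝ} (hε : 0 < ε)
include hρ

theorem IsMollifier.eq_zero {x : ℝ} (hx : 1 ≤ |x|) : ρ x = 0 := by
  by_contra h
  have := hρ.support_subset (subset_tsupport ρ h)
  rw [Set.mem_Ioo, ← abs_lt] at this
  linarith

theorem continuous_rhoEps (ε : ℝ) : Continuous (rhoEps ρ ε) := by
  have := hρ.smooth.continuous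
  unfold rhoEps
  fun_prop

include hε

theorem rhoEps_eq_zero {x : ℝ} (hx : ε ≤ |x|) : rhoEps ρ ε x = 0 := by
  rw [rhoEps, hρ.eq_zero, zero_div]
  rw [abs_div, abs_of_pos hε, le_div_iff₀ hε, one_mul]
  exact hx

theorem rhoEps_eq_zero_of_le {x : ℝ} (hx : x ≤ -ε) : rhoEps ρ ε x = 0 :=
  rhoEps_eq_zero hρ hε (by rw [abs_of_nonpos (by linarith)]; linarith)

theorem rhoEps_eq_zero_of_ge {x : ℝ} (hx : ε ≤ x) : rhoEps ρ ε x = 0 :=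
  rhoEps_eq_zero hρ hε (by rw [abs_of_nonneg (by linarith)]; linarith)

theorem rhoEps_nonneg (x : ℝ) : 0 ≤ rhoEps ρ ε x := div_nonneg (hρ.nonneg _) hε.le

theorem integral_rhoEps : ∫ x, rhoEps ρ ε x = 1 := by
  simp only [rhoEps]
  rw [integral_div, Measure.integral_comp_div ρ ε, hρ.integral_eq_one, abs_of_pos hε, smul_eq_mul,
    mul_one, div_self hε.ne']

/-- The mollified Heaviside function. -/
theorem mollify_heaviside (u : ℝ) : mollify ρ ε heaviside u = primitive (rhoEps ρ ε) u := by
  rw [mollify, primitive, ← integral_indicator measurableSet_Iic]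
  congr 1
  ext t
  by_cases h : t ≤ u
  · simp [heaviside, h]
  · simp [heaviside, h]

theorem continuous_mul_rhoEps {f : ℝ → ℝ} (hf : Continuous f) :
    Continuous fun t => f t * rhoEps ρ ε t := hf.mul (continuous_rhoEps hρ ε)

theorem mul_rhoEps_eq_zero (f : ℝ → ℝ) {x : ℝ} (hx : x ≤ -ε) : f x * rhoEps ρ ε x = 0 := by
  rw [rhoEps_eq_zero_of_le hρ hε hx, mul_zero]

theorem integrableOn_mul_rhoEps {f : ℝ → ℝ} (hf : Continuous f) (s : Set ℝ) :
    IntegrableOn (fun t => f t * rhoEps ρ ε t) s := by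
  refine Integrable.integrableOn (Continuous.integrable_of_hasCompactSupport
    (continuous_mul_rhoEps hρ hε hf) ?_)
  refine HasCompactSupport.intro (isCompact_Icc (a := -ε) (b := ε)) fun x hx => ?_
  rw [rhoEps_eq_zero hρ hε, mul_zero]
  rw [Set.mem_Icc, ← abs_le, not_le] at hx
  exact hx.le

/-- Since (u - t)⁺ = (u - t) 1_{t ≤ u}, the convolution is a combination of primitives of moments of
ρ_ε. Differentiation in u then needs only the fundamental theorem of calculus. -/
theorem mollify_uPlus (u : ℝ) : mollify ρ ε uPlus u =
    u * primitive (rhoEps ρ ε) u - primitive (fun t => t * rhoEps ρ ε t) u := by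
  have h1 := integrableOn_mul_rhoEps hρ hε (continuous_const (y := u)) (Set.Iic u)
  have h2 := integrableOn_mul_rhoEps hρ hε continuous_id' (Set.Iic u)
  simp only [mollify, primitive]
  rw [← integral_const_mul, ← integral_sub h1 h2, ← integral_indicator measurableSet_Iic]
  congr 1
  ext t
  by_cases h : t ≤ u
  · simp [uPlus, h]
    ring
  · simp [uPlus, h, le_of_not_ge h]

theorem mollify_uPlus_sq (u : ℝ) : mollify ρ ε (fun u => uPlus u ^ 2) u =
    u ^ 2 * primitive (rhoEps ρ ε) u - 2 * u * primitive (fun t => t * rhoEps ρ ε t) u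
      + primitive (fun t => t ^ 2 * rhoEps ρ ε t) u := by
  have h1 := integrableOn_mul_rhoEps hρ hε (continuous_const (y := u ^ 2)) (Set.Iic u)
  have h2 := (integrableOn_mul_rhoEps hρ hε continuous_id' (Set.Iic u)).const_mul (2 * u)
  have h3 := integrableOn_mul_rhoEps hρ hε (continuous_pow 2) (Set.Iic u)
  simp only [mollify, primitive]
  rw [← integral_const_mul, ← integral_const_mul]
  rw [← integral_sub h1 h2]
  rw [← integral_add (show Integrable (fun t => u ^ 2 * rhoEps ρ ε t - 2 * u * (t * rhoEps ρ ε t))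
    (volume.restrict (Set.Iic u)) from h1.sub h2) h3, ← integral_indicator measurableSet_Iic]
  congr 1
  ext t
  by_cases h : t ≤ u
  · simp [uPlus, h]
    ring
  · simp [uPlus, h, le_of_not_ge h]

theorem hasDerivAt_mollify_heaviside (u : ℝ) :
    HasDerivAt (mollify ρ ε heaviside) (rhoEps ρ ε u) u := by
  rw [show mollify ρ ε heaviside = primitive (rhoEps ρ ε) from funext (mollify_heaviside hρ hε)]
  exact hasDerivAt_primitive (continuous_rhoEps hρ ε) (fun x => rhoEps_eq_zero_of_le hρ hε) u

theorem hasDerivAt_mollify_uPlus (u : ℝ) :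
    HasDerivAt (mollify ρ ε uPlus) (mollify ρ ε heaviside u) u := by
  rw [funext (mollify_uPlus hρ hε), mollify_heaviside hρ hε]
  have h0 := hasDerivAt_primitive (continuous_rhoEps hρ ε)
    (fun x => rhoEps_eq_zero_of_le hρ hε) u
  have h1 := hasDerivAt_primitive (continuous_mul_rhoEps hρ hε continuous_id')
    (fun x => mul_rhoEps_eq_zero hρ hε fun x => x) u
  refine (((hasDerivAt_id' u).fun_mul h0).fun_sub h1).congr_deriv ?_
  ring

theorem hasDerivAt_mollify_uPlus_sq (u : ℝ) :
    HasDerivAt (mollify ρ ε fun u => uPlus u ^ 2) (2 * mollify ρ ε uPlus u) u := by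
  rw [funext (mollify_uPlus_sq hρ hε), mollify_uPlus hρ hε]
  have h0 := hasDerivAt_primitive (continuous_rhoEps hρ ε)
    (fun x => rhoEps_eq_zero_of_le hρ hε) u
  have h1 := hasDerivAt_primitive (continuous_mul_rhoEps hρ hε continuous_id')
    (fun x => mul_rhoEps_eq_zero hρ hε fun x => x) u
  have h2 := hasDerivAt_primitive (continuous_mul_rhoEps hρ hε (continuous_pow 2))
    (fun x => mul_rhoEps_eq_zero hρ hε (fun x => x ^ 2)) u
  refine (((((hasDerivAt_id' u).fun_pow 2).fun_mul h0).fun_sub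
    (((hasDerivAt_id' u).const_mul 2).fun_mul h1)).fun_add h2).congr_deriv ?_
  simp
  ring

theorem continuous_mollify_heaviside : Continuous (mollify ρ ε heaviside) :=
  continuous_iff_continuousAt.mpr fun u => (hasDerivAt_mollify_heaviside hρ hε u).continuousAt

theorem continuous_mollify_uPlus : Continuous (mollify ρ ε uPlus) :=
  continuous_iff_continuousAt.mpr fun u => (hasDerivAt_mollify_uPlus hρ hε u).continuousAt

theorem mollify_heaviside_of_le {u : ℝ} (hu : u ≤ -ε) : mollify ρ ε heaviside u = 0 := by
  rw [mollify_heaviside hρ hε, primitive_eq_zero (fun x => rhoEps_eq_zero_of_le hρ hε) hu]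

theorem primitive_eq_integral {f : ℝ → ℝ} {u : ℝ} (hu : ε ≤ u) :
    primitive (fun t => f t * rhoEps ρ ε t) u = ∫ t, f t * rhoEps ρ ε t := by
  rw [primitive, setIntegral_eq_integral_of_forall_compl_eq_zero]
  intro x hx
  rw [rhoEps_eq_zero_of_ge hρ hε, mul_zero]
  rw [Set.mem_Iic, not_le] at hx
  linarith

theorem mollify_heaviside_of_ge {u : ℝ} (hu : ε ≤ u) : mollify ρ ε heaviside u = 1 := by
  have := primitive_eq_integral hρ hε (f := fun _ => 1) hu
  simp only [one_mul] at this
  rw [mollify_heaviside hρ hε, this, integral_rhoEps hρ hε]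

theorem mollify_heaviside_nonneg (u : ℝ) : 0 ≤ mollify ρ ε heaviside u := by
  rw [mollify_heaviside hρ hε, primitive]
  exact integral_nonneg fun x => rhoEps_nonneg hρ hε x

theorem mollify_heaviside_le_one (u : ℝ) : mollify ρ ε heaviside u ≤ 1 := by
  have h := monotone_of_deriv_nonneg (f := mollify ρ ε heaviside)
    (fun u => (hasDerivAt_mollify_heaviside hρ hε u).differentiableAt)
    (fun u => by
      rw [(hasDerivAt_mollify_heaviside hρ hε u).deriv]
      exact rhoEps_nonneg hρ hε u)
  rw [← mollify_heaviside_of_ge hρ hε (le_max_right u ε)]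
  exact h (le_max_left u ε)

theorem integral_id_mul_rhoEps : ∫ t, t * rhoEps ρ ε t = 0 := by
  have h := integral_neg_eq_self (fun t => t * rhoEps ρ ε t) volume
  have h2 : ∀ t, -t * rhoEps ρ ε (-t) = -(t * rhoEps ρ ε t) := by
    intro t
    rw [rhoEps, rhoEps, neg_div, hρ.even]
    ring
  simp only [h2, integral_neg] at h
  linarith

theorem mollify_uPlus_of_le {u : ℝ} (hu : u ≤ -ε) : mollify ρ ε uPlus u = 0 := by
  rw [mollify_uPlus hρ hε, primitive_eq_zero (fun x => rhoEps_eq_zero_of_le hρ hε) hu,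
    primitive_eq_zero (fun x => mul_rhoEps_eq_zero hρ hε fun x => x) hu]
  ring

/-- Beyond the support the mollification is exact, because ρ is even and its first moment vanishes.
-/
theorem mollify_uPlus_of_ge {u : ℝ} (hu : ε ≤ u) : mollify ρ ε uPlus u = u := by
  rw [mollify_uPlus hρ hε, ← mollify_heaviside hρ hε, mollify_heaviside_of_ge hρ hε hu,
    primitive_eq_integral hρ hε hu, integral_id_mul_rhoEps hρ hε]
  ring

theorem mollify_uPlus_mono : Monotone (mollify ρ ε uPlus) :=
  monotone_of_deriv_nonneg
    (fun u => (hasDerivAt_mollify_uPlus hρ hε u).differentiableAt)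
    (fun u => by
      rw [(hasDerivAt_mollify_uPlus hρ hε u).deriv]
      exact mollify_heaviside_nonneg hρ hε u)

theorem mollify_uPlus_nonneg (u : ℝ) : 0 ≤ mollify ρ ε uPlus u := by
  rw [← mollify_uPlus_of_le hρ hε (min_le_right u (-ε))]
  exact mollify_uPlus_mono hρ hε (min_le_left u (-ε))

theorem mollify_uPlus_le {u : ℝ} (hu : u ≤ ε) : mollify ρ ε uPlus u ≤ ε :=
  (mollify_uPlus_mono hρ hε hu).trans (mollify_uPlus_of_ge hρ hε le_rfl).le

theorem mollify_uPlus_sq_of_le {u : ℝ} (hu : u ≤ -ε) :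
    mollify ρ ε (fun u => uPlus u ^ 2) u = 0 := by
  rw [mollify_uPlus_sq hρ hε, primitive_eq_zero (fun x => rhoEps_eq_zero_of_le hρ hε) hu,
    primitive_eq_zero (fun x => mul_rhoEps_eq_zero hρ hε fun x => x) hu,
    primitive_eq_zero (fun x => mul_rhoEps_eq_zero hρ hε fun x => x ^ 2) hu]
  ring

/-- The zeroth moment is 1 and the first is 0, so the error is exactly the second moment of ρ_ε,
which lies between 0 and ε². -/
theorem mollify_uPlus_sq_of_ge {u : ℝ} (hu : ε ≤ u) :
    |mollify ρ ε (fun u => uPlus u ^ 2) u - u ^ 2| ≤ ε ^ 2 := by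
  rw [mollify_uPlus_sq hρ hε, ← mollify_heaviside hρ hε, mollify_heaviside_of_ge hρ hε hu,
    primitive_eq_integral hρ hε hu, integral_id_mul_rhoEps hρ hε]
  have h1 : primitive (fun t => t ^ 2 * rhoEps ρ ε t) u
      ≤ ε ^ 2 * ∫ t, rhoEps ρ ε t := by
    rw [primitive_eq_integral hρ hε hu, ← integral_const_mul]
    have i1 := integrableOn_mul_rhoEps hρ hε (continuous_pow 2) Set.univ
    have i2 := integrableOn_mul_rhoEps hρ hε (continuous_const (y := ε ^ 2)) Set.univ
    rw [integrableOn_univ] at i1 i2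
    refine integral_mono i1 i2 fun t => ?_
    show t ^ 2 * rhoEps ρ ε t ≤ ε ^ 2 * rhoEps ρ ε t
    rcases le_total ε |t| with h | h
    · rw [rhoEps_eq_zero hρ hε h, mul_zero, mul_zero]
    · refine mul_le_mul_of_nonneg_right ?_ (rhoEps_nonneg hρ hε t)
      rw [← sq_abs t]
      exact pow_le_pow_left₀ (abs_nonneg t) h 2
  have h2 : 0 ≤ primitive (fun t => t ^ 2 * rhoEps ρ ε t) u :=
    integral_nonneg fun t => mul_nonneg (sq_nonneg t) (rhoEps_nonneg hρ hε t)
  rw [integral_rhoEps hρ hε] at h1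
  rw [abs_le]
  constructor <;> nlinarith

theorem mollify_uPlus_sq_mono : Monotone (mollify ρ ε fun u => uPlus u ^ 2) :=
  monotone_of_deriv_nonneg
    (fun u => (hasDerivAt_mollify_uPlus_sq hρ hε u).differentiableAt)
    (fun u => by
      rw [(hasDerivAt_mollify_uPlus_sq hρ hε u).deriv]
      exact mul_nonneg zero_le_two (mollify_uPlus_nonneg hρ hε u))

theorem mollify_uPlus_sq_nonneg (u : ℝ) : 0 ≤ mollify ρ ε (fun u => uPlus u ^ 2) u := by
  rw [← mollify_uPlus_sq_of_le hρ hε (min_le_right u (-ε))]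
  exact mollify_uPlus_sq_mono hρ hε (min_le_left u (-ε))

theorem mollify_uPlus_sq_le {u : ℝ} (hu : u ≤ ε) :
    mollify ρ ε (fun u => uPlus u ^ 2) u ≤ 2 * ε ^ 2 := by
  have h := mollify_uPlus_sq_mono hρ hε hu
  have h2 := abs_le.mp (mollify_uPlus_sq_of_ge hρ hε (le_refl ε))
  have h3 : mollify ρ ε (fun u => uPlus u ^ 2) u ≤ mollify ρ ε (fun u => uPlus u ^ 2) ε := h
  linarith [h2.2]

theorem abs_mollify_uPlus_sub (u : ℝ) : |mollify ρ ε uPlus u - uPlus u| ≤ ε := by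
  rcases le_total u (-ε) with h | h
  · rw [mollify_uPlus_of_le hρ hε h, uPlus, max_eq_left (by linarith)]
    simpa using hε.le
  · rcases le_total u ε with h' | h'
    · have h1 := mollify_uPlus_nonneg hρ hε u
      have h2 := mollify_uPlus_le hρ hε h'
      have h3 : 0 ≤ uPlus u := le_max_left _ _
      have h4 : uPlus u ≤ ε := max_le hε.le h'
      rw [abs_le]
      constructor <;> linarith
    · rw [mollify_uPlus_of_ge hρ hε h', uPlus, max_eq_right (by linarith)]
      simpa using hε.le

theorem abs_mollify_uPlus_sq_sub (hε1 : ε ≤ 1) (u : ℝ) :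
    |mollify ρ ε (fun u => uPlus u ^ 2) u - mollify ρ ε uPlus u ^ 2| ≤ 2 * ε := by
  have hε2 : ε ^ 2 ≤ ε := by nlinarith
  rcases le_total u ε with h | h
  · have h1 := mollify_uPlus_nonneg hρ hε u
    have h2 := mollify_uPlus_le hρ hε h
    have h3 := mollify_uPlus_sq_nonneg hρ hε u
    have h4 := mollify_uPlus_sq_le hρ hε h
    rw [abs_le]
    constructor <;> nlinarith
  · rw [mollify_uPlus_of_ge hρ hε h]
    linarith [mollify_uPlus_sq_of_ge hρ hε h]

/-- This is wθ = w modulo O(ε): for u ≤ ε the factor w is at most ε, for u ≥ ε one has θ = 1. -/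
theorem abs_mollify_uPlus_mul_sub (u : ℝ) :
    |mollify ρ ε uPlus u * mollify ρ ε heaviside u - mollify ρ ε uPlus u| ≤ ε := by
  rcases le_total u ε with h | h
  · have h1 := mollify_uPlus_nonneg hρ hε u
    have h2 := mollify_uPlus_le hρ hε h
    have h3 := mollify_heaviside_nonneg hρ hε u
    have h4 := mollify_heaviside_le_one hρ hε u
    rw [abs_le]
    constructor <;> nlinarith
  · rw [mollify_heaviside_of_ge hρ hε h]
    simpa using hε.le

/-- This is Uθ = w modulo O(ε): both sides vanish for u ≤ -ε, are O(ε) in the transition layer, and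
agree for u ≥ ε. -/
theorem abs_mul_mollify_heaviside_sub (u : ℝ) :
    |u * mollify ρ ε heaviside u - mollify ρ ε uPlus u| ≤ 2 * ε := by
  rcases le_total u (-ε) with h' | h'
  · rw [mollify_uPlus_of_le hρ hε h', mollify_heaviside_of_le hρ hε h']
    simpa using hε.le
  rcases le_total u ε with h | h
  · have h1 := mollify_uPlus_nonneg hρ hε u
    have h2 := mollify_uPlus_le hρ hε h
    have h3 := mollify_heaviside_nonneg hρ hε u
    have h4 := mollify_heaviside_le_one hρ hε u
    rw [abs_le]
    constructor <;> nlinarith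
  · rw [mollify_heaviside_of_ge hρ hε h, mollify_uPlus_of_ge hρ hε h]
    simpa using hε.le

/-! ### The correction functions -/

theorem primitive_const_mul_rhoEps (c u : ℝ) :
    primitive (fun t => c * rhoEps ρ ε t) u = c * mollify ρ ε heaviside u := by
  rw [mollify_heaviside hρ hε, primitive, primitive, integral_const_mul]

theorem abs_primitive_mul_rhoEps_le {f : ℝ → ℝ} (hf : Continuous f)
    (hb : ∀ u, |u| ≤ ε → |f u| ≤ ε) (u : ℝ) :
    |primitive (fun t => f t * rhoEps ρ ε t) u| ≤ ε := by
  have h := abs_primitive_le_of_abs_le (a := -ε) (f := fun t => f t * rhoEps ρ ε t)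
    (g := fun t => ε * rhoEps ρ ε t)
    (continuous_mul_rhoEps hρ hε hf) (continuous_mul_rhoEps hρ hε continuous_const)
    (fun x => mul_rhoEps_eq_zero hρ hε f) (fun x => mul_rhoEps_eq_zero hρ hε fun _ => ε)
    (fun x => by
      rcases le_total ε |x| with h | h
      · rw [rhoEps_eq_zero hρ hε h]
        simp
      · rw [abs_mul, abs_of_nonneg (rhoEps_nonneg hρ hε x)]
        exact mul_le_mul_of_nonneg_right (hb x h) (rhoEps_nonneg hρ hε x)) u
  refine h.trans ?_
  rw [primitive_const_mul_rhoEps hρ hε]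
  exact mul_le_of_le_one_right hε.le (mollify_heaviside_le_one hρ hε u)

theorem continuous_sigmaEps : Continuous (sigmaEps ρ ε) := by
  have := continuous_mollify_heaviside hρ hε
  unfold sigmaEps
  fun_prop

theorem sigmaEps_of_le {u : ℝ} (hu : u ≤ -ε) : sigmaEps ρ ε u = 0 := by
  rw [sigmaEps, mollify_heaviside_of_le hρ hε hu]
  ring

theorem abs_sigmaEps_le (u : ℝ) : |sigmaEps ρ ε u| ≤ 1 := by
  have h3 := mollify_heaviside_nonneg hρ hε u
  have h4 := mollify_heaviside_le_one hρ hε u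
  rw [sigmaEps, abs_le]
  constructor <;> nlinarith

/-- The integrand is bounded by 1 and lives on an interval of length 2ε, as θ is 0 or 1 outside it.
-/
theorem abs_primitive_sigmaEps_le (u : ℝ) : |primitive (sigmaEps ρ ε) u| ≤ 2 * ε := by
  have hc := continuous_sigmaEps hρ hε
  have key : ∀ u ≤ ε, |primitive (sigmaEps ρ ε) u| ≤ 2 * ε := by
    intro u hu
    refine (abs_primitive_le hc (fun x => sigmaEps_of_le hρ hε) (abs_sigmaEps_le hρ hε) u).trans ?_
    rw [one_mul]
    exact max_le (by linarith) (by linarith)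
  rcases le_total u ε with h | h
  · exact key u h
  · rw [primitive_eq_of_le hc (fun x => sigmaEps_of_le hρ hε) (b := ε) (fun x hx => by
      rw [sigmaEps, mollify_heaviside_of_ge hρ hε hx]
      ring) h]
    exact key ε le_rfl

end Mollifier

/-- What is needed of a correction function: `a` is a second primitive of `f`, it vanishes for
`u ≤ -ε`, and it is small with its first derivative. -/
structure IsCorrector (ε : ℝ) (a f : ℝ → ℝ) : Prop where
  hasDerivAt : ∀ u, HasDerivAt a (deriv a u) u
  hasDerivAt_deriv : ∀ u, HasDerivAt (deriv a) (f u) u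
  eq_zero : ∀ u ≤ -ε, a u = 0
  deriv_eq_zero : ∀ u ≤ -ε, deriv a u = 0
  abs_le : ∀ u, |a u| ≤ 2 * ε * (|u| + ε)
  abs_deriv_le : ∀ u, |deriv a u| ≤ 2 * ε

/-- The bound on the second primitive comes from integrating 2ε over an interval of length at most
|u| + ε. For |u| ≤ ε it gives O(ε²), which still beats the factor 1/ε of ρ_ε. -/
theorem isCorrector_primitive {ε : ℝ} (hε : 0 < ε) {f : ℝ → ℝ} (hf : Continuous f)
    (h0 : ∀ u ≤ -ε, f u = 0) (h1 : ∀ u, |primitive f u| ≤ 2 * ε) :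
    IsCorrector ε (primitive (primitive f)) f := by
  have hp0 : ∀ u ≤ -ε, primitive f u = 0 := fun u hu => primitive_eq_zero h0 hu
  have hpc := continuous_primitive hf h0
  have hd : deriv (primitive (primitive f)) = primitive f :=
    funext fun u => (hasDerivAt_primitive hpc hp0 u).deriv
  refine ⟨fun u => ?_, fun u => ?_, fun u hu => primitive_eq_zero hp0 hu, ?_, fun u => ?_, ?_⟩
  · rw [hd]
    exact hasDerivAt_primitive hpc hp0 u
  · rw [hd]
    exact hasDerivAt_primitive hf h0 u
  · rwa [hd]
  · refine (abs_primitive_le hpc hp0 h1 u).trans ?_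
    refine mul_le_mul_of_nonneg_left (max_le (by positivity) ?_) (by positivity)
    linarith [le_abs_self u]
  · rwa [hd]

theorem isCorrector_kappaEps {ρ : ℝ → ℝ} (hρ : IsMollifier ρ) {ε : ℝ} (hε : 0 < ε) :
    IsCorrector ε (kappaEps ρ ε) (fun u => mollify ρ ε uPlus u * rhoEps ρ ε u) := by
  have hw := continuous_mollify_uPlus hρ hε
  refine isCorrector_primitive hε (continuous_mul_rhoEps hρ hε hw)
    (fun x => mul_rhoEps_eq_zero hρ hε _) fun u => ?_
  refine (abs_primitive_mul_rhoEps_le hρ hε hw (fun u hu => ?_) u).trans (by linarith)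
  rw [abs_of_nonneg (mollify_uPlus_nonneg hρ hε u)]
  exact mollify_uPlus_le hρ hε (abs_le.mp hu).2

theorem isCorrector_zetaEps {ρ : ℝ → ℝ} (hρ : IsMollifier ρ) {ε : ℝ} (hε : 0 < ε) :
    IsCorrector ε (zetaEps ρ ε) (sigmaEps ρ ε) :=
  isCorrector_primitive hε (continuous_sigmaEps hρ hε) (fun _ => sigmaEps_of_le hρ hε)
    (abs_primitive_sigmaEps_le hρ hε)

theorem isCorrector_iotaEps {ρ : ℝ → ℝ} (hρ : IsMollifier ρ) {ε : ℝ} (hε : 0 < ε) :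
    IsCorrector ε (iotaEps ρ ε) (fun u => u * rhoEps ρ ε u) := by
  refine isCorrector_primitive hε (continuous_mul_rhoEps hρ hε continuous_id')
    (fun x => mul_rhoEps_eq_zero hρ hε fun t => t) fun u => ?_
  exact (abs_primitive_mul_rhoEps_le hρ hε continuous_id' (fun _ hu => hu) u).trans (by linarith)

theorem exists_rhoEps_bound {ρ : ℝ → ℝ} (hρ : IsMollifier ρ) :
    ∃ C, 0 ≤ C ∧ ∀ ε, 0 < ε → ∀ u, rhoEps ρ ε u * ε ≤ C := by
  obtain ⟨C, hC⟩ := (isCompact_Icc (a := (-1 : ℝ)) (b := 1)).exists_bound_of_continuousOn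
    hρ.smooth.continuous.continuousOn
  have hC0 : 0 ≤ C := (norm_nonneg _).trans (hC 0 (by simp))
  refine ⟨C, hC0, fun ε hε u => ?_⟩
  rw [rhoEps, div_mul_cancel₀ _ hε.ne']
  rcases le_total 1 |u / ε| with h | h
  · rw [hρ.eq_zero h]
    exact hC0
  · exact (le_abs_self _).trans (hC (u / ε) (by rwa [Set.mem_Icc, ← abs_le]))

end

section

/-! ### Two-jets -/

/-- A formal two-jet in four variables: a value, first and second derivatives. -/
@[ext] structure Jet (R : Type*) where
  v : R
  d : Fin 4 → R
  dd : Fin 4 → Fin 4 → R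

namespace Jet

variable {R T : Type*} [CommRing R] [CommRing T]

instance : Add (Jet R) :=
  ⟨fun a b => ⟨a.v + b.v, fun i => a.d i + b.d i, fun i j => a.dd i j + b.dd i j⟩⟩

instance : Mul (Jet R) :=
  ⟨fun a b => ⟨a.v * b.v, fun i => a.v * b.d i + a.d i * b.v,
    fun i j => a.v * b.dd i j + a.d i * b.d j + a.d j * b.d i + a.dd i j * b.v⟩⟩

/-- The jet of a constant. -/
def const (c : R) : Jet R := ⟨c, fun _ => 0, fun _ _ => 0⟩

/-- The jet of the reciprocal, `y` being the reciprocal of the value. -/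
def inv (a : Jet R) (y : R) : Jet R :=
  ⟨y, fun i => -y ^ 2 * a.d i, fun i j => 2 * y ^ 3 * a.d i * a.d j - y ^ 2 * a.dd i j⟩

/-- The image of a jet under a ring homomorphism. -/
def map (φ : R →+* T) (a : Jet R) : Jet T :=
  ⟨φ a.v, fun i => φ (a.d i), fun i j => φ (a.dd i j)⟩

@[simp] theorem add_v (a b : Jet R) : (a + b).v = a.v + b.v := rfl
@[simp] theorem add_d (a b : Jet R) (i : Fin 4) : (a + b).d i = a.d i + b.d i := rfl
@[simp] theorem add_dd (a b : Jet R) (i j : Fin 4) :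
    (a + b).dd i j = a.dd i j + b.dd i j := rfl
@[simp] theorem mul_v (a b : Jet R) : (a * b).v = a.v * b.v := rfl
@[simp] theorem mul_d (a b : Jet R) (i : Fin 4) :
    (a * b).d i = a.v * b.d i + a.d i * b.v := rfl
@[simp] theorem mul_dd (a b : Jet R) (i j : Fin 4) : (a * b).dd i j =
    a.v * b.dd i j + a.d i * b.d j + a.d j * b.d i + a.dd i j * b.v := rfl
@[simp] theorem const_v (c : R) : (const c).v = c := rfl
@[simp] theorem const_d (c : R) (i : Fin 4) : (const c).d i = 0 := rfl
@[simp] theorem const_dd (c : R) (i j : Fin 4) : (const c).dd i j = 0 := rfl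
@[simp] theorem inv_v (a : Jet R) (y : R) : (inv a y).v = y := rfl
@[simp] theorem inv_d (a : Jet R) (y : R) (i : Fin 4) :
    (inv a y).d i = -y ^ 2 * a.d i := rfl
@[simp] theorem inv_dd (a : Jet R) (y : R) (i j : Fin 4) :
    (inv a y).dd i j = 2 * y ^ 3 * a.d i * a.d j - y ^ 2 * a.dd i j := rfl
@[simp] theorem map_v (φ : R →+* T) (a : Jet R) : (map φ a).v = φ a.v := rfl
@[simp] theorem map_d (φ : R →+* T) (a : Jet R) (i : Fin 4) :
    (map φ a).d i = φ (a.d i) := rfl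
@[simp] theorem map_dd (φ : R →+* T) (a : Jet R) (i j : Fin 4) :
    (map φ a).dd i j = φ (a.dd i j) := rfl

theorem map_add (φ : R →+* T) (a b : Jet R) : map φ (a + b) = map φ a + map φ b := by
  ext <;> simp

theorem map_mul (φ : R →+* T) (a b : Jet R) : map φ (a * b) = map φ a * map φ b := by
  ext <;> simp

theorem map_const (φ : R →+* T) (c : R) : map φ (const c) = const (φ c) := by
  ext <;> simp

theorem map_inv (φ : R →+* T) (a : Jet R) (y : R) :
    map φ (inv a y) = inv (map φ a) (φ y) := by
  ext <;> simp [map_ofNat]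

end Jet

/-- `f` is `C¹` near `p`, twice differentiable at `p`, and its two-jet there is `J`. -/
structure HasJet (f : (Fin 4 → ℝ) → ℝ) (p : Fin 4 → ℝ) (J : Jet ℝ) : Prop where
  contDiffAt : ContDiffAt ℝ 1 f p
  differentiableAt : DifferentiableAt ℝ (fderiv ℝ f) p
  val : f p = J.v
  fst : ∀ i, pd i f p = J.d i
  snd : ∀ i j, pd i (pd j f) p = J.dd i j

namespace HasJet

variable {f g : (Fin 4 → ℝ) → ℝ} {p : Fin 4 → ℝ} {J J' : Jet ℝ}

theorem eventually_differentiableAt (h : HasJet f p J) :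
    ∀ᶠ q in 𝓝 p, DifferentiableAt ℝ f q := by
  filter_upwards [h.contDiffAt.eventually (by simp)] with q hq
  exact hq.differentiableAt (by simp)

theorem differentiableAt_self (h : HasJet f p J) : DifferentiableAt ℝ f p :=
  h.eventually_differentiableAt.self_of_nhds

theorem differentiableAt_pd (h : HasJet f p J) (i : Fin 4) : DifferentiableAt ℝ (pd i f) p :=
  h.differentiableAt.clm_apply (differentiableAt_const _)

theorem congr (h : HasJet f p J) (hg : g =ᶠ[𝓝 p] f) : HasJet g p J := by
  have h1 : fderiv ℝ g =ᶠ[𝓝 p] fderiv ℝ f := hg.fderiv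
  have h2 : ∀ j, pd j g =ᶠ[𝓝 p] pd j f := fun j => by
    filter_upwards [h1] with q hq
    simp [pd, hq]
  exact ⟨h.contDiffAt.congr_of_eventuallyEq hg, h.differentiableAt.congr_of_eventuallyEq h1,
    hg.self_of_nhds.trans h.val, fun i => (h2 i).self_of_nhds.trans (h.fst i),
    fun i j => by rw [pd, (h2 j).fderiv_eq]; exact h.snd i j⟩

theorem const (c : ℝ) (p : Fin 4 → ℝ) : HasJet (fun _ => c) p (Jet.const c) := by
  refine ⟨contDiffAt_const, ?_, rfl, fun i => by simp [pd], fun i j => ?_⟩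
  · simp
  · have : pd j (fun _ : Fin 4 → ℝ => c) = fun _ => 0 := by ext q; simp [pd]
    rw [this]; simp [pd]

theorem add (hf : HasJet f p J) (hg : HasJet g p J') :
    HasJet (fun q => f q + g q) p (J + J') := by
  have h1 : fderiv ℝ (fun q => f q + g q) =ᶠ[𝓝 p] fun q => fderiv ℝ f q + fderiv ℝ g q := by
    filter_upwards [hf.eventually_differentiableAt, hg.eventually_differentiableAt] with q h1 h2
    exact fderiv_fun_add h1 h2
  refine ⟨hf.contDiffAt.add hg.contDiffAt,
    (hf.differentiableAt.add hg.differentiableAt).congr_of_eventuallyEq h1,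
    by simp [hf.val, hg.val], fun i => ?_, fun i j => ?_⟩
  · rw [pd, h1.self_of_nhds]
    simp [← hf.fst, ← hg.fst, pd]
  · have h2 : pd j (fun q => f q + g q) =ᶠ[𝓝 p] fun q => pd j f q + pd j g q := by
      filter_upwards [h1] with q hq
      simp [pd, hq]
    rw [pd, h2.fderiv_eq, fderiv_fun_add (hf.differentiableAt_pd j) (hg.differentiableAt_pd j)]
    simp [← hf.snd, ← hg.snd, pd]

theorem mul (hf : HasJet f p J) (hg : HasJet g p J') :
    HasJet (fun q => f q * g q) p (J * J') := by
  have h1 : fderiv ℝ (fun q => f q * g q) =ᶠ[𝓝 p]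
      fun q => f q • fderiv ℝ g q + g q • fderiv ℝ f q := by
    filter_upwards [hf.eventually_differentiableAt, hg.eventually_differentiableAt] with q h1 h2
    exact fderiv_fun_mul h1 h2
  have hfd := hf.differentiableAt_self
  have hgd := hg.differentiableAt_self
  refine ⟨hf.contDiffAt.mul hg.contDiffAt,
    ((hfd.smul hg.differentiableAt).add (hgd.smul hf.differentiableAt)).congr_of_eventuallyEq h1,
    by simp [hf.val, hg.val], fun i => ?_, fun i j => ?_⟩
  · rw [pd, h1.self_of_nhds]
    simp [← hf.fst, ← hg.fst, ← hf.val, ← hg.val, pd]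
    ring
  · have h2 : pd j (fun q => f q * g q) =ᶠ[𝓝 p] fun q => f q * pd j g q + g q * pd j f q := by
      filter_upwards [h1] with q hq
      simp [pd, hq]
    rw [pd, h2.fderiv_eq, fderiv_fun_add (hfd.fun_mul (hg.differentiableAt_pd j))
      (hgd.fun_mul (hf.differentiableAt_pd j)), fderiv_fun_mul hfd (hg.differentiableAt_pd j),
      fderiv_fun_mul hgd (hf.differentiableAt_pd j)]
    simp only [Jet.mul_dd, ← hf.snd, ← hg.snd, ← hf.fst, ← hg.fst, ← hf.val, ← hg.val]
    simp [pd]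
    ring

theorem inv (hf : HasJet f p J) {y : ℝ} (hy : J.v * y = 1) :
    HasJet (fun q => (f q)⁻¹) p (J.inv y) := by
  have h0 : f p ≠ 0 := by rw [hf.val]; exact left_ne_zero_of_mul_eq_one hy
  have hy' : y = (f p)⁻¹ := by rw [hf.val]; exact eq_inv_of_mul_eq_one_right hy
  have hfd := hf.differentiableAt_self
  have h1 : fderiv ℝ (fun q => (f q)⁻¹) =ᶠ[𝓝 p]
      fun q => (-((f q)⁻¹ * (f q)⁻¹)) • fderiv ℝ f q := by
    filter_upwards [hf.eventually_differentiableAt,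
      hfd.continuousAt.eventually_ne h0] with q h1 h2
    have := ((hasDerivAt_inv h2).comp_hasFDerivAt q h1.hasFDerivAt).fderiv
    rw [show (fun q => (f q)⁻¹) = Inv.inv ∘ f from rfl, this]
    congr 1
    field_simp
  have hi : DifferentiableAt ℝ (fun q => (f q)⁻¹) p := hfd.inv h0
  have hii : DifferentiableAt ℝ (fun q => -((f q)⁻¹ * (f q)⁻¹)) p := (hi.mul hi).neg
  have hv : fderiv ℝ (fun q => (f q)⁻¹) p = (-((f p)⁻¹ * (f p)⁻¹)) • fderiv ℝ f p :=
    h1.self_of_nhds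
  refine ⟨hf.contDiffAt.inv h0, (hii.smul hf.differentiableAt).congr_of_eventuallyEq h1,
    hy'.symm, fun i => ?_, fun i j => ?_⟩
  · rw [pd, hv]
    simp only [Jet.inv_d, ← hf.fst, pd, hy', smul_apply, smul_eq_mul]
    ring
  · have h2 : pd j (fun q => (f q)⁻¹) =ᶠ[𝓝 p] fun q => (-((f q)⁻¹ * (f q)⁻¹)) * pd j f q := by
      filter_upwards [h1] with q hq
      simp [pd, hq]
    rw [pd, h2.fderiv_eq, fderiv_fun_mul hii (hf.differentiableAt_pd j), fderiv_fun_neg,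
      fderiv_fun_mul hi hi, hv]
    simp only [Jet.inv_dd, ← hf.snd, ← hf.fst, hy']
    simp [pd]
    ring

/-- Second derivatives are symmetric. -/
theorem symm (hf : HasJet f p J) (i j : Fin 4) : J.dd i j = J.dd j i := by
  have h := second_derivative_symmetric_of_eventually (𝕜 := ℝ)
    (hf.eventually_differentiableAt.mono fun q hq => hq.hasFDerivAt)
    hf.differentiableAt.hasFDerivAt (Pi.single i 1) (Pi.single j 1)
  have key : ∀ i j, J.dd i j = fderiv ℝ (fderiv ℝ f) p (Pi.single i 1) (Pi.single j 1) := by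
    intro i j
    rw [← hf.snd, pd, show pd j f = fun q => fderiv ℝ f q (Pi.single j 1) from rfl,
      fderiv_clm_apply hf.differentiableAt (differentiableAt_const _)]
    simp
  rw [key, key, h]

end HasJet

/-- The jet of a coordinate function. -/
theorem hasJet_coord (k : Fin 4) (p : Fin 4 → ℝ) :
    HasJet (fun q => q k) p ⟨p k, fun i => if i = k then 1 else 0, fun _ _ => 0⟩ := by
  have h1 : ∀ q, fderiv ℝ (fun q : Fin 4 → ℝ => q k) q = ContinuousLinearMap.proj k := fun q =>
    (ContinuousLinearMap.proj (R := ℝ) (φ := fun _ : Fin 4 => ℝ) k).fderiv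
  have h3 : ∀ i q, pd i (fun q : Fin 4 → ℝ => q k) q = if i = k then 1 else 0 := by
    intro i q
    simp [pd, h1, Pi.single_apply, eq_comm]
  refine ⟨by fun_prop, ?_, rfl, fun i => h3 i p, fun i j => ?_⟩
  · rw [show fderiv ℝ (fun q : Fin 4 → ℝ => q k) = fun _ => ContinuousLinearMap.proj k from
      funext h1]
    exact differentiableAt_const _
  · rw [show pd j (fun q : Fin 4 → ℝ => q k) = fun _ => if j = k then 1 else 0 from funext (h3 j)]
    simp [pd]

/-- The jet of a function of the coordinate `U`. -/
theorem hasJet_comp_zero {a a1 : ℝ → ℝ} {a2 : ℝ} (p : Fin 4 → ℝ)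
    (h : ∀ u, HasDerivAt a (a1 u) u) (hc : Continuous a1) (h1 : HasDerivAt a1 a2 (p 0)) :
    HasJet (fun q => a (q 0)) p ⟨a (p 0), fun i => if i = 0 then a1 (p 0) else 0,
      fun i j => if i = 0 then (if j = 0 then a2 else 0) else 0⟩ := by
  set π : (Fin 4 → ℝ) →L[ℝ] ℝ := ContinuousLinearMap.proj 0 with hπ
  have hf : ∀ q : Fin 4 → ℝ, HasFDerivAt (fun q : Fin 4 → ℝ => a (q 0)) (a1 (q 0) • π) q :=
    fun q => (h (q 0)).comp_hasFDerivAt q π.hasFDerivAt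
  have hf' : fderiv ℝ (fun q : Fin 4 → ℝ => a (q 0)) = fun q => a1 (q 0) • π :=
    funext fun q => (hf q).fderiv
  have h1' : HasFDerivAt (fun q : Fin 4 → ℝ => a1 (q 0)) (a2 • π) p :=
    h1.comp_hasFDerivAt p π.hasFDerivAt
  have hc1 : ContDiff ℝ 1 a := by
    rw [contDiff_one_iff_deriv]
    exact ⟨fun u => (h u).differentiableAt, by rwa [show deriv a = a1 from
      funext fun u => (h u).deriv]⟩
  refine ⟨(hc1.comp π.contDiff).contDiffAt, ?_, rfl, fun i => ?_, fun i j => ?_⟩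
  · rw [hf']
    exact h1'.differentiableAt.smul_const π
  · simp only [pd, hf']
    by_cases hi : i = 0 <;> simp [hπ, hi, eq_comm]
  · have : pd j (fun q : Fin 4 → ℝ => a (q 0)) = fun q => a1 (q 0) * (if j = 0 then 1 else 0) := by
      ext q
      simp only [pd, hf']
      by_cases hi : j = 0 <;> simp [hπ, hi, eq_comm]
    rw [this, pd, (h1'.mul_const _).fderiv]
    by_cases hi : i = 0 <;> by_cases hj : j = 0 <;>
      simp [hπ, hi, hj, eq_comm]

/-- `zCoord` as a continuous linear map. -/
def zL : (Fin 4 → ℝ) →L[ℝ] ℂ :=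
  (ContinuousLinearMap.proj 2).smulRight 1 + (ContinuousLinearMap.proj 3).smulRight Complex.I

theorem zL_apply (p : Fin 4 → ℝ) : zL p = zCoord p := by
  apply Complex.ext <;> simp [zL, zCoord]

/-- The images of the coordinate vectors under `zCoord`. -/
def zDir : Fin 4 → ℂ := ![0, 0, 1, Complex.I]

theorem zL_single (i : Fin 4) : zL (Pi.single i 1) = zDir i := by
  fin_cases i <;> simp [zL, zDir]

/-- The jet of a function of `Z`. -/
theorem hasJet_comp_z {b : ℂ → ℝ} (p : Fin 4 → ℝ) (hb : ContDiffAt ℝ 1 b (zCoord p))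
    (hd : DifferentiableAt ℝ (fderiv ℝ b) (zCoord p)) :
    HasJet (fun q => b (zCoord q)) p ⟨b (zCoord p), fun i => fderiv ℝ b (zCoord p) (zDir i),
      fun i j => fderiv ℝ (fun z => fderiv ℝ b z (zDir j)) (zCoord p) (zDir i)⟩ := by
  simp only [← zL_apply] at *
  have hev : ∀ᶠ q in 𝓝 p, DifferentiableAt ℝ b (zL q) := by
    apply zL.continuous.continuousAt.eventually
    filter_upwards [hb.eventually (by simp)] with q hq
    exact hq.differentiableAt (by simp)
  have hf : fderiv ℝ (fun q => b (zL q)) =ᶠ[𝓝 p] fun q => (fderiv ℝ b (zL q)).comp zL := by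
    filter_upwards [hev] with q hq
    exact (hq.hasFDerivAt.comp q zL.hasFDerivAt).fderiv
  have hd' : DifferentiableAt ℝ (fun q => fderiv ℝ b (zL q)) p :=
    hd.comp p zL.differentiableAt
  refine ⟨hb.comp p zL.contDiff.contDiffAt, ?_, rfl, fun i => ?_, fun i j => ?_⟩
  · exact (hd'.clm_comp (differentiableAt_const zL)).congr_of_eventuallyEq hf
  · rw [pd, hf.self_of_nhds]
    simp [zL_single]
  · have h2 : pd j (fun q => b (zL q)) =ᶠ[𝓝 p] fun q => fderiv ℝ b (zL q) (zDir j) := by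
      filter_upwards [hf] with q hq
      simp [pd, hq, zL_single]
    rw [pd, h2.fderiv_eq]
    have h3 : DifferentiableAt ℝ (fun z => fderiv ℝ b z (zDir j)) (zL p) :=
      hd.clm_apply (differentiableAt_const _)
    have h4 := (h3.hasFDerivAt.comp p zL.hasFDerivAt).fderiv
    rw [show (fun q => fderiv ℝ b (zL q) (zDir j)) = (fun z => fderiv ℝ b z (zDir j)) ∘ zL from rfl,
      h4]
    simp [zL_single]

end

section

/-! ### Ricci curvature of formal two-jets of metrics, and conformal change -/

section Formal

variable {R : Type*} [CommRing R]

/-- Christoffel symbols of the first kind, where `∂_k m_{ij} = 2 e_{kij}`. -/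
def chr (e : Fin 4 → Fin 4 → Fin 4 → R) (i j k : Fin 4) : R := e i j k + e j i k - e k i j

/-- The Riemann tensor of the metric jet `∂_k m_{ij} = 2 e_{kij}`,
`∂_k ∂_l m_{ij} = 2 ee_{klij}` with inverse `gi`. -/
def riem (gi : Fin 4 → Fin 4 → R) (e : Fin 4 → Fin 4 → Fin 4 → R)
    (ee : Fin 4 → Fin 4 → Fin 4 → Fin 4 → R) (k i j l : Fin 4) : R :=
  ee k j i l + ee i l k j - ee k l i j - ee i j k l +
    ∑ s, ∑ t, gi s t * (chr e k j s * chr e i l t - chr e k l s * chr e i j t)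

/-- The Ricci tensor of a metric jet. -/
def ric (gi : Fin 4 → Fin 4 → R) (e : Fin 4 → Fin 4 → Fin 4 → R)
    (ee : Fin 4 → Fin 4 → Fin 4 → Fin 4 → R) (i j : Fin 4) : R :=
  ∑ k, ∑ l, gi k l * riem gi e ee k i j l

/-- The Hessian of a function with jet `a`. -/
def hess (gi : Fin 4 → Fin 4 → R) (e : Fin 4 → Fin 4 → Fin 4 → R) (a : Jet R)
    (i j : Fin 4) : R :=
  a.dd i j - ∑ s, ∑ t, gi s t * (a.d s * chr e i j t)

/-- The squared norm of the gradient of a function with jet `a`. -/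
def gradSq (gi : Fin 4 → Fin 4 → R) (a : Jet R) : R :=
  ∑ s, ∑ t, gi s t * (a.d s * a.d t)

end Formal

theorem pd_christoffel {g : (Fin 4 → ℝ) → Matrix (Fin 4) (Fin 4) ℝ} {p : Fin 4 → ℝ}
    {J : Fin 4 → Fin 4 → Jet ℝ} (h : ∀ i j, HasJet (fun q => g q i j) p (J i j))
    (i j k l : Fin 4) : pd i (christoffel g j k l) p =
      ((J k l).dd i j + (J j l).dd i k - (J j k).dd i l) / 2 := by
  have h1 := (h k l).differentiableAt_pd j
  have h2 := (h j l).differentiableAt_pd k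
  have h3 := (h j k).differentiableAt_pd l
  rw [pd, show christoffel g j k l = fun q => (pd j (fun q => g q k l) q
      + pd k (fun q => g q j l) q - pd l (fun q => g q j k) q) * 2⁻¹ from by
    ext q; simp [christoffel, div_eq_mul_inv], fderiv_mul_const ((h1.fun_add h2).fun_sub h3),
    fderiv_fun_sub (h1.fun_add h2) h3, fderiv_fun_add h1 h2]
  simp only [← (h _ _).snd]
  simp [pd]
  ring

/-- The Ricci tensor of `g = m / P²`. -/
theorem ricci_conformal {g : (Fin 4 → ℝ) → Matrix (Fin 4) (Fin 4) ℝ} {p : Fin 4 → ℝ}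
    {μ : Fin 4 → Fin 4 → Jet ℝ} {P : Jet ℝ} {y : ℝ}
    (hg : ∀ i j, HasJet (fun q => g q i j) p (P.inv y * P.inv y * (Jet.const 2 * μ i j)))
    (hy : P.v * y = 1) (hμ : ∀ i j, μ i j = μ j i) (hPs : ∀ i j, P.dd i j = P.dd j i)
    (hμs : ∀ i j k l, (μ i j).dd k l = (μ i j).dd l k)
    {gi : Matrix (Fin 4) (Fin 4) ℝ} (hgi : gi.IsSymm)
    (hinv : Matrix.of (fun i j => 2 * (μ i j).v) * gi = 1) (i j : Fin 4) :
    ricci g p i j = ric gi (fun k i j => (μ i j).d k) (fun k l i j => (μ i j).dd k l) i j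
      + 2 * y * hess gi (fun k i j => (μ i j).d k) P i j
      + (y * (∑ k, ∑ l, gi k l * hess gi (fun k i j => (μ i j).d k) P k l)
        - 3 * y ^ 2 * gradSq gi P) * (2 * (μ i j).v) := by
  set e : Fin 4 → Fin 4 → Fin 4 → ℝ := fun k i j => (μ i j).d k with he
  set m : Matrix (Fin 4) (Fin 4) ℝ := Matrix.of (fun i j => 2 * (μ i j).v) with hm
  have hms : ∀ i j, m i j = m j i := fun i j => by simp [hm, hμ i j]
  have hg_eq : g p = y ^ 2 • m := by
    ext a b
    rw [(hg a b).val]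
    simp only [hm, Jet.mul_v, Jet.inv_v, Jet.const_v, Matrix.smul_apply, Matrix.of_apply,
      smul_eq_mul]
    ring
  have hginv : (g p)⁻¹ = P.v ^ 2 • gi := by
    apply Matrix.inv_eq_right_inv
    rw [hg_eq, Matrix.smul_mul, Matrix.mul_smul, hinv, smul_smul, ← mul_pow, mul_comm y, hy]
    simp
  have hchr : ∀ i j k, christoffel g i j k p = y ^ 2 * (chr e i j k
      - y * (P.d i * m j k + P.d j * m i k - P.d k * m i j)) := by
    intro i j k
    simp only [christoffel, (hg _ _).fst, he, chr, hm]
    simp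
    ring
  have hinv' : gi * m = 1 := mul_eq_one_comm.mp hinv
  have hBl : ∀ (a : Fin 4) (v : Fin 4 → ℝ), m a ⬝ᵥ (gi *ᵥ v) = v a := by
    intro a v
    have : (m *ᵥ (gi *ᵥ v)) a = v a := by rw [Matrix.mulVec_mulVec, hinv, Matrix.one_mulVec]
    exact this
  have hBs : ∀ u v : Fin 4 → ℝ, u ⬝ᵥ (gi *ᵥ v) = v ⬝ᵥ (gi *ᵥ u) := by
    intro u v
    rw [Matrix.dotProduct_mulVec, ← Matrix.mulVec_transpose, hgi.eq, dotProduct_comm]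
  have hBr : ∀ (a : Fin 4) (v : Fin 4 → ℝ), v ⬝ᵥ (gi *ᵥ (m a)) = v a := by
    intro a v
    rw [hBs, hBl]
  have hB : ∀ u v : Fin 4 → ℝ, ∑ s, ∑ t, gi s t * (u s * v t) = u ⬝ᵥ (gi *ᵥ v) := by
    intro u v
    simp only [dotProduct, Matrix.mulVec, Finset.mul_sum]
    exact Finset.sum_congr rfl fun s _ => Finset.sum_congr rfl fun t _ => by ring
  have hquad : ∀ i j k l, ∑ s, ∑ t, (g p)⁻¹ s t *
      (christoffel g i j s p * christoffel g k l t p) = y ^ 2 *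
      ((chr e i j - y • (P.d i • m j + P.d j • m i - m i j • P.d)) ⬝ᵥ
        (gi *ᵥ (chr e k l - y • (P.d k • m l + P.d l • m k - m k l • P.d)))) := by
    intro i j k l
    rw [← hB, Finset.mul_sum]
    refine Finset.sum_congr rfl fun s _ => ?_
    rw [Finset.mul_sum]
    refine Finset.sum_congr rfl fun t _ => ?_
    simp only [hginv, hchr, Matrix.smul_apply, smul_eq_mul, Pi.sub_apply, Pi.smul_apply,
      Pi.add_apply]
    -- The powers combine as P² y⁴ = y²; the factor P y + 1 turns P y = 1 into (P y)² = 1.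
    linear_combination (gi s t) * y ^ 2 * (P.v * y + 1) *
      ((chr e i j s - y * (P.d i * m j s + P.d j * m i s - m i j * P.d s)) *
       (chr e k l t - y * (P.d k * m l t + P.d l * m k t - m k l * P.d t))) * hy
  have hH : ∀ i j, hess gi e P i j = P.dd i j - P.d ⬝ᵥ (gi *ᵥ (chr e i j)) := by
    intro i j
    unfold hess
    rw [hB]
  have hN : gradSq gi P = P.d ⬝ᵥ (gi *ᵥ P.d) := by
    unfold gradSq
    rw [hB]
  -- Conformal change of Riemann: the correction is, up to sign, the Kulkarni–Nomizu product of m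
  -- with T = -y Hess P + (y²/2)|∇P|² m.
  have hriem : ∀ k i j l, riemann g k i j l p = y ^ 2 * (riem gi e
      (fun k l i j => (μ i j).dd k l) k i j l
      + m i l * (-y * hess gi e P k j + y ^ 2 * gradSq gi P / 2 * m k j)
      + m k j * (-y * hess gi e P i l + y ^ 2 * gradSq gi P / 2 * m i l)
      - m i j * (-y * hess gi e P k l + y ^ 2 * gradSq gi P / 2 * m k l)
      - m k l * (-y * hess gi e P i j + y ^ 2 * gradSq gi P / 2 * m i j)) := by
    intro k i j l
    simp only [riemann, riem, pd_christoffel hg, mul_sub, Finset.sum_sub_distrib, hquad, hB]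
    simp only [hH, hN, Matrix.mulVec_sub, Matrix.mulVec_add, Matrix.mulVec_smul, sub_dotProduct,
      add_dotProduct, smul_dotProduct, dotProduct_sub, dotProduct_add, dotProduct_smul, hBl, hBr,
      smul_eq_mul]
    simp only [hBs (chr e _ _) P.d]
    have hmv : ∀ a b, 2 * (μ a b).v = m a b := fun a b => rfl
    have hmv' : ∀ a b, (μ a b).v = m a b / 2 := fun a b => by rw [← hmv]; ring
    simp only [Jet.mul_dd, Jet.mul_v, Jet.mul_d, Jet.inv_v, Jet.inv_d, Jet.inv_dd, Jet.const_v,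
      Jet.const_d, Jet.const_dd, hmv', chr, he]
    simp only [Pi.sub_apply, Pi.smul_apply, Pi.add_apply, smul_eq_mul, chr, hμ j i, hμ j k, hμ l i,
      hμ l k, hμ l j, hμ k i, hms j i, hms l i, hms l j, hms k i, hPs k i, hμs _ _ k i]
    ring
  have hc1 : ∀ (T : Fin 4 → Fin 4 → ℝ) (i j : Fin 4),
      ∑ k, ∑ l, gi k l * (m i l * T k j) = T i j := by
    intro T i j
    have : ∀ k, ∑ l, gi k l * (m i l * T k j) = (gi * m) k i * T k j := by
      intro k
      rw [Matrix.mul_apply, Finset.sum_mul]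
      exact Finset.sum_congr rfl fun l _ => by rw [hms i l]; ring
    simp [this, hinv', Matrix.one_apply]
  have hc2 : ∀ (T : Fin 4 → Fin 4 → ℝ) (i j : Fin 4),
      ∑ k, ∑ l, gi k l * (m k j * T i l) = T i j := by
    intro T i j
    rw [Finset.sum_comm]
    have : ∀ l, ∑ k, gi k l * (m k j * T i l) = (gi * m) l j * T i l := by
      intro l
      rw [Matrix.mul_apply, Finset.sum_mul]
      exact Finset.sum_congr rfl fun k _ => by rw [hgi.apply]; ring
    simp [this, hinv', Matrix.one_apply]
  have hc3 : ∑ k, ∑ l, gi k l * m k l = 4 := by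
    have : ∀ k, ∑ l, gi k l * m k l = (gi * m) k k := by
      intro k
      rw [Matrix.mul_apply]
      exact Finset.sum_congr rfl fun l _ => by rw [hms k l]
    simp [this, hinv']
  set T : Fin 4 → Fin 4 → ℝ := fun k j =>
    -y * hess gi e P k j + y ^ 2 * gradSq gi P / 2 * m k j with hT
  -- The four contractions give T, T, -m tr T and -4T, where 4 is the dimension.
  have hmain : ricci g p i j = ric gi e (fun k l i j => (μ i j).dd k l) i j
      + 2 * T i j - m i j * (∑ k, ∑ l, gi k l * T k l) - 4 * T i j := by
    have h1 : ricci g p i j = ∑ k, ∑ l, (gi k l * riem gi e (fun k l i j => (μ i j).dd k l) k i j l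
        + gi k l * (m i l * T k j) + gi k l * (m k j * T i l) - m i j * (gi k l * T k l)
        - gi k l * m k l * T i j) := by
      simp only [ricci, Matrix.of_apply]
      refine Finset.sum_congr rfl fun k _ => Finset.sum_congr rfl fun l _ => ?_
      rw [hriem, hginv, Matrix.smul_apply, smul_eq_mul]
      simp only [hT]
      linear_combination (P.v * y + 1) * gi k l * (riem gi e
        (fun k l i j => (μ i j).dd k l) k i j l + m i l * T k j + m k j * T i l - m i j * T k l
        - m k l * T i j) * hy
    rw [h1]
    simp only [Finset.sum_add_distrib, Finset.sum_sub_distrib, hc1, hc2, ← Finset.sum_mul,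
      ← Finset.mul_sum, hc3, ric]
    ring
  have htr : ∑ k, ∑ l, gi k l * T k l = -y * (∑ k, ∑ l, gi k l * hess gi e P k l)
      + 2 * y ^ 2 * gradSq gi P := by
    have : ∀ k l, gi k l * T k l = -y * (gi k l * hess gi e P k l)
        + y ^ 2 * gradSq gi P / 2 * (gi k l * m k l) := fun k l => by simp only [hT]; ring
    simp only [this, Finset.sum_add_distrib, ← Finset.mul_sum, hc3]
    ring
  rw [hmain, htr]
  have hmm : 2 * (μ i j).v = m i j := rfl
  rw [hmm]
  simp only [hT]
  ring

end

section

/-! ### The two-jet of the regularised metric -/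

namespace Jet

variable {R T : Type*} [CommRing R] [CommRing T]

/-- The jet of a coordinate function. -/
def coord (k : Fin 4) (c : R) : Jet R := ⟨c, fun i => if i = k then 1 else 0, fun _ _ => 0⟩

/-- The jet of a function of `U`. -/
def ofU (c c1 c2 : R) : Jet R :=
  ⟨c, fun i => if i = 0 then c1 else 0, fun i j => if i = 0 then (if j = 0 then c2 else 0) else 0⟩

/-- The jet of a function of `Z`. -/
def ofZ (c c1 c2 c11 c12 c22 : R) : Jet R :=
  ⟨c, ![0, 0, c1, c2], ![![0, 0, 0, 0], ![0, 0, 0, 0], ![0, 0, c11, c12], ![0, 0, c12, c22]]⟩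

theorem map_coord (φ : R →+* T) (k : Fin 4) (c : R) : map φ (coord k c) = coord k (φ c) := by
  ext <;> simp [coord, apply_ite φ]

theorem map_ofU (φ : R →+* T) (c c1 c2 : R) :
    map φ (ofU c c1 c2) = ofU (φ c) (φ c1) (φ c2) := by
  ext <;> simp [ofU, apply_ite φ]

theorem map_ofZ (φ : R →+* T) (c c1 c2 c11 c12 c22 : R) : map φ (ofZ c c1 c2 c11 c12 c22) =
    ofZ (φ c) (φ c1) (φ c2) (φ c11) (φ c12) (φ c22) := by
  ext i j
  · rfl
  · fin_cases i <;> simp [ofZ]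
  · fin_cases i <;> fin_cases j <;> simp [ofZ]

end Jet

/-- The quantities from which the two-jet of the regularised metric is built: `L = Λ/6`, the
coordinates, the functions of `U` with their derivatives, `G`, half the Hessian of the profile
with its first (`t`) and second (`q`) derivatives, the reciprocal `p0i` of `1 + L |Z|²` and the
reciprocal `Q` of the denominator, and the inverse `k` of the transverse metric. -/
structure Atoms (R : Type*) where
  half : R
  L : R
  U : R
  V : R
  x1 : R
  x2 : R
  w : R
  θ : R
  r : R
  s : R
  κ : R
  κ1 : R
  κ2 : R
  ζ : R
  ζ1 : R
  ζ2 : R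
  ι : R
  ι1 : R
  ι2 : R
  G : R
  M11 : R
  M12 : R
  M22 : R
  t0 : R
  t1 : R
  t2 : R
  t3 : R
  q0 : R
  q1 : R
  q2 : R
  q3 : R
  q4 : R
  p0i : R
  Q : R
  k11 : R
  k12 : R
  k22 : R

namespace Atoms

variable {R T : Type*} [CommRing R] [CommRing T]

/-- The image under a ring homomorphism. -/
def map (φ : R →+* T) (a : Atoms R) : Atoms T where
  half := φ a.half
  L := φ a.L
  U := φ a.U
  V := φ a.V
  x1 := φ a.x1
  x2 := φ a.x2
  w := φ a.w
  θ := φ a.θ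
  r := φ a.r
  s := φ a.s
  κ := φ a.κ
  κ1 := φ a.κ1
  κ2 := φ a.κ2
  ζ := φ a.ζ
  ζ1 := φ a.ζ1
  ζ2 := φ a.ζ2
  ι := φ a.ι
  ι1 := φ a.ι1
  ι2 := φ a.ι2
  G := φ a.G
  M11 := φ a.M11
  M12 := φ a.M12
  M22 := φ a.M22
  t0 := φ a.t0
  t1 := φ a.t1
  t2 := φ a.t2
  t3 := φ a.t3
  q0 := φ a.q0
  q1 := φ a.q1
  q2 := φ a.q2
  q3 := φ a.q3
  q4 := φ a.q4
  p0i := φ a.p0i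
  Q := φ a.Q
  k11 := φ a.k11
  k12 := φ a.k12
  k22 := φ a.k22

variable (a : Atoms R)

def J11 : Jet R := .ofZ a.M11 a.t0 a.t1 a.q0 a.q1 a.q2
def J12 : Jet R := .ofZ a.M12 a.t1 a.t2 a.q1 a.q2 a.q3
def J22 : Jet R := .ofZ a.M22 a.t2 a.t3 a.q2 a.q3 a.q4
def wJ : Jet R := .ofU a.w a.θ a.r
def sJ : Jet R := .ofU a.s (2 * a.w) (2 * a.θ)

def GJ : Jet R :=
  .ofZ a.G (-2 * (a.M11 * a.x1 + a.M12 * a.x2)) (-2 * (a.M12 * a.x1 + a.M22 * a.x2))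
    (-2 * a.M11 - 2 * (a.x1 * a.t0 + a.x2 * a.t1)) (-2 * a.M12 - 2 * (a.x1 * a.t1 + a.x2 * a.t2))
    (-2 * a.M22 - 2 * (a.x1 * a.t2 + a.x2 * a.t3))

/-- `|Z|²`. -/
def normJ : Jet R :=
  .coord 2 a.x1 * .coord 2 a.x1 + .coord 3 a.x2 * .coord 3 a.x2

def p0J : Jet R := .const 1 + .const a.L * a.normJ
def p0iJ : Jet R := a.p0J.inv a.p0i

/-- The trace of `M²`. -/
def nJ : Jet R := a.J11 * a.J11 + .const 2 * (a.J12 * a.J12) + a.J22 * a.J22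

def AJ : Jet R :=
  .const 2 * a.nJ + .const (-2 * a.L ^ 2) * (a.GJ * a.GJ * (a.p0iJ * a.p0iJ))

def EJ : Jet R := .const (-2 * a.L ^ 2) * (a.GJ * .coord 1 a.V * (a.p0iJ * a.p0iJ))

/-- The correction `A κ + B ζ + E ι`. -/
def cJ : Jet R :=
  a.AJ * .ofU a.κ a.κ1 a.κ2 + a.nJ * .ofU a.ζ a.ζ1 a.ζ2 + a.EJ * .ofU a.ι a.ι1 a.ι2

def h11J : Jet R :=
  .const 1 + a.cJ + .const 2 * (a.wJ * a.J11) + a.sJ * (a.J11 * a.J11 + a.J12 * a.J12)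

def h12J : Jet R := .const 2 * (a.wJ * a.J12) + a.sJ * ((a.J11 + a.J22) * a.J12)

def h22J : Jet R :=
  .const 1 + a.cJ + .const 2 * (a.wJ * a.J22) + a.sJ * (a.J12 * a.J12 + a.J22 * a.J22)

/-- The jet of the denominator. -/
def PJ : Jet R :=
  .const 1 + .const a.L * (a.normJ + .const (-1) * (.coord 0 a.U * .coord 1 a.V)
    + .const (-1) * (a.wJ * a.GJ))

/-- The jet of half the conformally rescaled metric. -/
def μ : Fin 4 → Fin 4 → Jet R :=
  ![![.const 0, .const (-a.half), .const 0, .const 0],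
    ![.const (-a.half), .const 0, .const 0, .const 0],
    ![.const 0, .const 0, a.h11J, a.h12J],
    ![.const 0, .const 0, a.h12J, a.h22J]]

def gi : Matrix (Fin 4) (Fin 4) R :=
  !![0, -1, 0, 0; -1, 0, 0, 0; 0, 0, a.k11, a.k12; 0, 0, a.k12, a.k22]

def e (k i j : Fin 4) : R := (a.μ i j).d k
def ee (k l i j : Fin 4) : R := (a.μ i j).dd k l

/-- The Ricci tensor of the metric, by the conformal transformation formula. -/
def ricJ (i j : Fin 4) : R :=
  ric a.gi a.e a.ee i j + 2 * a.Q * hess a.gi a.e a.PJ i j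
    + (a.Q * (∑ k, ∑ l, a.gi k l * hess a.gi a.e a.PJ k l)
      - 3 * a.Q ^ 2 * gradSq a.gi a.PJ) * (2 * (a.μ i j).v)

/-- The metric. -/
def gJ (i j : Fin 4) : R := a.Q ^ 2 * (2 * (a.μ i j).v)

/-- The relations that hold up to errors of order `ε`. -/
structure IsReduced : Prop where
  half : 2 * a.half = 1
  κ : a.κ = 0
  κ1 : a.κ1 = 0
  κ2 : a.κ2 = 0
  ζ : a.ζ = 0
  ζ1 : a.ζ1 = 0
  ζ2 : a.ζ2 = 0
  ι : a.ι = 0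
  ι1 : a.ι1 = 0
  ι2 : a.ι2 = 0
  s : a.s = a.w ^ 2
  wθ : a.w * a.θ = a.w
  Uθ : a.U * a.θ = a.w
  Q : a.PJ.v * a.Q = 1
  kh11 : 2 * (a.h11J.v * a.k11 + a.h12J.v * a.k12) = 1
  kh12 : a.h11J.v * a.k12 + a.h12J.v * a.k22 = 0
  kh21 : a.h12J.v * a.k11 + a.h22J.v * a.k12 = 0
  kh22 : 2 * (a.h12J.v * a.k12 + a.h22J.v * a.k22) = 1

/-- Entries of S = 1 + wM. Working with S instead of the transverse metric S² keeps the curvature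
identities of low degree. -/
def S11 : R := 1 + a.w * a.M11
def S12 : R := a.w * a.M12
def S22 : R := 1 + a.w * a.M22

variable {a}

namespace IsReduced

variable (h : a.IsReduced)
include h

theorem cJ : a.cJ = .const 0 := by
  have h0 : Jet.ofU (0 : R) 0 0 = .const 0 := by ext <;> simp [Jet.ofU]
  have h1 : ∀ J : Jet R, J * .const 0 = .const 0 := fun J => by ext <;> simp
  have h2 : ∀ J : Jet R, J + .const 0 = J := fun J => by ext <;> simp
  rw [Atoms.cJ, h.κ, h.κ1, h.κ2, h.ζ, h.ζ1, h.ζ2, h.ι, h.ι1, h.ι2, h0, h1, h1, h1, h2, h2]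

/-- Without correction and with s = w², the expression 1 + 2wM + sM² is the square S². -/
theorem h11J_v : a.h11J.v = a.S11 ^ 2 + a.S12 ^ 2 := by
  simp [h11J, h.cJ, wJ, sJ, J11, J12, Jet.ofU, Jet.ofZ, h.s, S11, S12]
  ring

theorem h12J_v : a.h12J.v = a.S12 * (a.S11 + a.S22) := by
  simp [h12J, wJ, sJ, J11, J12, J22, Jet.ofU, Jet.ofZ, h.s, S11, S12, S22]
  ring

theorem h22J_v : a.h22J.v = a.S12 ^ 2 + a.S22 ^ 2 := by
  simp [h22J, h.cJ, wJ, sJ, J12, J22, Jet.ofU, Jet.ofZ, h.s, S22, S12]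
  ring

/-- The U-derivative 2θM + 2wM² becomes θ(MS + SM) because w = wθ; the transverse derivatives are
those of S². -/
theorem h11J_d (i : Fin 4) : a.h11J.d i = ![2 * a.θ * (a.M11 * a.S11 + a.M12 * a.S12), 0,
    2 * a.w * (a.t0 * a.S11 + a.t1 * a.S12), 2 * a.w * (a.t1 * a.S11 + a.t2 * a.S12)] i := by
  have := h.wθ
  fin_cases i <;> simp [h11J, h.cJ, wJ, sJ, J11, J12, Jet.ofU, Jet.ofZ, h.s, S11, S12]
  · linear_combination (-2) * (a.M11 ^ 2 + a.M12 ^ 2) * this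
  all_goals ring

theorem h12J_d (i : Fin 4) : a.h12J.d i = ![2 * a.θ * (a.M11 * a.S12 + a.M12 * a.S22), 0,
    a.w * (a.t0 * a.S12 + a.t1 * (a.S11 + a.S22) + a.t2 * a.S12),
    a.w * (a.t1 * a.S12 + a.t2 * (a.S11 + a.S22) + a.t3 * a.S12)] i := by
  have := h.wθ
  fin_cases i <;> simp [h12J, wJ, sJ, J11, J12, J22, Jet.ofU, Jet.ofZ, h.s, S11, S12, S22]
  · linear_combination (-2) * (a.M11 + a.M22) * a.M12 * this
  all_goals ring

theorem h22J_d (i : Fin 4) : a.h22J.d i = ![2 * a.θ * (a.M12 * a.S12 + a.M22 * a.S22), 0,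
    2 * a.w * (a.t1 * a.S12 + a.t2 * a.S22), 2 * a.w * (a.t2 * a.S12 + a.t3 * a.S22)] i := by
  have := h.wθ
  fin_cases i <;> simp [h22J, h.cJ, wJ, sJ, J12, J22, Jet.ofU, Jet.ofZ, h.s, S12, S22]
  · linear_combination (-2) * (a.M22 ^ 2 + a.M12 ^ 2) * this
  all_goals ring

end IsReduced
end Atoms

end

section

/-! ### The Einstein equations in the quotient, outside the component UU -/

namespace Atoms
variable {R T : Type*} [CommRing R] [CommRing T] {a : Atoms R}

/-- First components of the vectors `W` with `Γ_{ij,c} = 2 Σ_b W_b S_{bc}`. -/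
def W1 (a : Atoms R) : Fin 4 → Fin 4 → R :=
  ![![0, 0, a.θ * a.M11, a.θ * a.M12], ![0, 0, 0, 0],
    ![a.θ * a.M11, 0, a.w * a.t0, a.w * a.t1], ![a.θ * a.M12, 0, a.w * a.t1, a.w * a.t2]]

/-- Second components of the vectors `W` with `Γ_{ij,c} = 2 Σ_b W_b S_{bc}`. -/
def W2 (a : Atoms R) : Fin 4 → Fin 4 → R :=
  ![![0, 0, a.θ * a.M12, a.θ * a.M22], ![0, 0, 0, 0],
    ![a.θ * a.M12, 0, a.w * a.t1, a.w * a.t2], ![a.θ * a.M22, 0, a.w * a.t2, a.w * a.t3]]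

theorem PJ_d_zero : a.PJ.d 0 = -a.L * (a.V + a.θ * a.G) := by
  simp [PJ, normJ, wJ, GJ, Jet.coord, Jet.ofU, Jet.ofZ]
  ring

theorem PJ_d_one : a.PJ.d 1 = -a.L * a.U := by
  simp [PJ, normJ, wJ, GJ, Jet.coord, Jet.ofU, Jet.ofZ]

theorem PJ_d_two : a.PJ.d 2 = 2 * a.L * (a.S11 * a.x1 + a.S12 * a.x2) := by
  simp [PJ, normJ, wJ, GJ, Jet.coord, Jet.ofU, Jet.ofZ, S11, S12]
  ring

theorem PJ_d_three : a.PJ.d 3 = 2 * a.L * (a.S12 * a.x1 + a.S22 * a.x2) := by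
  simp [PJ, normJ, wJ, GJ, Jet.coord, Jet.ofU, Jet.ofZ, S22, S12]
  ring

theorem PJ_v : a.PJ.v = 1 + a.L * (a.x1 ^ 2 + a.x2 ^ 2 - a.U * a.V - a.w * a.G) := by
  simp [PJ, normJ, wJ, GJ, Jet.coord, Jet.ofU, Jet.ofZ]
  ring

namespace IsReduced

variable (h : a.IsReduced)
include h

theorem chr_one (i j : Fin 4) : chr a.e i j 1 = 0 := by
  fin_cases i <;> fin_cases j <;>
    simp [chr, e, μ, h.h11J_d, h.h12J_d, h.h22J_d]

/-- W consists of derivatives of the columns of S. M is half a Hessian, so ∂_i S_{bj} is symmetric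
in the transverse indices and the usual three terms collapse to one multiple of S. -/
theorem chr_two (i j : Fin 4) : chr a.e i j 2 = 2 * (a.W1 i j * a.S11 + a.W2 i j * a.S12) := by
  fin_cases i <;> fin_cases j <;>
    simp [chr, e, μ, h.h11J_d, h.h12J_d, h.h22J_d, W1, W2] <;>
    simp only [S11, S12, S22] <;> ring

theorem chr_three (i j : Fin 4) : chr a.e i j 3 = 2 * (a.W1 i j * a.S12 + a.W2 i j * a.S22) := by
  fin_cases i <;> fin_cases j <;>
    simp [chr, e, μ, h.h11J_d, h.h12J_d, h.h22J_d, W1, W2] <;>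
    simp only [S11, S12, S22] <;> ring

/-- The inverse transverse metric is `(2 S²)⁻¹`. -/
theorem SkS : 2 * (!![a.S11, a.S12; a.S12, a.S22] * (!![a.k11, a.k12; a.k12, a.k22] *
    !![a.S11, a.S12; a.S12, a.S22])) = 1 := by
  have h1 : !![a.S11, a.S12; a.S12, a.S22] * (!![a.S11, a.S12; a.S12, a.S22] *
      (2 * !![a.k11, a.k12; a.k12, a.k22])) = 1 := by
    have e1 := h.kh11
    have e2 := h.kh12
    have e3 := h.kh21
    have e4 := h.kh22
    rw [h.h11J_v, h.h12J_v] at e1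
    rw [h.h11J_v, h.h12J_v] at e2
    rw [h.h12J_v, h.h22J_v] at e3 e4
    have h2 : (2 : Matrix (Fin 2) (Fin 2) R) = !![2, 0; 0, 2] := by
      ext i j
      fin_cases i <;> fin_cases j <;> simp [Matrix.ofNat_apply]
    rw [h2]
    ext i j
    fin_cases i <;> fin_cases j <;> simp [Matrix.mul_apply, Fin.sum_univ_two]
    · linear_combination e1
    · linear_combination 2 * e2
    · linear_combination 2 * e3
    · linear_combination e4
  -- A one-sided matrix inverse over a commutative ring is two-sided: S(S·2k) = 1 gives (S·2k)S = 1.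
  -- No field is needed, and the quotient ring is not one.
  have h3 := mul_eq_one_comm.mp h1
  rw [← h3]
  noncomm_ring

theorem sks11 : 2 * (a.S11 * (a.k11 * a.S11 + a.k12 * a.S12) +
    a.S12 * (a.k12 * a.S11 + a.k22 * a.S12)) = 1 := by
  have := congrFun (congrFun h.SkS 0) 0
  rw [two_mul] at this
  simpa [Matrix.mul_apply, Fin.sum_univ_two, ← two_mul] using this

theorem sks12 : 2 * (a.S11 * (a.k11 * a.S12 + a.k12 * a.S22) +
    a.S12 * (a.k12 * a.S12 + a.k22 * a.S22)) = 0 := by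
  have := congrFun (congrFun h.SkS 0) 1
  rw [two_mul] at this
  simpa [Matrix.mul_apply, Fin.sum_univ_two, ← two_mul] using this

theorem sks22 : 2 * (a.S12 * (a.k11 * a.S12 + a.k12 * a.S22) +
    a.S22 * (a.k12 * a.S12 + a.k22 * a.S22)) = 1 := by
  have := congrFun (congrFun h.SkS 1) 1
  rw [two_mul] at this
  simpa [Matrix.mul_apply, Fin.sum_univ_two, ← two_mul] using this

/-- The factors S of the Christoffel symbols cancel against k = (2S²)⁻¹, leaving a Euclidean product
of the W with no inverse in it. The U, V block contributes nothing, since symbols with last index 1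
vanish. -/
theorem sum_chr (i j k l : Fin 4) : ∑ s, ∑ t, a.gi s t * (chr a.e i j s * chr a.e k l t) =
    2 * (a.W1 i j * a.W1 k l + a.W2 i j * a.W2 k l) := by
  simp [Fin.sum_univ_four, gi, h.chr_one, h.chr_two, h.chr_three]
  linear_combination 2 * (a.W1 i j * a.W1 k l) * h.sks11 + 2 * (a.W2 i j * a.W2 k l) * h.sks22
    + 2 * (a.W1 i j * a.W2 k l + a.W2 i j * a.W1 k l) * h.sks12

theorem riem_eq (k i j l : Fin 4) : riem a.gi a.e a.ee k i j l =
    a.ee k j i l + a.ee i l k j - a.ee k l i j - a.ee i j k l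
      + 2 * (a.W1 k j * a.W1 i l + a.W2 k j * a.W2 i l)
      - 2 * (a.W1 k l * a.W1 i j + a.W2 k l * a.W2 i j) := by
  simp only [riem, mul_sub, Finset.sum_sub_distrib, h.sum_chr]
  ring

/-- The second derivatives of the transverse metric. -/
theorem h11J_dd (i j : Fin 4) : a.h11J.dd i j = ![
    ![a.h11J.dd 0 0, 0, 2 * a.θ * a.t0 + 4 * a.w * (a.M11 * a.t0 + a.M12 * a.t1),
      2 * a.θ * a.t1 + 4 * a.w * (a.M11 * a.t1 + a.M12 * a.t2)],
    ![0, 0, 0, 0],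
    ![2 * a.θ * a.t0 + 4 * a.w * (a.M11 * a.t0 + a.M12 * a.t1), 0,
      2 * a.w * (a.q0 * a.S11 + a.q1 * a.S12) + 2 * a.w ^ 2 * (a.t0 ^ 2 + a.t1 ^ 2),
      2 * a.w * (a.q1 * a.S11 + a.q2 * a.S12) + 2 * a.w ^ 2 * (a.t0 * a.t1 + a.t1 * a.t2)],
    ![2 * a.θ * a.t1 + 4 * a.w * (a.M11 * a.t1 + a.M12 * a.t2), 0,
      2 * a.w * (a.q1 * a.S11 + a.q2 * a.S12) + 2 * a.w ^ 2 * (a.t0 * a.t1 + a.t1 * a.t2),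
      2 * a.w * (a.q2 * a.S11 + a.q3 * a.S12) + 2 * a.w ^ 2 * (a.t1 ^ 2 + a.t2 ^ 2)]] i j := by
  fin_cases i <;> fin_cases j <;>
    simp [h11J, h.cJ, wJ, sJ, J11, J12, Jet.ofU, Jet.ofZ, h.s, S11, S12] <;> ring

theorem h12J_dd (i j : Fin 4) : a.h12J.dd i j = ![
    ![a.h12J.dd 0 0, 0,
      2 * a.θ * a.t1 + 2 * a.w * ((a.t0 + a.t2) * a.M12 + (a.M11 + a.M22) * a.t1),
      2 * a.θ * a.t2 + 2 * a.w * ((a.t1 + a.t3) * a.M12 + (a.M11 + a.M22) * a.t2)],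
    ![0, 0, 0, 0],
    ![2 * a.θ * a.t1 + 2 * a.w * ((a.t0 + a.t2) * a.M12 + (a.M11 + a.M22) * a.t1), 0,
      2 * a.w * a.q1 + a.w ^ 2 * ((a.q0 + a.q2) * a.M12 + 2 * (a.t0 + a.t2) * a.t1
        + (a.M11 + a.M22) * a.q1),
      2 * a.w * a.q2 + a.w ^ 2 * ((a.q1 + a.q3) * a.M12 + (a.t0 + a.t2) * a.t2
        + (a.t1 + a.t3) * a.t1 + (a.M11 + a.M22) * a.q2)],
    ![2 * a.θ * a.t2 + 2 * a.w * ((a.t1 + a.t3) * a.M12 + (a.M11 + a.M22) * a.t2), 0,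
      2 * a.w * a.q2 + a.w ^ 2 * ((a.q1 + a.q3) * a.M12 + (a.t0 + a.t2) * a.t2
        + (a.t1 + a.t3) * a.t1 + (a.M11 + a.M22) * a.q2),
      2 * a.w * a.q3 + a.w ^ 2 * ((a.q2 + a.q4) * a.M12 + 2 * (a.t1 + a.t3) * a.t2
        + (a.M11 + a.M22) * a.q3)]] i j := by
  fin_cases i <;> fin_cases j <;>
    simp [h12J, wJ, sJ, J11, J12, J22, Jet.ofU, Jet.ofZ, h.s] <;> ring

theorem h22J_dd (i j : Fin 4) : a.h22J.dd i j = ![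
    ![a.h22J.dd 0 0, 0, 2 * a.θ * a.t2 + 4 * a.w * (a.M12 * a.t1 + a.M22 * a.t2),
      2 * a.θ * a.t3 + 4 * a.w * (a.M12 * a.t2 + a.M22 * a.t3)],
    ![0, 0, 0, 0],
    ![2 * a.θ * a.t2 + 4 * a.w * (a.M12 * a.t1 + a.M22 * a.t2), 0,
      2 * a.w * (a.q1 * a.S12 + a.q2 * a.S22) + 2 * a.w ^ 2 * (a.t1 ^ 2 + a.t2 ^ 2),
      2 * a.w * (a.q2 * a.S12 + a.q3 * a.S22) + 2 * a.w ^ 2 * (a.t1 * a.t2 + a.t2 * a.t3)],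
    ![2 * a.θ * a.t3 + 4 * a.w * (a.M12 * a.t2 + a.M22 * a.t3), 0,
      2 * a.w * (a.q2 * a.S12 + a.q3 * a.S22) + 2 * a.w ^ 2 * (a.t1 * a.t2 + a.t2 * a.t3),
      2 * a.w * (a.q3 * a.S12 + a.q4 * a.S22) + 2 * a.w ^ 2 * (a.t2 ^ 2 + a.t3 ^ 2)]] i j := by
  fin_cases i <;> fin_cases j <;>
    simp [h22J, h.cJ, wJ, sJ, J22, J12, Jet.ofU, Jet.ofZ, h.s, S22, S12] <;> ring

/-- Modulo O(ε) the correction is gone, and with it the dependence of the metric on V. -/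
theorem riem_zero_one (i j : Fin 4) : riem a.gi a.e a.ee 0 i j 1 = 0 := by
  rw [h.riem_eq]
  fin_cases i <;> fin_cases j <;>
    simp [ee, μ, h.h11J_dd _ 1, h.h12J_dd _ 1, h.h22J_dd _ 1, W1, W2]

theorem riem_one_zero (i j : Fin 4) : riem a.gi a.e a.ee 1 i j 0 = 0 := by
  rw [h.riem_eq]
  fin_cases i <;> fin_cases j <;>
    simp [ee, μ, h.h11J_dd 1, h.h12J_dd 1, h.h22J_dd 1, W1, W2]

-- Second derivatives of S² cancel the products W · W; the mixed U-terms match because wθ = w. This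
-- expresses the flatness of m on either side of the wave. The excluded case UU contains the jump of
-- θ.
set_option maxHeartbeats 2000000 in
theorem riem_transverse (k l i j : Fin 4) (hk : k = 2 ∨ k = 3) (hl : l = 2 ∨ l = 3)
    (hij : ¬(i = 0 ∧ j = 0)) : riem a.gi a.e a.ee k i j l = 0 := by
  have := h.wθ
  rw [h.riem_eq]
  rcases hk with rfl | rfl <;> rcases hl with rfl | rfl <;> fin_cases i <;> fin_cases j <;>
    first
    | exact absurd ⟨rfl, rfl⟩ hij
    | (simp only [ee, μ, W1, W2]
       simp [h.h11J_dd 2, h.h12J_dd 2, h.h22J_dd 2, h.h11J_dd 3, h.h12J_dd 3, h.h22J_dd 3,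
         h.h11J_dd 0 2, h.h12J_dd 0 2, h.h22J_dd 0 2, h.h11J_dd 0 3, h.h12J_dd 0 3,
         h.h22J_dd 0 3, h.h11J_dd 1, h.h12J_dd 1, h.h22J_dd 1, h.h11J_dd 0 1, h.h12J_dd 0 1,
         h.h22J_dd 0 1]
       all_goals try simp only [S11, S12, S22]
       all_goals first | ring1 | grind)

theorem ric_eq_zero (i j : Fin 4) (hij : ¬(i = 0 ∧ j = 0)) : ric a.gi a.e a.ee i j = 0 := by
  simp only [ric, Fin.sum_univ_four, h.riem_zero_one, h.riem_one_zero,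
    h.riem_transverse 2 2 i j (by simp) (by simp) hij,
    h.riem_transverse 2 3 i j (by simp) (by simp) hij,
    h.riem_transverse 3 2 i j (by simp) (by simp) hij,
    h.riem_transverse 3 3 i j (by simp) (by simp) hij]
  simp [gi]

theorem hess_eq (i j : Fin 4) : hess a.gi a.e a.PJ i j = a.PJ.dd i j - a.L * a.U * chr a.e i j 0
    - 2 * a.L * (a.x1 * a.W1 i j + a.x2 * a.W2 i j) := by
  simp [hess, Fin.sum_univ_four, gi, h.chr_one, h.chr_two, h.chr_three, PJ_d_one,
    PJ_d_two, PJ_d_three]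
  linear_combination (-2) * a.L * (a.x1 * a.W1 i j) * h.sks11
    - 2 * a.L * (a.x2 * a.W2 i j) * h.sks22
    - 2 * a.L * (a.x1 * a.W2 i j + a.x2 * a.W1 i j) * h.sks12

/-- The term -L w G of P has Hessian in x given by M and its derivatives. The Christoffel terms
remove the derivatives of M, and Uθ = w completes the rest to L · 2S². -/
theorem hess_eq_smul (i j : Fin 4) (hij : ¬(i = 0 ∧ j = 0)) :
    hess a.gi a.e a.PJ i j = a.L * (2 * (a.μ i j).v) := by
  rw [h.hess_eq]
  have h1 := h.Uθ
  have h2 := h.wθ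
  have h3 := h.half
  fin_cases i <;> fin_cases j <;> first
    | exact absurd ⟨rfl, rfl⟩ hij
    | (simp [PJ, normJ, wJ, GJ, Jet.coord, Jet.ofU, Jet.ofZ, chr, e, μ, h.h11J_d, h.h12J_d,
         h.h22J_d, W1, W2, h.h11J_v, h.h12J_v, h.h22J_v]
       all_goals try simp only [S11, S12, S22]
       all_goals first | ring1 | grind)

theorem trace_hess : ∑ k, ∑ l, a.gi k l * hess a.gi a.e a.PJ k l = 4 * a.L := by
  have e1 := h.kh11
  have e2 := h.kh12
  have e3 := h.kh21
  have e4 := h.kh22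
  have e5 := h.half
  have hs := fun i j hij => h.hess_eq_smul i j hij
  simp only [Fin.sum_univ_four, hs 0 1 (by simp), hs 1 0 (by simp), hs 2 2 (by simp),
    hs 2 3 (by simp), hs 3 2 (by simp), hs 3 3 (by simp)]
  simp [gi, μ]
  linear_combination a.L * e1 + a.L * e4 + 2 * a.L * e5

/-- ∇P is 2L S x transversally, so its transverse square is 2L²|x|², and the U, V part is -2L²(UV +
wG) by Uθ = w. With this value and Q P = 1, the terms of the conformal formula add up to 6L Q² m. -/
theorem gradSq_eq : gradSq a.gi a.PJ = 2 * a.L * (a.PJ.v - 1) := by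
  have h1 := h.Uθ
  rw [PJ_v]
  simp [gradSq, Fin.sum_univ_four, gi, PJ_d_zero, PJ_d_one, PJ_d_two, PJ_d_three]
  linear_combination (-2) * a.L ^ 2 * a.G * h1 + 2 * a.L ^ 2 * a.x1 ^ 2 * h.sks11
    + 2 * a.L ^ 2 * a.x2 ^ 2 * h.sks22 + 4 * a.L ^ 2 * a.x1 * a.x2 * h.sks12

/-- The Einstein equations hold up to errors of order `ε`, except for the component `UU`. -/
theorem ricJ_eq (i j : Fin 4) (hij : ¬(i = 0 ∧ j = 0)) : a.ricJ i j = 6 * a.L * a.gJ i j := by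
  rw [ricJ, gJ, h.ric_eq_zero i j hij, h.hess_eq_smul i j hij, h.trace_hess, h.gradSq_eq]
  linear_combination (-6) * a.L * a.Q * (2 * (a.μ i j).v) * h.Q

end IsReduced
end Atoms

end

section

/-! ### Second U-derivatives and the component UU -/

namespace Atoms
variable {R T : Type*} [CommRing R] [CommRing T]

/-- Replace the second `U`-derivatives of the functions of `U`. -/
def withSecond (a : Atoms R) (r κ2 ζ2 ι2 : R) : Atoms R :=
  { a with r := r, κ2 := κ2, ζ2 := ζ2, ι2 := ι2 }

section Mask

variable (a : Atoms R) (r κ2 ζ2 ι2 : R)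

theorem ee_withSecond {k l : Fin 4} (hkl : ¬(k = 0 ∧ l = 0)) (i j : Fin 4) :
    (a.withSecond r κ2 ζ2 ι2).ee k l i j = a.ee k l i j := by
  have h0 : ∀ c c1 c2 c2' : R, (Jet.ofU c c1 c2).dd k l = (Jet.ofU c c1 c2').dd k l := by
    intro c c1 c2 c2'
    simp only [Jet.ofU]
    grind
  have hκ := h0 a.κ a.κ1 κ2 a.κ2
  have hζ := h0 a.ζ a.ζ1 ζ2 a.ζ2
  have hι := h0 a.ι a.ι1 ι2 a.ι2
  have hw := h0 a.w a.θ r a.r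
  have e1 : (a.withSecond r κ2 ζ2 ι2).h11J.dd k l = a.h11J.dd k l := by
    simp only [h11J, cJ, wJ, Jet.add_dd, Jet.mul_dd, withSecond, hκ, hζ, hι, hw]
    rfl
  have e2 : (a.withSecond r κ2 ζ2 ι2).h12J.dd k l = a.h12J.dd k l := by
    simp only [h12J, wJ, Jet.add_dd, Jet.mul_dd, withSecond, hw]
    rfl
  have e3 : (a.withSecond r κ2 ζ2 ι2).h22J.dd k l = a.h22J.dd k l := by
    simp only [h22J, cJ, wJ, Jet.add_dd, Jet.mul_dd, withSecond, hκ, hζ, hι, hw]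
    rfl
  fin_cases i <;> fin_cases j <;> first | rfl | exact e1 | exact e2 | exact e3

theorem PJ_dd_withSecond {k l : Fin 4} (hkl : ¬(k = 0 ∧ l = 0)) :
    (a.withSecond r κ2 ζ2 ι2).PJ.dd k l = a.PJ.dd k l := by
  have hw : (Jet.ofU a.w a.θ r).dd k l = (Jet.ofU a.w a.θ a.r).dd k l := by
    simp only [Jet.ofU]
    grind
  simp only [PJ, wJ, Jet.add_dd, Jet.mul_dd, withSecond, hw]
  rfl

theorem e_withSecond : (a.withSecond r κ2 ζ2 ι2).e = a.e := by
  ext k i j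
  fin_cases i <;> fin_cases j <;> rfl

theorem μ_v_withSecond (i j : Fin 4) :
    ((a.withSecond r κ2 ζ2 ι2).μ i j).v = (a.μ i j).v := by
  have e1 : (a.withSecond r κ2 ζ2 ι2).h11J.v = a.h11J.v := by
    simp only [h11J, cJ, wJ, Jet.add_v, Jet.mul_v, Jet.ofU, withSecond]
    rfl
  have e2 : (a.withSecond r κ2 ζ2 ι2).h12J.v = a.h12J.v := by
    simp only [h12J, wJ, Jet.add_v, Jet.mul_v, Jet.ofU, withSecond]
    rfl
  have e3 : (a.withSecond r κ2 ζ2 ι2).h22J.v = a.h22J.v := by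
    simp only [h22J, cJ, wJ, Jet.add_v, Jet.mul_v, Jet.ofU, withSecond]
    rfl
  have e0 : (a.withSecond r κ2 ζ2 ι2).half = a.half := rfl
  fin_cases i <;> fin_cases j <;> simp [μ, e0, e1, e2, e3]

theorem ee_constant (k l i j : Fin 4) (h : i = 0 ∨ i = 1 ∨ j = 0 ∨ j = 1) :
    a.ee k l i j = 0 := by
  fin_cases i <;> fin_cases j <;> first | rfl | simp at h

/-- Second U-derivatives occur only in entries `ee 0 0`. The hypotheses exclude each position of
such an entry, or make it a derivative of a constant metric coefficient. -/
theorem riem_withSecond {k i j l : Fin 4} (h1 : ¬(i = 0 ∧ j = 0)) (h2 : ¬(k = 0 ∧ l = 0))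
    (h3 : ¬(k = 0 ∧ j = 0) ∨ l = 1) (h4 : ¬(i = 0 ∧ l = 0) ∨ k = 1) :
    riem a.gi (a.withSecond r κ2 ζ2 ι2).e (a.withSecond r κ2 ζ2 ι2).ee k i j l =
      riem a.gi a.e a.ee k i j l := by
  have e3 : (a.withSecond r κ2 ζ2 ι2).ee k j i l = a.ee k j i l := by
    rcases h3 with h3 | rfl
    · exact a.ee_withSecond r κ2 ζ2 ι2 h3 i l
    · rw [ee_constant _ _ _ _ _ (by simp), ee_constant _ _ _ _ _ (by simp)]
  have e4 : (a.withSecond r κ2 ζ2 ι2).ee i l k j = a.ee i l k j := by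
    rcases h4 with h4 | rfl
    · exact a.ee_withSecond r κ2 ζ2 ι2 h4 k j
    · rw [ee_constant _ _ _ _ _ (by simp), ee_constant _ _ _ _ _ (by simp)]
  simp only [riem, e3, e4, a.ee_withSecond r κ2 ζ2 ι2 h1, a.ee_withSecond r κ2 ζ2 ι2 h2,
    e_withSecond]

theorem ric_withSecond {i j : Fin 4} (h : ¬(i = 0 ∧ j = 0)) :
    ric a.gi (a.withSecond r κ2 ζ2 ι2).e (a.withSecond r κ2 ζ2 ι2).ee i j =
      ric a.gi a.e a.ee i j := by
  have key : ∀ k l, a.gi k l = 0 ∨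
      riem a.gi (a.withSecond r κ2 ζ2 ι2).e (a.withSecond r κ2 ζ2 ι2).ee k i j l =
        riem a.gi a.e a.ee k i j l := by
    intro k l
    fin_cases k <;> fin_cases l <;> first
      | exact Or.inl rfl
      | exact Or.inr (a.riem_withSecond r κ2 ζ2 ι2 h (by simp) (by simp) (by simp))
  simp only [ric]
  refine Finset.sum_congr rfl fun k _ => Finset.sum_congr rfl fun l _ => ?_
  rcases key k l with h0 | h0 <;> simp [h0]

theorem hess_withSecond {i j : Fin 4} (h : ¬(i = 0 ∧ j = 0)) :
    hess a.gi (a.withSecond r κ2 ζ2 ι2).e (a.withSecond r κ2 ζ2 ι2).PJ i j =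
      hess a.gi a.e a.PJ i j := by
  simp only [hess, a.PJ_dd_withSecond r κ2 ζ2 ι2 h, e_withSecond]
  rfl

/-- Only the component `UU` involves the second `U`-derivatives. -/
theorem ricJ_withSecond {i j : Fin 4} (h : ¬(i = 0 ∧ j = 0)) :
    (a.withSecond r κ2 ζ2 ι2).ricJ i j = a.ricJ i j := by
  have h1 : ∑ k, ∑ l, a.gi k l *
      hess a.gi (a.withSecond r κ2 ζ2 ι2).e (a.withSecond r κ2 ζ2 ι2).PJ k l =
      ∑ k, ∑ l, a.gi k l * hess a.gi a.e a.PJ k l := by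
    refine Finset.sum_congr rfl fun k _ => Finset.sum_congr rfl fun l _ => ?_
    by_cases hkl : k = 0 ∧ l = 0
    -- The Hessian component UU is affected, but g^{UU} = 0, so the trace does not see it.
    · rw [hkl.1, hkl.2, show a.gi 0 0 = 0 from rfl, zero_mul, zero_mul]
    · rw [a.hess_withSecond r κ2 ζ2 ι2 hkl]
  have h2 : gradSq a.gi (a.withSecond r κ2 ζ2 ι2).PJ = gradSq a.gi a.PJ := rfl
  rw [ricJ, ricJ, show (a.withSecond r κ2 ζ2 ι2).gi = a.gi from rfl, ric_withSecond _ _ _ _ _ h,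
    hess_withSecond _ _ _ _ _ h, h1, h2, μ_v_withSecond]
  rfl

end Mask

variable (a : Atoms R)

theorem chr_zero_zero (t : Fin 4) : chr a.e 0 0 t = 0 := by
  fin_cases t <;> simp [chr, e, μ]

/-- The component `UU` of the Ricci tensor. -/
theorem ricJ_zero_zero : a.ricJ 0 0 =
    -(a.k11 * a.h11J.dd 0 0 + 2 * a.k12 * a.h12J.dd 0 0 + a.k22 * a.h22J.dd 0 0)
    + ∑ k, ∑ l, a.gi k l * ∑ s, ∑ t, a.gi s t * (chr a.e k 0 s * chr a.e 0 l t)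
    - 2 * a.Q * a.L * a.r * a.G := by
  have hP : a.PJ.dd 0 0 = -a.L * a.r * a.G := by
    simp [PJ, normJ, wJ, GJ, Jet.coord, Jet.ofU, Jet.ofZ]
    ring
  have h0 : (a.μ 0 0).v = 0 := rfl
  have h1 : ∀ k l, riem a.gi a.e a.ee k 0 0 l =
      -a.ee 0 0 k l + ∑ s, ∑ t, a.gi s t * (chr a.e k 0 s * chr a.e 0 l t) := by
    intro k l
    simp only [riem, chr_zero_zero, mul_zero, sub_zero]
    rw [ee_constant _ k 0 0 l (by simp), ee_constant _ 0 l k 0 (by simp),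
      ee_constant _ k l 0 0 (by simp)]
    ring
  have h2 : ∑ k, ∑ l, a.gi k l * a.ee 0 0 k l =
      a.k11 * a.h11J.dd 0 0 + 2 * a.k12 * a.h12J.dd 0 0 + a.k22 * a.h22J.dd 0 0 := by
    simp [Fin.sum_univ_four, gi, ee, μ]
    ring
  rw [ricJ, h0, ← h2]
  simp only [ric, h1, hess, chr_zero_zero, mul_zero, Finset.sum_const_zero, hP, mul_add,
    Finset.sum_add_distrib, mul_neg, Finset.sum_neg_distrib]
  ring

/-- The part of the component `UU` of the Ricci tensor that is small; `r1`, `z`, `rU`, `rc`, `rs`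
stand for `ρ_ε w`, `θ² - θ`, `U ρ_ε`, `ρ_ε c`, `ρ_ε s`. -/
def restUU (r1 z rU rc rs : R) : R :=
  2 * (a.k11 * ((rc + 2 * r1 * a.M11 + rs * (a.M11 ^ 2 + a.M12 ^ 2)) * a.M11
        + (2 * r1 * a.M12 + rs * ((a.M11 + a.M22) * a.M12)) * a.M12)
      + a.k12 * ((rc + 2 * r1 * a.M11 + rs * (a.M11 ^ 2 + a.M12 ^ 2)) * a.M12
        + (2 * r1 * a.M12 + rs * ((a.M11 + a.M22) * a.M12)) * a.M22)
      + a.k12 * ((2 * r1 * a.M12 + rs * ((a.M11 + a.M22) * a.M12)) * a.M11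
        + (rc + 2 * r1 * a.M22 + rs * (a.M12 ^ 2 + a.M22 ^ 2)) * a.M12)
      + a.k22 * ((2 * r1 * a.M12 + rs * ((a.M11 + a.M22) * a.M12)) * a.M12
        + (rc + 2 * r1 * a.M22 + rs * (a.M12 ^ 2 + a.M22 ^ 2)) * a.M22))
    - 2 * a.L * a.G * (a.Q * a.p0i * a.L * (rU * a.V + r1 * a.G))
    - 2 * a.θ * (a.k11 * (a.M11 ^ 2 + a.M12 ^ 2) + 2 * a.k12 * ((a.M11 + a.M22) * a.M12)
      + a.k22 * (a.M12 ^ 2 + a.M22 ^ 2))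
    - (a.k11 + a.k22) * (a.AJ.v * r1 + a.nJ.v * z + a.EJ.v * rU)
    + ∑ k, ∑ l, a.gi k l * ∑ s, ∑ t, a.gi s t * (chr a.e k 0 s * chr a.e 0 l t)

variable {a}

/-- This isolates the singular part. On the support of ρ_ε the transverse inverse k is close to 1/2
and Q is close to 1/p₀; substituting these values in the terms with r leaves the bracket of the
hypothesis, and the errors carry the harmless products r w, r U, r c, r s. The relation p₀ p₀⁻¹ = 1
is assumed only after multiplication by r, because p0i is a true inverse only near the wave. -/
theorem ricJ_zero_zero_withSecond {r r1 z rU rc rs : R} (hr1 : r1 = r * a.w)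
    (hrU : rU = r * a.U) (hrc : rc = r * a.cJ.v) (hrs : rs = r * a.s)
    (hp0 : r * (a.p0J.v * a.p0i - 1) = 0) (hQ : a.PJ.v * a.Q = 1)
    (kh11 : 2 * (a.h11J.v * a.k11 + a.h12J.v * a.k12) = 1)
    (kh12 : a.h11J.v * a.k12 + a.h12J.v * a.k22 = 0)
    (kh21 : a.h12J.v * a.k11 + a.h22J.v * a.k12 = 0)
    (kh22 : 2 * (a.h12J.v * a.k12 + a.h22J.v * a.k22) = 1) :
    (a.withSecond r r1 z rU).ricJ 0 0 =
      r * (-(a.M11 + a.M22) - 2 * a.L * a.G * a.p0i) + a.restUU r1 z rU rc rs := by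
  have d1 : (a.withSecond r r1 z rU).h11J.dd 0 0 = a.AJ.v * r1 + a.nJ.v * z + a.EJ.v * rU
      + 2 * r * a.M11 + 2 * a.θ * (a.M11 ^ 2 + a.M12 ^ 2) := by
    simp [withSecond, h11J, cJ, AJ, EJ, nJ, p0iJ, p0J, normJ, wJ, sJ, GJ, J11, J12, J22, Jet.coord, Jet.ofU,
      Jet.ofZ]
    ring
  have d2 : (a.withSecond r r1 z rU).h12J.dd 0 0 =
      2 * r * a.M12 + 2 * a.θ * ((a.M11 + a.M22) * a.M12) := by
    simp [withSecond, h12J, wJ, sJ, J11, J12, J22, Jet.ofU, Jet.ofZ]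
    ring
  have d3 : (a.withSecond r r1 z rU).h22J.dd 0 0 = a.AJ.v * r1 + a.nJ.v * z + a.EJ.v * rU
      + 2 * r * a.M22 + 2 * a.θ * (a.M12 ^ 2 + a.M22 ^ 2) := by
    simp [withSecond, h22J, cJ, AJ, EJ, nJ, p0iJ, p0J, normJ, wJ, sJ, GJ, J11, J12, J22, Jet.coord, Jet.ofU,
      Jet.ofZ]
    ring
  have v1 : a.h11J.v = 1 + a.cJ.v + 2 * a.w * a.M11 + a.s * (a.M11 ^ 2 + a.M12 ^ 2) := by
    simp [h11J, wJ, sJ, J11, J12, Jet.ofU, Jet.ofZ]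
    ring
  have v2 : a.h12J.v = 2 * a.w * a.M12 + a.s * ((a.M11 + a.M22) * a.M12) := by
    simp [h12J, wJ, sJ, J11, J12, J22, Jet.ofU, Jet.ofZ]
    ring
  have v3 : a.h22J.v = 1 + a.cJ.v + 2 * a.w * a.M22 + a.s * (a.M12 ^ 2 + a.M22 ^ 2) := by
    simp [h22J, wJ, sJ, J22, J12, Jet.ofU, Jet.ofZ]
    ring
  have hPp : a.p0J.v - a.PJ.v = a.L * (a.U * a.V + a.w * a.G) := by
    rw [PJ_v]
    simp [p0J, normJ, Jet.coord]
    ring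
  rw [ricJ_zero_zero, d1, d2, d3, e_withSecond, restUU]
  simp only [show (a.withSecond r r1 z rU).gi = a.gi from rfl,
    show (a.withSecond r r1 z rU).k11 = a.k11 from rfl,
    show (a.withSecond r r1 z rU).k12 = a.k12 from rfl,
    show (a.withSecond r r1 z rU).k22 = a.k22 from rfl,
    show (a.withSecond r r1 z rU).Q = a.Q from rfl,
    show (a.withSecond r r1 z rU).L = a.L from rfl,
    show (a.withSecond r r1 z rU).G = a.G from rfl,
    show (a.withSecond r r1 z rU).r = r from rfl]
  rw [v1, v2] at kh11 kh12
  rw [v2, v3] at kh21 kh22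
  -- The relations 2hk = 1 multiplied by r, with h = 1 + (h - 1): r k is r/2 up to products r(h - 1)
  -- k.
  have c1 : 2 * r * a.k11 = r - 2 * (a.k11 * (rc + 2 * r1 * a.M11 + rs * (a.M11 ^ 2 + a.M12 ^ 2))
      + a.k12 * (2 * r1 * a.M12 + rs * ((a.M11 + a.M22) * a.M12))) := by
    rw [hrc, hrs, hr1]
    linear_combination r * kh11
  have c2 : 2 * r * a.k12 =
      - 2 * (a.k12 * (rc + 2 * r1 * a.M11 + rs * (a.M11 ^ 2 + a.M12 ^ 2))
      + a.k22 * (2 * r1 * a.M12 + rs * ((a.M11 + a.M22) * a.M12))) := by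
    rw [hrc, hrs, hr1]
    linear_combination 2 * r * kh12
  have c3 : 2 * r * a.k12 =
      - 2 * (a.k12 * (rc + 2 * r1 * a.M22 + rs * (a.M12 ^ 2 + a.M22 ^ 2))
      + a.k11 * (2 * r1 * a.M12 + rs * ((a.M11 + a.M22) * a.M12))) := by
    rw [hrc, hrs, hr1]
    linear_combination 2 * r * kh21
  have c4 : 2 * r * a.k22 = r - 2 * (a.k22 * (rc + 2 * r1 * a.M22 + rs * (a.M12 ^ 2 + a.M22 ^ 2))
      + a.k12 * (2 * r1 * a.M12 + rs * ((a.M11 + a.M22) * a.M12))) := by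
    rw [hrc, hrs, hr1]
    linear_combination r * kh22
  -- The difference of the reciprocals of P and p₀, with p₀ - P = L(UV + wG).
  have c5 : r * a.Q - r * a.p0i = a.Q * a.p0i * a.L * (rU * a.V + r1 * a.G) := by
    rw [hrU, hr1]
    linear_combination (-a.Q) * hp0 + a.Q * a.p0i * r * hPp - r * a.p0i * hQ + 2 * r * a.p0i * hQ
  linear_combination (-a.M11) * c1 - a.M12 * c2 - a.M12 * c3 - a.M22 * c4 - 2 * a.L * a.G * c5

namespace IsReduced

variable (h : a.IsReduced)
include h

/-- Where w vanishes S is the identity, so 2k is too; z plays the role of a function concentrated in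
the transition layer. -/
theorem mul_k {z : R} (hz : z * a.w = 0) :
    2 * (z * a.k11) = z ∧ z * a.k12 = 0 ∧ 2 * (z * a.k22) = z := by
  have e1 := h.kh11
  have e2 := h.kh12
  have e4 := h.kh22
  rw [h.h11J_v, h.h12J_v] at e1 e2
  rw [h.h12J_v, h.h22J_v] at e4
  simp only [S11, S12, S22] at e1 e2 e4
  refine ⟨?_, ?_, ?_⟩
  · linear_combination z * e1 - (2 * a.k11 * (2 * a.M11 + a.w * (a.M11 ^ 2 + a.M12 ^ 2))
      + 2 * a.k12 * a.M12 * (2 + a.w * a.M11 + a.w * a.M22)) * hz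
  · linear_combination z * e2 - (a.k12 * (2 * a.M11 + a.w * (a.M11 ^ 2 + a.M12 ^ 2))
      + a.k22 * a.M12 * (2 + a.w * a.M11 + a.w * a.M22)) * hz
  · linear_combination z * e4 - (2 * a.k22 * (2 * a.M22 + a.w * (a.M22 ^ 2 + a.M12 ^ 2))
      + 2 * a.k12 * a.M12 * (2 + a.w * a.M11 + a.w * a.M22)) * hz

/-- Here the corrections earn their form. Against ρ_ε w, ρ_ε U and θ² - θ the inverse k may be
replaced by 1/2 and Q by 1/p₀. Then ρ_ε w has coefficient 2 tr M² - 2L²G²/p₀² = A, ρ_ε U has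
-2L²GV/p₀² = E, and the mismatch between s'' = 2θ and the quadratic Christoffel term in θ² leaves
(θ² - θ) tr M², with tr M² = B. The second derivatives of the correctors enter with the trace of k,
which is 1 here. -/
theorem restUU_eq_zero {r1 rU : R} (h1w : r1 * a.w = 0) (h1U : r1 * a.U = 0)
    (hUw : rU * a.w = 0) (hUU : rU * a.U = 0) (h1p : r1 * (a.p0J.v * a.p0i) = r1)
    (hUp : rU * (a.p0J.v * a.p0i) = rU) :
    a.restUU r1 (a.θ ^ 2 - a.θ) rU 0 0 = 0 := by
  have hzw : (a.θ ^ 2 - a.θ) * a.w = 0 := by linear_combination a.θ * h.wθ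
  obtain ⟨z1, z2, z3⟩ := h.mul_k hzw
  obtain ⟨r1k, r2k, r3k⟩ := h.mul_k h1w
  obtain ⟨u1, u2, u3⟩ := h.mul_k hUw
  have hquad : ∑ k, ∑ l, a.gi k l * ∑ s, ∑ t, a.gi s t * (chr a.e k 0 s * chr a.e 0 l t) =
      2 * a.θ ^ 2 * (a.k11 * (a.M11 ^ 2 + a.M12 ^ 2) + 2 * a.k12 * ((a.M11 + a.M22) * a.M12)
        + a.k22 * (a.M12 ^ 2 + a.M22 ^ 2)) := by
    simp only [h.sum_chr]
    simp [Fin.sum_univ_four, gi, W1, W2]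
    ring
  have hP : a.PJ.v = a.p0J.v - a.L * (a.U * a.V + a.w * a.G) := by
    rw [PJ_v]
    simp [p0J, normJ, Jet.coord]
    ring
  have hQ := h.Q
  rw [hP] at hQ
  have q1 : r1 * a.Q = r1 * a.p0i := by
    linear_combination (-a.Q) * h1p + r1 * a.p0i * hQ + a.Q * a.p0i * a.L * a.V * h1U
      + a.Q * a.p0i * a.L * a.G * h1w
  have q2 : rU * a.Q = rU * a.p0i := by
    linear_combination (-a.Q) * hUp + rU * a.p0i * hQ + a.Q * a.p0i * a.L * a.V * hUU
      + a.Q * a.p0i * a.L * a.G * hUw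
  have hA : a.AJ.v = 2 * a.nJ.v - 2 * a.L ^ 2 * (a.G ^ 2 * a.p0i ^ 2) := by
    simp [AJ, p0iJ, GJ, Jet.ofZ]
    ring
  have hE : a.EJ.v = - 2 * a.L ^ 2 * (a.G * a.V * a.p0i ^ 2) := by
    simp [EJ, p0iJ, GJ, Jet.ofZ, Jet.coord]
    ring
  have hn : a.nJ.v = a.M11 ^ 2 + 2 * a.M12 ^ 2 + a.M22 ^ 2 := by
    simp [nJ, J11, J12, J22, Jet.ofZ]
    ring
  have t1 : 2 * (r1 * (a.k11 + a.k22)) = 2 * r1 := by linear_combination r1k + r3k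
  -- Cancelling the factor 2 uses the atom `half`, which is its inverse in the quotient.
  have k1 : r1 * (a.k11 + a.k22) = r1 := by
    linear_combination a.half * (r1k + r3k) - (r1 * (a.k11 + a.k22) - r1) * h.half
  have k2 : rU * (a.k11 + a.k22) = rU := by
    linear_combination a.half * (u1 + u3) - (rU * (a.k11 + a.k22) - rU) * h.half
  have k3 : (a.θ ^ 2 - a.θ) * (a.k11 + a.k22) = a.θ ^ 2 - a.θ := by
    linear_combination a.half * (z1 + z3)
      - ((a.θ ^ 2 - a.θ) * (a.k11 + a.k22) - (a.θ ^ 2 - a.θ)) * h.half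
  rw [restUU, hquad, hA, hE, hn]
  linear_combination 2 * (a.M11 ^ 2 + a.M12 ^ 2) * r1k + 8 * ((a.M11 + a.M22) * a.M12) * r2k
    + 2 * (a.M12 ^ 2 + a.M22 ^ 2) * r3k
    - 2 * a.L ^ 2 * a.G * a.p0i * (a.V * q2 + a.G * q1)
    + (a.M11 ^ 2 + a.M12 ^ 2) * z1 + 4 * ((a.M11 + a.M22) * a.M12) * z2
    + (a.M12 ^ 2 + a.M22 ^ 2) * z3
    - (2 * (a.M11 ^ 2 + 2 * a.M12 ^ 2 + a.M22 ^ 2) - 2 * a.L ^ 2 * (a.G ^ 2 * a.p0i ^ 2)) * k1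
    - (a.M11 ^ 2 + 2 * a.M12 ^ 2 + a.M22 ^ 2) * k3
    + 2 * a.L ^ 2 * (a.G * a.V * a.p0i ^ 2) * k2

end IsReduced

end Atoms

end

section

/-! ### Derivatives of the profile -/

/-- The derivative in the direction `v`. -/
def dv (v : ℂ) (f : ℂ → ℝ) (z : ℂ) : ℝ := fderiv ℝ f z v

theorem contDiff_dv {f : ℂ → ℝ} {n m : WithTop ℕ∞} (hf : ContDiff ℝ n f) (hnm : m + 1 ≤ n)
    (v : ℂ) : ContDiff ℝ m (dv v f) :=
  (hf.fderiv_right hnm).clm_apply contDiff_const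

theorem dv_comm {f : ℂ → ℝ} (hf : ContDiff ℝ 2 f) (v w : ℂ) : dv v (dv w f) = dv w (dv v f) := by
  have hd : Differentiable ℝ (fderiv ℝ f) :=
    (hf.fderiv_right (m := 1) (by norm_num)).differentiable (by simp)
  have key : ∀ v w z, dv v (dv w f) z = fderiv ℝ (fderiv ℝ f) z v w := by
    intro v w z
    rw [dv, show dv w f = fun z => fderiv ℝ f z w from rfl,
      fderiv_clm_apply (hd z) (differentiableAt_const _)]
    simp
  ext z
  rw [key, key]
  have h := hf.contDiffAt (x := z)
  exact (h.isSymmSndFDerivAt (by simp)) v w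

theorem fderiv_eq_dv (f : ℂ → ℝ) : fderiv ℝ f =
    fun z => dv 1 f z • Complex.reCLM + dv Complex.I f z • Complex.imCLM := by
  ext z x
  have hx : x = x.re • (1 : ℂ) + x.im • Complex.I := by apply Complex.ext <;> simp
  conv_lhs => rw [hx, map_add, map_smul, map_smul]
  simp [dv]
  ring

theorem dv_const_mul {f : ℂ → ℝ} (hf : Differentiable ℝ f) (c : ℝ) (v : ℂ) :
    dv v (fun z => c * f z) = fun z => c * dv v f z := by
  ext z
  rw [dv, fderiv_const_mul (hf z)]
  simp [dv]

/-- The jet of a function of `Z`. -/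
theorem hasJet_ofZ {b : ℂ → ℝ} (p : Fin 4 → ℝ) (hb : ContDiffAt ℝ 1 b (zCoord p))
    (h1 : DifferentiableAt ℝ (dv 1 b) (zCoord p))
    (h2 : DifferentiableAt ℝ (dv Complex.I b) (zCoord p)) :
    HasJet (fun q => b (zCoord q)) p (.ofZ (b (zCoord p)) (dv 1 b (zCoord p))
      (dv Complex.I b (zCoord p)) (dv 1 (dv 1 b) (zCoord p)) (dv 1 (dv Complex.I b) (zCoord p))
      (dv Complex.I (dv Complex.I b) (zCoord p))) := by
  have hd : DifferentiableAt ℝ (fderiv ℝ b) (zCoord p) := by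
    rw [fderiv_eq_dv]
    exact (h1.smul_const _).add (h2.smul_const _)
  have h := hasJet_comp_z p hb hd
  have hs := h.symm 3 2
  convert h using 1
  ext i j
  · rfl
  · fin_cases i <;> simp [Jet.ofZ, zDir, dv]
  · fin_cases i <;> fin_cases j <;> simp [Jet.ofZ, zDir, dv]
    all_goals first | rfl | (simp [zDir] at hs; exact hs.symm)

/-- Symmetry at a single point of twice differentiability; `dv_comm` would need C², which the second
derivatives of H lack. -/
theorem dv_comm_at {b : ℂ → ℝ} {z : ℂ} (hb : ContDiffAt ℝ 1 b z)
    (h1 : DifferentiableAt ℝ (dv 1 b) z) (h2 : DifferentiableAt ℝ (dv Complex.I b) z) :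
    dv Complex.I (dv 1 b) z = dv 1 (dv Complex.I b) z := by
  have hz : zCoord ![0, 0, z.re, z.im] = z := by apply Complex.ext <;> simp [zCoord]
  rw [← hz] at hb h1 h2
  have hd : DifferentiableAt ℝ (fderiv ℝ b) (zCoord ![0, 0, z.re, z.im]) := by
    rw [fderiv_eq_dv]
    exact (h1.smul_const _).add (h2.smul_const _)
  have h := (hasJet_comp_z _ hb hd).symm 3 2
  rw [hz] at h
  simp [zDir] at h
  exact h

theorem iteratedFDeriv_three (H : ℂ → ℝ) (hH : ContDiff ℝ 3 H) (u v w : ℂ) (z : ℂ) :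
    iteratedFDeriv ℝ 3 H z ![u, v, w] = dv u (dv v (dv w H)) z := by
  have step : ∀ (n : ℕ) (hn : (n : WithTop ℕ∞) < 3) (x : ℂ) (m : Fin (n + 1) → ℂ),
      iteratedFDeriv ℝ (n + 1) H x m =
        fderiv ℝ (fun y => iteratedFDeriv ℝ n H y (Fin.tail m)) x (m 0) := by
    intro n hn x m
    have hd : DifferentiableAt ℝ (iteratedFDeriv ℝ n H) x :=
      hH.differentiable_iteratedFDeriv hn x
    rw [iteratedFDeriv_succ_apply_left]
    have := ((ContinuousMultilinearMap.apply ℝ (fun _ : Fin n => ℂ) ℝ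
      (Fin.tail m)).hasFDerivAt.comp x hd.hasFDerivAt).fderiv
    rw [show (fun y => iteratedFDeriv ℝ n H y (Fin.tail m)) =
      (ContinuousMultilinearMap.apply ℝ (fun _ : Fin n => ℂ) ℝ (Fin.tail m)) ∘
        (iteratedFDeriv ℝ n H) from rfl, this]
    rfl
  have h2 : ∀ z, iteratedFDeriv ℝ 1 H z ![w] = dv w H z := by
    intro z
    rw [step 0 (by norm_num)]
    simp [dv]
  have h3 : ∀ z, iteratedFDeriv ℝ 2 H z ![v, w] = dv v (dv w H) z := by
    intro z
    rw [step 1 (by norm_num)]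
    simp only [dv]
    congr 2
    ext y
    exact h2 y
  rw [step 2 (by norm_num)]
  simp only [dv]
  congr 2
  ext y
  exact h3 y

section Profile

variable (H : ℂ → ℝ)

def M11 (z : ℂ) : ℝ := 1 / 2 * dv 1 (dv 1 H) z
def M12 (z : ℂ) : ℝ := 1 / 2 * dv 1 (dv Complex.I H) z
def M22 (z : ℂ) : ℝ := 1 / 2 * dv Complex.I (dv Complex.I H) z

variable {H} (hH : IsC31Loc H)
include hH

theorem contDiff_dv_profile (v : ℂ) : ContDiff ℝ 2 (dv v H) :=
  contDiff_dv hH.1 (by norm_num) v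

theorem contDiff_dv_dv_profile (v w : ℂ) : ContDiff ℝ 1 (dv v (dv w H)) :=
  contDiff_dv (contDiff_dv_profile hH w) (by norm_num) v

theorem contDiff_M11 : ContDiff ℝ 1 (M11 H) := contDiff_const.mul (contDiff_dv_dv_profile hH _ _)
theorem contDiff_M12 : ContDiff ℝ 1 (M12 H) := contDiff_const.mul (contDiff_dv_dv_profile hH _ _)
theorem contDiff_M22 : ContDiff ℝ 1 (M22 H) := contDiff_const.mul (contDiff_dv_dv_profile hH _ _)

theorem dv_half (u v w : ℂ) : dv u (fun z => 1 / 2 * dv v (dv w H) z) =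
    fun z => 1 / 2 * dv u (dv v (dv w H)) z :=
  dv_const_mul ((contDiff_dv_dv_profile hH v w).differentiable (by simp)) _ _

/-- Total symmetry of D³H reduces the derivatives of M to t₀, …, t₃. -/
theorem dv_I_M11 : dv Complex.I (M11 H) = dv 1 (M12 H) := by
  rw [show M11 H = fun z => 1 / 2 * dv 1 (dv 1 H) z from rfl,
    show M12 H = fun z => 1 / 2 * dv 1 (dv Complex.I H) z from rfl, dv_half hH, dv_half hH,
    dv_comm (contDiff_dv_profile hH 1), dv_comm (hH.1.of_le (by norm_num)) Complex.I 1]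

theorem dv_I_M12 : dv Complex.I (M12 H) = dv 1 (M22 H) := by
  rw [show M22 H = fun z => 1 / 2 * dv Complex.I (dv Complex.I H) z from rfl,
    show M12 H = fun z => 1 / 2 * dv 1 (dv Complex.I H) z from rfl, dv_half hH, dv_half hH,
    dv_comm (contDiff_dv_profile hH Complex.I)]

theorem half_third (u v w : ℂ) : (fun z => 1 / 2 * dv u (dv v (dv w H)) z) =
    fun z => 1 / 2 * iteratedFDeriv ℝ 3 H z ![u, v, w] := by
  ext z
  rw [iteratedFDeriv_three H hH.1]

/-- The directional derivatives of the second derivatives are `C⁰`, differentiable where `D³H` is,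
and have bounded derivative on compact sets. -/
def IsThird (H f : ℂ → ℝ) : Prop :=
  ∃ u v w : ℂ, f = fun z => 1 / 2 * iteratedFDeriv ℝ 3 H z ![u, v, w]

omit hH in
theorem IsThird.differentiableAt {f : ℂ → ℝ} (hf : IsThird H f) {z : ℂ}
    (hz : DifferentiableAt ℝ (iteratedFDeriv ℝ 3 H) z) : DifferentiableAt ℝ f z := by
  obtain ⟨u, v, w, rfl⟩ := hf
  exact (((ContinuousMultilinearMap.apply ℝ (fun _ : Fin 3 => ℂ) ℝ
    ![u, v, w]).differentiableAt.comp z hz)).const_mul (1 / 2)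

theorem IsThird.continuous {f : ℂ → ℝ} (hf : IsThird H f) : Continuous f := by
  obtain ⟨u, v, w, rfl⟩ := hf
  exact continuous_const.mul ((ContinuousMultilinearMap.apply ℝ (fun _ : Fin 3 => ℂ) ℝ
    ![u, v, w]).continuous.comp (hH.1.continuous_iteratedFDeriv (by simp)))

theorem IsThird.locallyLipschitz {f : ℂ → ℝ} (hf : IsThird H f) : LocallyLipschitz f := by
  obtain ⟨u, v, w, rfl⟩ := hf
  have h1 : LocallyLipschitz fun z => iteratedFDeriv ℝ 3 H z ![u, v, w] :=
    (ContinuousMultilinearMap.apply ℝ (fun _ : Fin 3 => ℂ) ℝ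
      ![u, v, w]).lipschitz.locallyLipschitz.comp hH.2
  exact (lipschitzWith_smul (1 / 2 : ℝ)).locallyLipschitz.comp h1

/-- Local Lipschitz constants bound the derivative, and compactness makes finitely many of them
suffice. Where f is not differentiable `fderiv` is 0, so the bound holds at every point and fourth
derivatives of H define bounded atoms on all of K. -/
theorem IsThird.exists_bound {f : ℂ → ℝ} (hf : IsThird H f) {K : Set ℂ} (hK : IsCompact K)
    (v : ℂ) : ∃ C, ∀ z ∈ K, |dv v f z| ≤ C := by
  have hL := hf.locallyLipschitz hH
  refine hK.induction_on (p := fun s => ∃ C, ∀ z ∈ s, |dv v f z| ≤ C) ⟨0, by simp⟩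
    (fun s t hst ⟨C, hC⟩ => ⟨C, fun z hz => hC z (hst hz)⟩)
    (fun s t ⟨C, hC⟩ ⟨D, hD⟩ => ⟨max C D, fun z hz => ?_⟩) fun z _ => ?_
  · rcases hz with hz | hz
    · exact (hC z hz).trans (le_max_left _ _)
    · exact (hD z hz).trans (le_max_right _ _)
  · obtain ⟨C, t, ht, hC⟩ := hL z
    obtain ⟨s, hst, hs, hzs⟩ := mem_nhds_iff.mp ht
    refine ⟨s, mem_nhdsWithin_of_mem_nhds (hs.mem_nhds hzs), C * ‖v‖, fun y hy => ?_⟩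
    have := norm_fderiv_le_of_lipschitzOn ℝ (hs.mem_nhds hy) (hC.mono hst)
    exact ((fderiv ℝ f y).le_opNorm v).trans (by gcongr)

theorem isThird_dv_M11 (v : ℂ) : IsThird H (dv v (M11 H)) :=
  ⟨v, 1, 1, (dv_half hH v 1 1).trans (half_third hH v 1 1)⟩

theorem isThird_dv_M12 (v : ℂ) : IsThird H (dv v (M12 H)) :=
  ⟨v, 1, Complex.I, (dv_half hH v 1 Complex.I).trans (half_third hH v 1 Complex.I)⟩

theorem isThird_dv_M22 (v : ℂ) : IsThird H (dv v (M22 H)) :=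
  ⟨v, Complex.I, Complex.I,
    (dv_half hH v Complex.I Complex.I).trans (half_third hH v Complex.I Complex.I)⟩

/-! ### The Wirtinger derivatives -/

omit hH in
theorem fderiv_ofReal_comb {f g : ℂ → ℝ} {z : ℂ} (hf : DifferentiableAt ℝ f z)
    (hg : DifferentiableAt ℝ g z) (c d : ℂ) (v : ℂ) :
    fderiv ℝ (fun z => c * (f z : ℂ) + d * (g z : ℂ)) z v = c * dv v f z + d * dv v g z := by
  have h1 : HasFDerivAt (fun z => (f z : ℂ)) (Complex.ofRealCLM.comp (fderiv ℝ f z)) z :=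
    Complex.ofRealCLM.hasFDerivAt.comp z hf.hasFDerivAt
  have h2 : HasFDerivAt (fun z => (g z : ℂ)) (Complex.ofRealCLM.comp (fderiv ℝ g z)) z :=
    Complex.ofRealCLM.hasFDerivAt.comp z hg.hasFDerivAt
  rw [((h1.const_mul c).fun_add (h2.const_mul d)).fderiv]
  simp [dv]

omit hH in
theorem fderiv_toC {z : ℂ} (hf : DifferentiableAt ℝ H z) (v : ℂ) :
    fderiv ℝ (toC H) z v = dv v H z := by
  have := (Complex.ofRealCLM.hasFDerivAt.comp z hf.hasFDerivAt).fderiv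
  rw [show toC H = Complex.ofRealCLM ∘ H from rfl, this]
  simp [dv]

theorem dZ_toC : dZ (toC H) = fun z => 1 / 2 * (dv 1 H z : ℂ)
    + -(Complex.I / 2) * (dv Complex.I H z : ℂ) := by
  ext z
  have hd := hH.1.differentiable (by simp) z
  rw [dZ, fderiv_toC hd, fderiv_toC hd]
  ring

theorem dZbar_toC : dZbar (toC H) = fun z => 1 / 2 * (dv 1 H z : ℂ)
    + Complex.I / 2 * (dv Complex.I H z : ℂ) := by
  ext z
  have hd := hH.1.differentiable (by simp) z
  rw [dZbar, fderiv_toC hd, fderiv_toC hd]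
  ring

theorem HZZ_eq (z : ℂ) : HZZ H z = ⟨1 / 2 * (M11 H z - M22 H z), -M12 H z⟩ := by
  have h1 := (contDiff_dv_profile hH 1).differentiable (by simp) z
  have h2 := (contDiff_dv_profile hH Complex.I).differentiable (by simp) z
  rw [HZZ, dZ_toC hH, dZ, fderiv_ofReal_comb h1 h2, fderiv_ofReal_comb h1 h2]
  rw [dv_comm (hH.1.of_le (by norm_num)) Complex.I 1]
  apply Complex.ext <;> simp [M11, M12, M22]
  all_goals ring

theorem HZbZb_eq (z : ℂ) : HZbZb H z = ⟨1 / 2 * (M11 H z - M22 H z), M12 H z⟩ := by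
  have h1 := (contDiff_dv_profile hH 1).differentiable (by simp) z
  have h2 := (contDiff_dv_profile hH Complex.I).differentiable (by simp) z
  rw [HZbZb, dZbar_toC hH, dZbar, fderiv_ofReal_comb h1 h2, fderiv_ofReal_comb h1 h2]
  rw [dv_comm (hH.1.of_le (by norm_num)) Complex.I 1]
  apply Complex.ext <;> simp [M11, M12, M22]
  all_goals ring

theorem HZZb_eq (z : ℂ) : HZZb H z = 1 / 2 * (M11 H z + M22 H z) := by
  have h1 := (contDiff_dv_profile hH 1).differentiable (by simp) z
  have h2 := (contDiff_dv_profile hH Complex.I).differentiable (by simp) z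
  rw [HZZb, dZbar_toC hH, dZ, fderiv_ofReal_comb h1 h2, fderiv_ofReal_comb h1 h2]
  simp [M11, M22]
  ring

theorem G_eq : G H = fun z => H z + (-z.re * dv 1 H z + -z.im * dv Complex.I H z) := by
  ext z
  rw [G, dZ_toC hH, dZbar_toC hH]
  simp [toC]
  ring

theorem contDiff_G : ContDiff ℝ 2 (G H) := by
  rw [G_eq hH]
  have h1 := contDiff_dv_profile hH 1
  have h2 := contDiff_dv_profile hH Complex.I
  have h3 := hH.1.of_le (show (2 : WithTop ℕ∞) ≤ 3 by norm_num)
  have h4 : ContDiff ℝ 2 fun z : ℂ => z.re := Complex.reCLM.contDiff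
  have h5 : ContDiff ℝ 2 fun z : ℂ => z.im := Complex.imCLM.contDiff
  exact h3.add ((h4.neg.mul h1).add (h5.neg.mul h2))

omit hH in
theorem dv_re_mul_add_im_mul {f g : ℂ → ℝ} (hf : Differentiable ℝ f) (hg : Differentiable ℝ g)
    (v z : ℂ) : dv v (fun z => -z.re * f z + -z.im * g z) z =
      -v.re * f z - z.re * dv v f z - v.im * g z - z.im * dv v g z := by
  have h4 : HasFDerivAt (fun z : ℂ => -z.re) (-Complex.reCLM) z :=
    Complex.reCLM.hasFDerivAt.neg
  have h5 : HasFDerivAt (fun z : ℂ => -z.im) (-Complex.imCLM) z :=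
    Complex.imCLM.hasFDerivAt.neg
  rw [dv, ((h4.fun_mul (hf z).hasFDerivAt).fun_add (h5.fun_mul (hg z).hasFDerivAt)).fderiv]
  simp [dv]
  ring

/-- First derivatives of H cancel, so ∇G = -2Mx; the two-jet of G needs no derivative of H beyond
the third. -/
theorem dv_G (v : ℂ) : dv v (G H) = fun z =>
    -z.re * dv v (dv 1 H) z + -z.im * dv v (dv Complex.I H) z := by
  ext z
  have h0 := hH.1.differentiable (by simp) z
  have h1 := (contDiff_dv_profile hH 1).differentiable (by simp)
  have h2 := (contDiff_dv_profile hH Complex.I).differentiable (by simp)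
  have h3 : DifferentiableAt ℝ (fun z => -z.re * dv 1 H z + -z.im * dv Complex.I H z) z := by
    have h4 : DifferentiableAt ℝ (fun z : ℂ => z.re) z := Complex.reCLM.differentiableAt
    have h5 : DifferentiableAt ℝ (fun z : ℂ => z.im) z := Complex.imCLM.differentiableAt
    exact (h4.neg.mul (h1 z)).add (h5.neg.mul (h2 z))
  have h6 := dv_re_mul_add_im_mul h1 h2 v z
  rw [dv] at h6
  rw [G_eq hH, dv, fderiv_fun_add h0 h3, add_apply, h6]
  have hv : fderiv ℝ H z v = v.re * dv 1 H z + v.im * dv Complex.I H z := by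
    rw [fderiv_eq_dv]
    simp
    ring
  rw [hv]
  ring

theorem dv_one_G : dv 1 (G H) = fun z => 2 * (-z.re * M11 H z + -z.im * M12 H z) := by
  rw [dv_G hH]
  ext z
  simp only [M11, M12]
  ring

theorem dv_I_G : dv Complex.I (G H) = fun z => 2 * (-z.re * M12 H z + -z.im * M22 H z) := by
  rw [dv_G hH, dv_comm (hH.1.of_le (by norm_num)) Complex.I 1]
  ext z
  simp only [M12, M22]
  ring

theorem dv_dv_one_G (v z : ℂ) : dv v (dv 1 (G H)) z = 2 * (-v.re * M11 H z
    - z.re * dv v (M11 H) z - v.im * M12 H z - z.im * dv v (M12 H) z) := by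
  have h1 := (contDiff_M11 hH).differentiable (by simp)
  have h2 := (contDiff_M12 hH).differentiable (by simp)
  rw [dv_one_G hH, ← dv_re_mul_add_im_mul h1 h2]
  refine congrFun (dv_const_mul ?_ 2 v) z
  have h4 : Differentiable ℝ (fun z : ℂ => z.re) := Complex.reCLM.differentiable
  have h5 : Differentiable ℝ (fun z : ℂ => z.im) := Complex.imCLM.differentiable
  exact (h4.fun_neg.fun_mul h1).fun_add (h5.fun_neg.fun_mul h2)

theorem dv_dv_I_G (v z : ℂ) : dv v (dv Complex.I (G H)) z = 2 * (-v.re * M12 H z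
    - z.re * dv v (M12 H) z - v.im * M22 H z - z.im * dv v (M22 H) z) := by
  have h1 := (contDiff_M12 hH).differentiable (by simp)
  have h2 := (contDiff_M22 hH).differentiable (by simp)
  rw [dv_I_G hH, ← dv_re_mul_add_im_mul h1 h2]
  refine congrFun (dv_const_mul ?_ 2 v) z
  have h4 : Differentiable ℝ (fun z : ℂ => z.re) := Complex.reCLM.differentiable
  have h5 : Differentiable ℝ (fun z : ℂ => z.im) := Complex.imCLM.differentiable
  exact (h4.fun_neg.fun_mul h1).fun_add (h5.fun_neg.fun_mul h2)

end Profile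

end

section

/-! ### The metrics in real form -/

theorem toRealFrame_blockMatrix (a b r : ℝ) :
    toRealFrame (blockMatrix ⟨a, b⟩ (r : ℂ) ⟨a, -b⟩) =
      !![0, -1, 0, 0; -1, 0, 0, 0; 0, 0, 2 * (a + r), -(2 * b); 0, 0, -(2 * b), 2 * (r - a)] := by
  ext i j
  fin_cases i <;> fin_cases j <;>
    simp [toRealFrame, blockMatrix, frameChange, Matrix.mul_apply, Fin.sum_univ_four] <;> ring

/-- The correction `A κ + B ζ + E ι`. -/
def corr (Λ : ℝ) (H : ℂ → ℝ) (ρ : ℝ → ℝ) (ε : ℝ) (p : Fin 4 → ℝ) : ℝ :=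
  coeffA Λ H (zCoord p) * kappaEps ρ ε (p 0) + coeffB H (zCoord p) * zetaEps ρ ε (p 0)
    + coeffE Λ H (p 1) (zCoord p) * iotaEps ρ ε (p 0)

/-- Half the metric `-2 dU dV + 2 ((1 + c) + 2 w M + s M²)`. -/
def halfMetric (H : ℂ → ℝ) (w s c : ℝ) (z : ℂ) : Matrix (Fin 4) (Fin 4) ℝ :=
  !![0, -(1 / 2), 0, 0; -(1 / 2), 0, 0, 0;
    0, 0, 1 + c + 2 * (w * M11 H z) + s * (M11 H z * M11 H z + M12 H z * M12 H z),
      2 * (w * M12 H z) + s * ((M11 H z + M22 H z) * M12 H z);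
    0, 0, 2 * (w * M12 H z) + s * ((M11 H z + M22 H z) * M12 H z),
      1 + c + 2 * (w * M22 H z) + s * (M12 H z * M12 H z + M22 H z * M22 H z)]

variable {Λ : ℝ} {H : ℂ → ℝ} (hH : IsC31Loc H)
include hH

/-- In real coordinates the linear terms are the entries of M and the quadratic ones those of M², so
the block is a polynomial in one symmetric matrix. -/
theorem toRealFrame_eq_halfMetric (w s c : ℝ) (z : ℂ) : toRealFrame (blockMatrix
    (2 * HZZ H z * w + 2 * HZZb H z * HZZ H z * s)
    ((1 + 2 * HZZb H z * w + (HZZb H z ^ 2 + Complex.normSq (HZbZb H z)) * s + c : ℝ) : ℂ)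
    (2 * HZbZb H z * w + 2 * HZZb H z * HZbZb H z * s)) = (2 : ℝ) • halfMetric H w s c z := by
  have e1 : 2 * HZZ H z * w + 2 * HZZb H z * HZZ H z * s =
      ⟨(M11 H z - M22 H z) * (w + HZZb H z * s), -2 * M12 H z * (w + HZZb H z * s)⟩ := by
    rw [HZZ_eq hH]
    apply Complex.ext <;> simp <;> ring
  have e2 : 2 * HZbZb H z * w + 2 * HZZb H z * HZbZb H z * s =
      ⟨(M11 H z - M22 H z) * (w + HZZb H z * s), -(-2 * M12 H z * (w + HZZb H z * s))⟩ := by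
    rw [HZbZb_eq hH]
    apply Complex.ext <;> simp <;> ring
  rw [e1, e2, toRealFrame_blockMatrix, HZbZb_eq hH, HZZb_eq hH]
  ext i j
  fin_cases i <;> fin_cases j <;> simp [halfMetric, Complex.normSq_mk] <;> ring

theorem approxMetric_eq (ρ : ℝ → ℝ) (ε : ℝ) (p : Fin 4 → ℝ) :
    approxMetric Λ H ρ ε p = (1 / PEps Λ H ρ ε p ^ 2) • (2 : ℝ) • halfMetric H
      (mollify ρ ε uPlus (p 0)) (mollify ρ ε (fun u => uPlus u ^ 2) (p 0)) (corr Λ H ρ ε p)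
      (zCoord p) := by
  rw [← toRealFrame_eq_halfMetric hH, approxMetric]
  congr 3
  push_cast [corr]
  ring

theorem waveMetric_eq (p : Fin 4 → ℝ) :
    waveMetric Λ H p = (1 / P Λ H p ^ 2) • (2 : ℝ) • halfMetric H
      (uPlus (p 0)) (uPlus (p 0) ^ 2) 0 (zCoord p) := by
  rw [← toRealFrame_eq_halfMetric hH, waveMetric]
  congr 3
  · push_cast
    ring
  · push_cast
    ring
  · push_cast
    ring

/-- The terms mixing G and H_{ZZ̄} cancel, leaving 2 tr M² - 2(Λ/6)² G²/p₀². -/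
theorem coeffA_eq {z : ℂ} (hz : bgFactor Λ z ≠ 0) : coeffA Λ H z =
    2 * (M11 H z * M11 H z + 2 * (M12 H z * M12 H z) + M22 H z * M22 H z)
    + -2 * (Λ / 6) ^ 2 * (G H z * G H z * ((bgFactor Λ z)⁻¹ * (bgFactor Λ z)⁻¹)) := by
  rw [coeffA, HZZb_eq hH, HZbZb_eq hH, Complex.normSq_mk]
  field_simp
  ring

theorem coeffB_eq (z : ℂ) : coeffB H z =
    M11 H z * M11 H z + 2 * (M12 H z * M12 H z) + M22 H z * M22 H z := by
  rw [coeffB, HZZb_eq hH, HZbZb_eq hH, Complex.normSq_mk]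
  ring

omit hH in
theorem coeffE_eq (V : ℝ) (z : ℂ) : coeffE Λ H V z =
    -2 * (Λ / 6) ^ 2 * (G H z * V * ((bgFactor Λ z)⁻¹ * (bgFactor Λ z)⁻¹)) := by
  rw [coeffE]
  ring

end

section

/-! ### The two-jet of the regularised metric at a point -/

/-- The reciprocal of `1 + (Λ/6) |Z|²`, replaced by zero where the corrections vanish. -/
def bgInv (Λ ε : ℝ) (p : Fin 4 → ℝ) : ℝ :=
  if p 0 < -ε then 0 else (bgFactor Λ (zCoord p))⁻¹

/-- The coefficients of half the regularised metric before the conformal change. -/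
def halfApprox (Λ : ℝ) (H : ℂ → ℝ) (ρ : ℝ → ℝ) (ε : ℝ) (p : Fin 4 → ℝ) :
    Matrix (Fin 4) (Fin 4) ℝ :=
  halfMetric H (mollify ρ ε uPlus (p 0)) (mollify ρ ε (fun u => uPlus u ^ 2) (p 0))
    (corr Λ H ρ ε p) (zCoord p)

/-- The determinant of the transverse part of `halfApprox`. -/
def transDet (Λ : ℝ) (H : ℂ → ℝ) (ρ : ℝ → ℝ) (ε : ℝ) (p : Fin 4 → ℝ) : ℝ :=
  halfApprox Λ H ρ ε p 2 2 * halfApprox Λ H ρ ε p 3 3 - halfApprox Λ H ρ ε p 2 3 ^ 2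

/-- The quantities of which the two-jet of the regularised metric at `p` is built, except for the
second derivatives of the functions of `U`. -/
def realAtoms (Λ : ℝ) (H : ℂ → ℝ) (ρ : ℝ → ℝ) (ε : ℝ) (p : Fin 4 → ℝ) : Atoms ℝ where
  half := 1 / 2
  L := Λ / 6
  U := p 0
  V := p 1
  x1 := p 2
  x2 := p 3
  w := mollify ρ ε uPlus (p 0)
  θ := mollify ρ ε heaviside (p 0)
  r := 0
  s := mollify ρ ε (fun u => uPlus u ^ 2) (p 0)
  κ := kappaEps ρ ε (p 0)
  κ1 := deriv (kappaEps ρ ε) (p 0)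
  κ2 := 0
  ζ := zetaEps ρ ε (p 0)
  ζ1 := deriv (zetaEps ρ ε) (p 0)
  ζ2 := 0
  ι := iotaEps ρ ε (p 0)
  ι1 := deriv (iotaEps ρ ε) (p 0)
  ι2 := 0
  G := G H (zCoord p)
  M11 := M11 H (zCoord p)
  M12 := M12 H (zCoord p)
  M22 := M22 H (zCoord p)
  t0 := dv 1 (M11 H) (zCoord p)
  t1 := dv 1 (M12 H) (zCoord p)
  t2 := dv 1 (M22 H) (zCoord p)
  t3 := dv Complex.I (M22 H) (zCoord p)
  q0 := dv 1 (dv 1 (M11 H)) (zCoord p)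
  q1 := dv 1 (dv 1 (M12 H)) (zCoord p)
  q2 := dv 1 (dv 1 (M22 H)) (zCoord p)
  q3 := dv 1 (dv Complex.I (M22 H)) (zCoord p)
  q4 := dv Complex.I (dv Complex.I (M22 H)) (zCoord p)
  p0i := bgInv Λ ε p
  Q := (PEps Λ H ρ ε p)⁻¹
  k11 := (2 * transDet Λ H ρ ε p)⁻¹ * halfApprox Λ H ρ ε p 3 3
  k12 := (2 * transDet Λ H ρ ε p)⁻¹ * -halfApprox Λ H ρ ε p 2 3
  k22 := (2 * transDet Λ H ρ ε p)⁻¹ * halfApprox Λ H ρ ε p 2 2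

/-- The quantities of which the two-jet of the regularised metric at `p` is built. -/
def fullAtoms (Λ : ℝ) (H : ℂ → ℝ) (ρ : ℝ → ℝ) (ε : ℝ) (p : Fin 4 → ℝ) : Atoms ℝ :=
  (realAtoms Λ H ρ ε p).withSecond (rhoEps ρ ε (p 0))
    (mollify ρ ε uPlus (p 0) * rhoEps ρ ε (p 0)) (sigmaEps ρ ε (p 0)) (p 0 * rhoEps ρ ε (p 0))

variable {Λ : ℝ} {H : ℂ → ℝ} (hH : IsC31Loc H) {ρ : ℝ → ℝ} (hρ : IsMollifier ρ)
  {ε : ℝ} (hε : 0 < ε) {p : Fin 4 → ℝ}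

theorem IsCorrector.hasJet {a f : ℝ → ℝ} (h : IsCorrector ε a f) (p : Fin 4 → ℝ) :
    HasJet (fun q => a (q 0)) p (.ofU (a (p 0)) (deriv a (p 0)) (f (p 0))) :=
  hasJet_comp_zero p h.hasDerivAt
    (continuous_iff_continuousAt.mpr fun u => (h.hasDerivAt_deriv u).continuousAt)
    (h.hasDerivAt_deriv _)

section
include hρ hε

theorem hasJet_wJ (p : Fin 4 → ℝ) :
    HasJet (fun q => mollify ρ ε uPlus (q 0)) p (fullAtoms Λ H ρ ε p).wJ :=
  hasJet_comp_zero p (hasDerivAt_mollify_uPlus hρ hε) (continuous_mollify_heaviside hρ hε)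
    (hasDerivAt_mollify_heaviside hρ hε _)

theorem hasJet_sJ (p : Fin 4 → ℝ) :
    HasJet (fun q => mollify ρ ε (fun u => uPlus u ^ 2) (q 0)) p (fullAtoms Λ H ρ ε p).sJ :=
  hasJet_comp_zero p (hasDerivAt_mollify_uPlus_sq hρ hε)
    ((continuous_mollify_uPlus hρ hε).const_mul 2) ((hasDerivAt_mollify_uPlus hρ hε _).const_mul 2)

end

theorem hasJet_normJ (p : Fin 4 → ℝ) :
    HasJet (fun q => Complex.normSq (zCoord q)) p (fullAtoms Λ H ρ ε p).normJ :=
  (((hasJet_coord 2 p).mul (hasJet_coord 2 p)).add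
    ((hasJet_coord 3 p).mul (hasJet_coord 3 p))).congr
    (Eventually.of_forall fun q => by simp [zCoord, Complex.normSq_mk])

theorem hasJet_p0J (p : Fin 4 → ℝ) :
    HasJet (fun q => bgFactor Λ (zCoord q)) p (fullAtoms Λ H ρ ε p).p0J :=
  (HasJet.const 1 p).add ((HasJet.const (Λ / 6) p).mul (hasJet_normJ p))

theorem hasJet_p0iJ (h0 : ¬p 0 < -ε) (hz : bgFactor Λ (zCoord p) ≠ 0) :
    HasJet (fun q => (bgFactor Λ (zCoord q))⁻¹) p (fullAtoms Λ H ρ ε p).p0iJ := by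
  have h := hasJet_p0J (Λ := Λ) (H := H) (ρ := ρ) (ε := ε) p
  refine h.inv ?_
  rw [← h.val]
  show bgFactor Λ (zCoord p) * bgInv Λ ε p = 1
  rw [bgInv, if_neg h0, mul_inv_cancel₀ hz]

include hH

theorem hasJet_GJ (p : Fin 4 → ℝ) :
    HasJet (fun q => G H (zCoord q)) p (fullAtoms Λ H ρ ε p).GJ := by
  have hG := contDiff_G hH
  have h := hasJet_ofZ p (hG.of_le (by norm_num)).contDiffAt
    ((contDiff_dv hG (m := 1) (by norm_num) 1).differentiable (by simp) _)
    ((contDiff_dv hG (m := 1) (by norm_num) Complex.I).differentiable (by simp) _)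
  convert h using 1
  have e1 := dv_dv_one_G hH 1 (zCoord p)
  have e2 := dv_dv_I_G hH 1 (zCoord p)
  have e3 := dv_dv_I_G hH Complex.I (zCoord p)
  rw [e1, e2, e3, dv_one_G hH, dv_I_G hH, dv_I_M12 hH]
  simp only [Atoms.GJ, fullAtoms, Atoms.withSecond, realAtoms]
  simp only [zCoord, Complex.one_re, Complex.one_im, Complex.I_re, Complex.I_im]
  congr 1 <;> ring

theorem hasJet_J11 (hz : DifferentiableAt ℝ (iteratedFDeriv ℝ 3 H) (zCoord p)) :
    HasJet (fun q => M11 H (zCoord q)) p (fullAtoms Λ H ρ ε p).J11 := by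
  have h := hasJet_ofZ p (contDiff_M11 hH).contDiffAt
    ((isThird_dv_M11 hH 1).differentiableAt hz)
    ((isThird_dv_M11 hH Complex.I).differentiableAt hz)
  rw [dv_I_M11 hH, dv_comm_at (contDiff_M12 hH).contDiffAt
    ((isThird_dv_M12 hH 1).differentiableAt hz)
    ((isThird_dv_M12 hH Complex.I).differentiableAt hz), dv_I_M12 hH] at h
  exact h

theorem hasJet_J12 (hz : DifferentiableAt ℝ (iteratedFDeriv ℝ 3 H) (zCoord p)) :
    HasJet (fun q => M12 H (zCoord q)) p (fullAtoms Λ H ρ ε p).J12 := by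
  have h := hasJet_ofZ p (contDiff_M12 hH).contDiffAt
    ((isThird_dv_M12 hH 1).differentiableAt hz)
    ((isThird_dv_M12 hH Complex.I).differentiableAt hz)
  rw [dv_I_M12 hH, dv_comm_at (contDiff_M22 hH).contDiffAt
    ((isThird_dv_M22 hH 1).differentiableAt hz)
    ((isThird_dv_M22 hH Complex.I).differentiableAt hz)] at h
  exact h

theorem hasJet_J22 (hz : DifferentiableAt ℝ (iteratedFDeriv ℝ 3 H) (zCoord p)) :
    HasJet (fun q => M22 H (zCoord q)) p (fullAtoms Λ H ρ ε p).J22 :=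
  hasJet_ofZ p (contDiff_M22 hH).contDiffAt ((isThird_dv_M22 hH 1).differentiableAt hz)
    ((isThird_dv_M22 hH Complex.I).differentiableAt hz)

include hρ hε

omit hH in
theorem corr_eventuallyEq_zero (h0 : p 0 < -ε) : corr Λ H ρ ε =ᶠ[𝓝 p] fun _ => 0 := by
  have : ∀ᶠ q : Fin 4 → ℝ in 𝓝 p, q 0 < -ε :=
    (continuous_apply 0).continuousAt.eventually (gt_mem_nhds h0)
  filter_upwards [this] with q hq
  rw [corr, (isCorrector_kappaEps hρ hε).eq_zero _ hq.le, (isCorrector_zetaEps hρ hε).eq_zero _ hq.le,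
    (isCorrector_iotaEps hρ hε).eq_zero _ hq.le]
  ring

/-- For U < -ε all correctors vanish nearby, so p₀ may have zeros there. Elsewhere p₀ ≠ 0, and the
jet follows from the product and reciprocal rules. -/
theorem hasJet_cJ (hz : DifferentiableAt ℝ (iteratedFDeriv ℝ 3 H) (zCoord p))
    (hp : p 0 < -ε ∨ bgFactor Λ (zCoord p) ≠ 0) :
    HasJet (corr Λ H ρ ε) p (fullAtoms Λ H ρ ε p).cJ := by
  have hκ := isCorrector_kappaEps hρ hε
  have hζ := isCorrector_zetaEps hρ hε
  have hι := isCorrector_iotaEps hρ hε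
  by_cases h0 : p 0 < -ε
  · convert (HasJet.const 0 p).congr (corr_eventuallyEq_zero hρ hε h0) using 1
    have e1 : Jet.ofU (fullAtoms Λ H ρ ε p).κ (fullAtoms Λ H ρ ε p).κ1 (fullAtoms Λ H ρ ε p).κ2 =
        .const 0 := by
      ext <;> simp [Jet.ofU, fullAtoms, Atoms.withSecond, realAtoms, hκ.eq_zero _ h0.le,
        hκ.deriv_eq_zero _ h0.le, rhoEps_eq_zero_of_le hρ hε h0.le]
    have e2 : Jet.ofU (fullAtoms Λ H ρ ε p).ζ (fullAtoms Λ H ρ ε p).ζ1 (fullAtoms Λ H ρ ε p).ζ2 =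
        .const 0 := by
      ext <;> simp [Jet.ofU, fullAtoms, Atoms.withSecond, realAtoms, hζ.eq_zero _ h0.le,
        hζ.deriv_eq_zero _ h0.le, sigmaEps_of_le hρ hε h0.le]
    have e3 : Jet.ofU (fullAtoms Λ H ρ ε p).ι (fullAtoms Λ H ρ ε p).ι1 (fullAtoms Λ H ρ ε p).ι2 =
        .const 0 := by
      ext <;> simp [Jet.ofU, fullAtoms, Atoms.withSecond, realAtoms, hι.eq_zero _ h0.le,
        hι.deriv_eq_zero _ h0.le, rhoEps_eq_zero_of_le hρ hε h0.le]
    rw [Atoms.cJ, e1, e2, e3]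
    ext <;> simp
  · have hz0 : bgFactor Λ (zCoord p) ≠ 0 := hp.resolve_left h0
    have j11 := hasJet_J11 (Λ := Λ) (ρ := ρ) (ε := ε) hH hz
    have j12 := hasJet_J12 (Λ := Λ) (ρ := ρ) (ε := ε) hH hz
    have j22 := hasJet_J22 (Λ := Λ) (ρ := ρ) (ε := ε) hH hz
    have jG := hasJet_GJ (Λ := Λ) (ρ := ρ) (ε := ε) hH p
    have jp := hasJet_p0iJ (H := H) (ρ := ρ) h0 hz0
    have jn := ((j11.mul j11).add ((HasJet.const 2 p).mul (j12.mul j12))).add (j22.mul j22)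
    have jA := ((HasJet.const 2 p).mul jn).add
      ((HasJet.const (-2 * (Λ / 6) ^ 2) p).mul ((jG.mul jG).mul (jp.mul jp)))
    have jE := (HasJet.const (-2 * (Λ / 6) ^ 2) p).mul
      ((jG.mul (hasJet_coord 1 p)).mul (jp.mul jp))
    have j := ((jA.mul (hκ.hasJet p)).add (jn.mul (hζ.hasJet p))).add (jE.mul (hι.hasJet p))
    refine j.congr ?_
    have : ∀ᶠ q in 𝓝 p, bgFactor Λ (zCoord q) ≠ 0 :=
      (hasJet_p0J (H := H) (ρ := ρ) (ε := ε) p).differentiableAt_self.continuousAt.eventually_ne hz0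
    filter_upwards [this] with q hq
    rw [corr, coeffA_eq hH hq, coeffB_eq hH, coeffE_eq]

theorem hasJet_PJ (p : Fin 4 → ℝ) :
    HasJet (PEps Λ H ρ ε) p (fullAtoms Λ H ρ ε p).PJ := by
  have jG := hasJet_GJ (Λ := Λ) (ρ := ρ) (ε := ε) hH p
  have jn := hasJet_normJ (Λ := Λ) (H := H) (ρ := ρ) (ε := ε) p
  have jw := hasJet_wJ (Λ := Λ) (H := H) hρ hε p
  have j := (HasJet.const 1 p).add ((HasJet.const (Λ / 6) p).mul
    ((jn.add ((HasJet.const (-1) p).mul ((hasJet_coord 0 p).mul (hasJet_coord 1 p)))).add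
      ((HasJet.const (-1) p).mul (jw.mul jG))))
  refine j.congr (Eventually.of_forall fun q => ?_)
  simp only [PEps]
  ring

theorem hasJet_halfApprox (hz : DifferentiableAt ℝ (iteratedFDeriv ℝ 3 H) (zCoord p))
    (hp : p 0 < -ε ∨ bgFactor Λ (zCoord p) ≠ 0) (i j : Fin 4) :
    HasJet (fun q => halfApprox Λ H ρ ε q i j) p ((fullAtoms Λ H ρ ε p).μ i j) := by
  have j11 := hasJet_J11 (Λ := Λ) (ρ := ρ) (ε := ε) hH hz
  have j12 := hasJet_J12 (Λ := Λ) (ρ := ρ) (ε := ε) hH hz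
  have j22 := hasJet_J22 (Λ := Λ) (ρ := ρ) (ε := ε) hH hz
  have jw := hasJet_wJ (Λ := Λ) (H := H) hρ hε p
  have js := hasJet_sJ (Λ := Λ) (H := H) hρ hε p
  have jc := hasJet_cJ hH hρ hε hz hp
  have h11 := (((HasJet.const 1 p).add jc).add ((HasJet.const 2 p).mul (jw.mul j11))).add
    (js.mul ((j11.mul j11).add (j12.mul j12)))
  have h12 := ((HasJet.const 2 p).mul (jw.mul j12)).add (js.mul ((j11.add j22).mul j12))
  have h22 := (((HasJet.const 1 p).add jc).add ((HasJet.const 2 p).mul (jw.mul j22))).add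
    (js.mul ((j12.mul j12).add (j22.mul j22)))
  fin_cases i <;> fin_cases j <;> first
    | exact HasJet.const 0 p
    | exact HasJet.const (-(1 / 2)) p
    | exact h11
    | exact h12
    | exact h22

theorem hasJet_approxMetric (hz : DifferentiableAt ℝ (iteratedFDeriv ℝ 3 H) (zCoord p))
    (hp : p 0 < -ε ∨ bgFactor Λ (zCoord p) ≠ 0) (hP : PEps Λ H ρ ε p ≠ 0) (i j : Fin 4) :
    HasJet (fun q => approxMetric Λ H ρ ε q i j) p
      ((fullAtoms Λ H ρ ε p).PJ.inv (PEps Λ H ρ ε p)⁻¹ *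
        (fullAtoms Λ H ρ ε p).PJ.inv (PEps Λ H ρ ε p)⁻¹ *
        (Jet.const 2 * (fullAtoms Λ H ρ ε p).μ i j)) := by
  have jP := hasJet_PJ (Λ := Λ) hH hρ hε p
  have jQ := jP.inv (y := (PEps Λ H ρ ε p)⁻¹) (by rw [← jP.val, mul_inv_cancel₀ hP])
  have j := (jQ.mul jQ).mul ((HasJet.const 2 p).mul (hasJet_halfApprox hH hρ hε hz hp i j))
  refine j.congr (Eventually.of_forall fun q => ?_)
  simp only [approxMetric_eq hH, Matrix.smul_apply, smul_eq_mul, halfApprox]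
  rw [one_div, pow_two, mul_inv]

theorem corr_eq (hp : p 0 < -ε ∨ bgFactor Λ (zCoord p) ≠ 0) :
    corr Λ H ρ ε p = (realAtoms Λ H ρ ε p).cJ.v := by
  have hκ := isCorrector_kappaEps hρ hε
  have hζ := isCorrector_zetaEps hρ hε
  have hι := isCorrector_iotaEps hρ hε
  by_cases h0 : p 0 < -ε
  · simp [corr, Atoms.cJ, Jet.ofU, realAtoms, hκ.eq_zero _ h0.le, hζ.eq_zero _ h0.le,
      hι.eq_zero _ h0.le]
  · rw [corr, coeffA_eq hH (hp.resolve_left h0), coeffB_eq hH, coeffE_eq]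
    simp [realAtoms, Atoms.cJ, Atoms.AJ, Atoms.EJ, Atoms.nJ, Atoms.p0iJ, Atoms.GJ, Atoms.J11,
      Atoms.J12, Atoms.J22, Jet.coord, Jet.ofU, Jet.ofZ, bgInv, h0]

theorem halfApprox_eq (hp : p 0 < -ε ∨ bgFactor Λ (zCoord p) ≠ 0) (i j : Fin 4) :
    halfApprox Λ H ρ ε p i j = ((realAtoms Λ H ρ ε p).μ i j).v := by
  have hc := corr_eq hH hρ hε hp
  rw [halfApprox, hc]
  fin_cases i <;> fin_cases j <;> rfl

theorem approxMetric_apply (hp : p 0 < -ε ∨ bgFactor Λ (zCoord p) ≠ 0) (i j : Fin 4) :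
    approxMetric Λ H ρ ε p i j = (realAtoms Λ H ρ ε p).gJ i j := by
  rw [approxMetric_eq hH, Atoms.gJ, ← halfApprox_eq hH hρ hε hp]
  simp only [Matrix.smul_apply, smul_eq_mul, halfApprox, realAtoms]
  rw [one_div, inv_pow]

theorem ricci_approxMetric (hz : DifferentiableAt ℝ (iteratedFDeriv ℝ 3 H) (zCoord p))
    (hp : p 0 < -ε ∨ bgFactor Λ (zCoord p) ≠ 0) (hP : PEps Λ H ρ ε p ≠ 0)
    (hD : transDet Λ H ρ ε p ≠ 0) (i j : Fin 4) :
    ricci (approxMetric Λ H ρ ε) p i j = (fullAtoms Λ H ρ ε p).ricJ i j := by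
  have jP := hasJet_PJ (Λ := Λ) hH hρ hε p
  have jμ := hasJet_halfApprox (Λ := Λ) hH hρ hε hz hp
  refine ricci_conformal (hasJet_approxMetric hH hρ hε hz hp hP)
    (by rw [← jP.val, mul_inv_cancel₀ hP]) ?_ jP.symm (fun i j => (jμ i j).symm) ?_ ?_ i j
  · intro i j
    fin_cases i <;> fin_cases j <;> rfl
  · ext i j
    fin_cases i <;> fin_cases j <;> rfl
  · have hv : ∀ i j, ((fullAtoms Λ H ρ ε p).μ i j).v = halfApprox Λ H ρ ε p i j :=
      fun i j => (jμ i j).val.symm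
    have e23 : halfApprox Λ H ρ ε p 3 2 = halfApprox Λ H ρ ε p 2 3 := rfl
    have hD' : halfApprox Λ H ρ ε p 2 2 * halfApprox Λ H ρ ε p 3 3
        - halfApprox Λ H ρ ε p 2 3 ^ 2 ≠ 0 := hD
    have z : ∀ i j : Fin 4, (i = 0 ∧ j ≠ 1 ∨ i = 1 ∧ j ≠ 0 ∨ j = 0 ∧ i ≠ 1 ∨ j = 1 ∧ i ≠ 0) →
        halfApprox Λ H ρ ε p i j = 0 := by
      intro i j hij
      fin_cases i <;> fin_cases j <;> first | rfl | simp at hij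
    have e01 : halfApprox Λ H ρ ε p 0 1 = -(1 / 2) := rfl
    have e10 : halfApprox Λ H ρ ε p 1 0 = -(1 / 2) := rfl
    simp only [hv]
    ext i j
    fin_cases i <;> fin_cases j <;>
      simp [Matrix.mul_apply, Fin.sum_univ_four, Atoms.gi, fullAtoms, Atoms.withSecond, realAtoms,
        e23, transDet, e01, e10, z]
    all_goals field_simp
    all_goals ring

end

section

/-! ### Functions up to errors of order `ε` -/

section Order

variable (X : Type*)

/-- The ring of bounded functions. -/
def bdd : Subring (X → ℝ) where
  carrier := {f | ∃ C, ∀ x, |f x| ≤ C}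
  mul_mem' := by
    rintro f g ⟨C, hC⟩ ⟨D, hD⟩
    refine ⟨C * D, fun x => ?_⟩
    rw [Pi.mul_apply, abs_mul]
    exact mul_le_mul (hC x) (hD x) (abs_nonneg _) ((abs_nonneg _).trans (hC x))
  one_mem' := ⟨1, fun x => by simp⟩
  add_mem' := by
    rintro f g ⟨C, hC⟩ ⟨D, hD⟩
    exact ⟨C + D, fun x => (abs_add_le _ _).trans (add_le_add (hC x) (hD x))⟩
  zero_mem' := ⟨0, fun x => by simp⟩
  neg_mem' := by
    rintro f ⟨C, hC⟩
    exact ⟨C, fun x => by simpa using hC x⟩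

variable {X}

/-- The ideal of functions bounded by a multiple of `e`. -/
def smallIdeal (e : X → ℝ) : Ideal (bdd X) where
  carrier := {f | ∃ C, ∀ x, |f.1 x| ≤ C * e x}
  add_mem' := by
    rintro f g ⟨C, hC⟩ ⟨D, hD⟩
    refine ⟨C + D, fun x => ?_⟩
    rw [add_mul]
    exact (abs_add_le _ _).trans (add_le_add (hC x) (hD x))
  zero_mem' := ⟨0, fun x => by simp⟩
  smul_mem' := by
    rintro ⟨b, B, hB⟩ f ⟨C, hC⟩
    refine ⟨B * C, fun x => ?_⟩
    show |b x * f.1 x| ≤ _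
    rw [abs_mul, mul_assoc]
    exact mul_le_mul (hB x) (hC x) (abs_nonneg _) ((abs_nonneg _).trans (hB x))

/-- Bounded functions modulo small ones. -/
abbrev modSmall (e : X → ℝ) : bdd X →+* bdd X ⧸ smallIdeal e := Ideal.Quotient.mk (smallIdeal e)

/-- Evaluation at a point. -/
def ev (x : X) : bdd X →+* ℝ := (Pi.evalRingHom (fun _ => ℝ) x).comp (bdd X).subtype

theorem modSmall_eq_zero {e : X → ℝ} {f : bdd X} :
    modSmall e f = 0 ↔ ∃ C, ∀ x, |ev x f| ≤ C * e x := Ideal.Quotient.eq_zero_iff_mem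

theorem modSmall_eq {e : X → ℝ} {f g : bdd X} :
    modSmall e f = modSmall e g ↔ ∃ C, ∀ x, |ev x f - ev x g| ≤ C * e x := by
  rw [← sub_eq_zero, ← map_sub, modSmall_eq_zero]
  simp only [map_sub]

theorem bdd_ext {f g : bdd X} (h : ∀ x, ev x f = ev x g) : f = g :=
  Subtype.ext (funext h)

end Order

/-! ### Naturality of the curvature expressions under ring homomorphisms -/

namespace Atoms

section Map

variable {R T : Type*} [CommRing R] [CommRing T] (φ : R →+* T) (a : Atoms R)

theorem map_AJ : (a.map φ).AJ = a.AJ.map φ := by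
  simp only [AJ, nJ, GJ, J11, J12, J22, p0iJ, p0J, normJ, map, Jet.map_add, Jet.map_mul,
    Jet.map_const, Jet.map_inv, Jet.map_coord, Jet.map_ofZ, map_one, _root_.map_mul,
    _root_.map_neg, _root_.map_sub, _root_.map_add, map_pow, map_ofNat]

theorem map_nJ : (a.map φ).nJ = a.nJ.map φ := by
  simp only [nJ, J11, J12, J22, map, Jet.map_add, Jet.map_mul, Jet.map_const, Jet.map_ofZ,
    map_ofNat]

theorem map_EJ : (a.map φ).EJ = a.EJ.map φ := by
  simp only [EJ, GJ, p0iJ, p0J, normJ, map, Jet.map_add, Jet.map_mul,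
    Jet.map_const, Jet.map_inv, Jet.map_coord, Jet.map_ofZ, map_one, _root_.map_mul,
    _root_.map_neg, _root_.map_sub, _root_.map_add, map_pow, map_ofNat]

theorem map_p0J : (a.map φ).p0J = a.p0J.map φ := by
  simp only [p0J, normJ, map, Jet.map_add, Jet.map_mul, Jet.map_const, Jet.map_coord, map_one]

theorem map_cJ : (a.map φ).cJ = a.cJ.map φ := by
  rw [cJ, cJ, map_AJ, map_nJ, map_EJ]
  simp only [map, Jet.map_add, Jet.map_mul, Jet.map_ofU]

theorem map_h11J : (a.map φ).h11J = a.h11J.map φ := by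
  rw [h11J, h11J, map_cJ]
  simp only [wJ, sJ, J11, J12, map, Jet.map_add, Jet.map_mul, Jet.map_const, Jet.map_ofU,
    Jet.map_ofZ, map_one, _root_.map_mul, map_ofNat]

theorem map_h12J : (a.map φ).h12J = a.h12J.map φ := by
  rw [h12J, h12J]
  simp only [wJ, sJ, J11, J12, J22, map, Jet.map_add, Jet.map_mul, Jet.map_const, Jet.map_ofU,
    Jet.map_ofZ, _root_.map_mul, map_ofNat]

theorem map_h22J : (a.map φ).h22J = a.h22J.map φ := by
  rw [h22J, h22J, map_cJ]
  simp only [wJ, sJ, J22, J12, map, Jet.map_add, Jet.map_mul, Jet.map_const, Jet.map_ofU,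
    Jet.map_ofZ, map_one, _root_.map_mul, map_ofNat]

theorem map_PJ : (a.map φ).PJ = a.PJ.map φ := by
  simp only [PJ, wJ, GJ, normJ, map, Jet.map_add, Jet.map_mul, Jet.map_const, Jet.map_coord,
    Jet.map_ofU, Jet.map_ofZ, map_one, _root_.map_mul, _root_.map_neg, _root_.map_sub,
    _root_.map_add, map_ofNat]

theorem map_μ (i j : Fin 4) : (a.map φ).μ i j = (a.μ i j).map φ := by
  have h0 : (a.map φ).half = φ a.half := rfl
  fin_cases i <;> fin_cases j <;>
    simp [μ, map_h11J, map_h12J, map_h22J, Jet.map_const, h0]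

theorem map_gi (i j : Fin 4) : (a.map φ).gi i j = φ (a.gi i j) := by
  fin_cases i <;> fin_cases j <;> simp [gi, map]

theorem map_chr (i j k : Fin 4) : chr (a.map φ).e i j k = φ (chr a.e i j k) := by
  simp [chr, e, map_μ]

/-- All reciprocals, even that of 2, are atoms, so the expression contains no division. This allows
one formula to be used pointwise, for bounded functions, and modulo O(ε). -/
theorem map_ricJ (i j : Fin 4) : (a.map φ).ricJ i j = φ (a.ricJ i j) := by
  have hQ : (a.map φ).Q = φ a.Q := rfl
  have hee : ∀ k l i j, (a.map φ).ee k l i j = φ (a.ee k l i j) := fun k l i j => by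
    simp [ee, map_μ]
  simp only [ricJ, ric, riem, hess, gradSq, map_chr, hee, map_gi, map_PJ, map_μ, hQ, Jet.map_v,
    Jet.map_d, Jet.map_dd, map_sum, _root_.map_add, _root_.map_sub, _root_.map_mul, map_pow,
    map_ofNat]

theorem map_gJ (i j : Fin 4) : (a.map φ).gJ i j = φ (a.gJ i j) := by
  have hQ : (a.map φ).Q = φ a.Q := rfl
  simp only [gJ, map_μ, hQ, Jet.map_v, _root_.map_mul, map_pow, map_ofNat]

theorem map_restUU (r1 z rU rc rs : R) :
    (a.map φ).restUU (φ r1) (φ z) (φ rU) (φ rc) (φ rs) = φ (a.restUU r1 z rU rc rs) := by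
  simp only [restUU, map_chr, map_gi, map_AJ, map_nJ, map_EJ, map_sum, _root_.map_add,
    _root_.map_sub, _root_.map_mul, map_pow, map_ofNat, Jet.map_v]
  rfl

end Map

end Atoms

end

section

/-! ### Bounds on compact sets -/

/-- Pairs of a parameter `ε` and a point of `K`. -/
def Param (K : Set (Fin 4 → ℝ)) (δ : ℝ) : Type :=
  {x : ℝ × (Fin 4 → ℝ) // 0 < x.1 ∧ x.1 ≤ δ ∧ x.2 ∈ K}

namespace Param

variable {K : Set (Fin 4 → ℝ)} {δ : ℝ}

def eps (x : Param K δ) : ℝ := x.1.1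
def pt (x : Param K δ) : Fin 4 → ℝ := x.1.2

theorem eps_pos (x : Param K δ) : 0 < x.eps := x.2.1
theorem eps_le (x : Param K δ) : x.eps ≤ δ := x.2.2.1
theorem pt_mem (x : Param K δ) : x.pt ∈ K := x.2.2.2

end Param

/-- The background factor is bounded away from zero at the points of `K` with `-δ ≤ U`. -/
structure IsRange (Λ : ℝ) (K : Set (Fin 4 → ℝ)) (δ : ℝ) : Prop where
  pos : 0 < δ
  le_one : δ ≤ 1
  ne_zero : ∀ p ∈ K, -δ ≤ p 0 → bgFactor Λ (zCoord p) ≠ 0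
  inv_le : ∃ C, ∀ p ∈ K, -δ ≤ p 0 → |(bgFactor Λ (zCoord p))⁻¹| ≤ C

theorem IsRange.mono {Λ : ℝ} {K : Set (Fin 4 → ℝ)} {δ δ' : ℝ} (h : IsRange Λ K δ) (h0 : 0 < δ')
    (hle : δ' ≤ δ) : IsRange Λ K δ' where
  pos := h0
  le_one := hle.trans h.le_one
  ne_zero p hp hU := h.ne_zero p hp (by linarith)
  inv_le := h.inv_le.imp fun C hC p hp hU => hC p hp (by linarith)

namespace Atoms

attribute [ext] Atoms

variable {R T : Type*} [CommRing R] [CommRing T]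

/-- Replace the reciprocals of the denominator and of the transverse metric. -/
def withInv (a : Atoms R) (Q k11 k12 k22 : R) : Atoms R :=
  { a with Q := Q, k11 := k11, k12 := k12, k22 := k22 }

/-- Replace `w` and `s` and drop the corrections. -/
def limit (a : Atoms R) (w s : R) : Atoms R :=
  { a with w := w, s := s, κ := 0, κ1 := 0, ζ := 0, ζ1 := 0, ι := 0, ι1 := 0 }

theorem map_limit (φ : R →+* T) (a : Atoms R) (w s : R) :
    (a.limit w s).map φ = (a.map φ).limit (φ w) (φ s) := by
  ext <;> simp [map, limit]

end Atoms

theorem continuous_zCoord : Continuous zCoord := by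
  have h : zCoord = zL := funext fun p => (zL_apply p).symm
  rw [h]
  exact zL.continuous

theorem continuous_bgFactor (Λ : ℝ) : Continuous (bgFactor Λ) := by
  unfold bgFactor
  exact continuous_const.add (continuous_const.mul Complex.continuous_normSq)

section Bounds

variable {Λ : ℝ} {H : ℂ → ℝ} {ρ : ℝ → ℝ} {K : Set (Fin 4 → ℝ)} {δ : ℝ}

theorem mem_bdd_of_continuous (hK : IsCompact K) {f : (Fin 4 → ℝ) → ℝ} (hf : Continuous f) :
    (fun x : Param K δ => f x.pt) ∈ bdd (Param K δ) := by
  obtain ⟨C, hC⟩ := hK.exists_bound_of_continuousOn hf.continuousOn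
  exact ⟨C, fun x => hC _ x.pt_mem⟩

theorem mem_bdd_const (c : ℝ) : (fun _ : Param K δ => c) ∈ bdd (Param K δ) :=
  ⟨|c|, fun _ => le_rfl⟩

theorem exists_abs_le (hK : IsCompact K) :
    ∃ C, 0 ≤ C ∧ ∀ p ∈ K, |p 0| ≤ C := by
  obtain ⟨C, hC⟩ := hK.exists_bound_of_continuousOn (continuous_apply 0).continuousOn
  exact ⟨max C 0, le_max_right _ _, fun p hp => (hC p hp).trans (le_max_left _ _)⟩

theorem IsCorrector.bound (hδ : IsRange Λ K δ) (hK : IsCompact K) {a f : ℝ → ℝ → ℝ}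
    (h : ∀ ε, 0 < ε → IsCorrector ε (a ε) (f ε)) :
    ∃ C, ∀ x : Param K δ, |a x.eps (x.pt 0)| ≤ C * x.eps := by
  obtain ⟨C, hC0, hC⟩ := exists_abs_le hK
  refine ⟨2 * (C + 1), fun x => ((h _ x.eps_pos).abs_le _).trans ?_⟩
  have h1 := hC _ x.pt_mem
  have h2 := x.eps_le.trans hδ.le_one
  have h3 := x.eps_pos
  nlinarith

theorem IsCorrector.bound_deriv {a f : ℝ → ℝ → ℝ}
    (h : ∀ ε, 0 < ε → IsCorrector ε (a ε) (f ε)) :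
    ∃ C, ∀ x : Param K δ, |deriv (a x.eps) (x.pt 0)| ≤ C * x.eps :=
  ⟨2, fun x => (h _ x.eps_pos).abs_deriv_le _⟩

theorem mem_bdd_of_small (hδ : IsRange Λ K δ) {f : Param K δ → ℝ}
    (h : ∃ C, ∀ x, |f x| ≤ C * x.eps) : f ∈ bdd (Param K δ) := by
  obtain ⟨C, hC⟩ := h
  refine ⟨|C|, fun x => (hC x).trans ?_⟩
  have h2 := x.eps_le.trans hδ.le_one
  have h3 := x.eps_pos
  nlinarith [le_abs_self C, abs_nonneg C]

theorem mem_bdd_of_near (hδ : IsRange Λ K δ) {f g : Param K δ → ℝ}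
    (hg : g ∈ bdd (Param K δ)) (h : ∃ C, ∀ x, |f x - g x| ≤ C * x.eps) : f ∈ bdd (Param K δ) := by
  have := (bdd (Param K δ)).add_mem (mem_bdd_of_small hδ h) hg
  convert this using 1
  ext x
  simp

theorem continuous_uPlus : Continuous uPlus := by
  unfold uPlus
  fun_prop

variable (hH : IsC31Loc H) (hρ : IsMollifier ρ) (hK : IsCompact K) (hδ : IsRange Λ K δ)

include hρ hK hδ

theorem mem_bdd_w : (fun x : Param K δ => mollify ρ x.eps uPlus (x.pt 0)) ∈ bdd (Param K δ) :=
  mem_bdd_of_near hδ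
    (mem_bdd_of_continuous hK (continuous_uPlus.comp (continuous_apply 0)))
    ⟨1, fun x => by simpa using abs_mollify_uPlus_sub hρ x.eps_pos (x.pt 0)⟩

theorem mem_bdd_s : (fun x : Param K δ => mollify ρ x.eps (fun u => uPlus u ^ 2) (x.pt 0)) ∈
    bdd (Param K δ) :=
  mem_bdd_of_near hδ ((bdd (Param K δ)).pow_mem (mem_bdd_w hρ hK hδ) 2)
    ⟨2, fun x => abs_mollify_uPlus_sq_sub hρ x.eps_pos (x.eps_le.trans hδ.le_one) (x.pt 0)⟩

include hH

/-- The reciprocals are left as parameters because their boundedness rests on uniform nondegeneracy,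
which is itself deduced from this lemma. The reciprocal of p₀ is bounded thanks to its cut-off at U
< -ε. -/
theorem exists_atoms (Q k11 k12 k22 : bdd (Param K δ)) :
    ∃ a : Atoms (bdd (Param K δ)), ∀ x, a.map (ev x) =
      (realAtoms Λ H ρ x.eps x.pt).withInv (ev x Q) (ev x k11) (ev x k12) (ev x k22) := by
  have hκ := fun ε (h : 0 < ε) => isCorrector_kappaEps hρ h
  have hζ := fun ε (h : 0 < ε) => isCorrector_zetaEps hρ h
  have hι := fun ε (h : 0 < ε) => isCorrector_iotaEps hρ h
  have hc : ∀ k : Fin 4, (fun x : Param K δ => x.pt k) ∈ bdd (Param K δ) :=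
    fun k => mem_bdd_of_continuous hK (continuous_apply k)
  have hz : ∀ f : ℂ → ℝ, Continuous f → (fun x : Param K δ => f (zCoord x.pt)) ∈
      bdd (Param K δ) := fun f hf => mem_bdd_of_continuous hK (hf.comp continuous_zCoord)
  have hd : ∀ (f : ℂ → ℝ) (v : ℂ), IsThird H f → (fun x : Param K δ => dv v f (zCoord x.pt)) ∈
      bdd (Param K δ) := fun f v hf => by
    obtain ⟨C, hC⟩ := hf.exists_bound hH (hK.image continuous_zCoord) v
    exact ⟨C, fun x => hC _ ⟨_, x.pt_mem, rfl⟩⟩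
  have hp : (fun x : Param K δ => bgInv Λ x.eps x.pt) ∈ bdd (Param K δ) := by
    obtain ⟨C, hC⟩ := hδ.inv_le
    refine ⟨max C 0, fun x => ?_⟩
    simp only [bgInv]
    split_ifs with h0
    · rw [abs_zero]
      exact le_max_right _ _
    · exact (hC _ x.pt_mem (by linarith [x.eps_le])).trans (le_max_left _ _)
  have hθ : (fun x : Param K δ => mollify ρ x.eps heaviside (x.pt 0)) ∈ bdd (Param K δ) :=
    ⟨1, fun x => abs_le.mpr ⟨by linarith [mollify_heaviside_nonneg hρ x.eps_pos (x.pt 0)],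
      mollify_heaviside_le_one hρ x.eps_pos (x.pt 0)⟩⟩
  exact ⟨{
    half := ⟨_, mem_bdd_const (1 / 2)⟩
    L := ⟨_, mem_bdd_const (Λ / 6)⟩
    U := ⟨_, hc 0⟩
    V := ⟨_, hc 1⟩
    x1 := ⟨_, hc 2⟩
    x2 := ⟨_, hc 3⟩
    w := ⟨_, mem_bdd_w hρ hK hδ⟩
    θ := ⟨_, hθ⟩
    r := ⟨_, mem_bdd_const 0⟩
    s := ⟨_, mem_bdd_s hρ hK hδ⟩
    κ := ⟨_, mem_bdd_of_small hδ (IsCorrector.bound hδ hK hκ)⟩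
    κ1 := ⟨_, mem_bdd_of_small hδ (IsCorrector.bound_deriv hκ)⟩
    κ2 := ⟨_, mem_bdd_const 0⟩
    ζ := ⟨_, mem_bdd_of_small hδ (IsCorrector.bound hδ hK hζ)⟩
    ζ1 := ⟨_, mem_bdd_of_small hδ (IsCorrector.bound_deriv hζ)⟩
    ζ2 := ⟨_, mem_bdd_const 0⟩
    ι := ⟨_, mem_bdd_of_small hδ (IsCorrector.bound hδ hK hι)⟩
    ι1 := ⟨_, mem_bdd_of_small hδ (IsCorrector.bound_deriv hι)⟩
    ι2 := ⟨_, mem_bdd_const 0⟩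
    G := ⟨_, hz _ (contDiff_G hH).continuous⟩
    M11 := ⟨_, hz _ (contDiff_M11 hH).continuous⟩
    M12 := ⟨_, hz _ (contDiff_M12 hH).continuous⟩
    M22 := ⟨_, hz _ (contDiff_M22 hH).continuous⟩
    t0 := ⟨_, hz _ ((isThird_dv_M11 hH 1).continuous hH)⟩
    t1 := ⟨_, hz _ ((isThird_dv_M12 hH 1).continuous hH)⟩
    t2 := ⟨_, hz _ ((isThird_dv_M22 hH 1).continuous hH)⟩
    t3 := ⟨_, hz _ ((isThird_dv_M22 hH Complex.I).continuous hH)⟩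
    q0 := ⟨_, hd _ 1 (isThird_dv_M11 hH 1)⟩
    q1 := ⟨_, hd _ 1 (isThird_dv_M12 hH 1)⟩
    q2 := ⟨_, hd _ 1 (isThird_dv_M22 hH 1)⟩
    q3 := ⟨_, hd _ 1 (isThird_dv_M22 hH Complex.I)⟩
    q4 := ⟨_, hd _ Complex.I (isThird_dv_M22 hH Complex.I)⟩
    p0i := ⟨_, hp⟩
    Q := Q
    k11 := k11
    k12 := k12
    k22 := k22 }, fun x => rfl⟩

end Bounds

end

section

namespace Atoms

variable {R T : Type*} [CommRing R] [CommRing T] (φ : R →+* T) (a : Atoms R)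

theorem withInv_PJ (Q k11 k12 k22 : R) : (a.withInv Q k11 k12 k22).PJ = a.PJ := rfl

theorem withInv_μ (Q k11 k12 k22 : R) : (a.withInv Q k11 k12 k22).μ = a.μ := rfl

theorem map_PJ_v : φ a.PJ.v = (a.map φ).PJ.v := by rw [map_PJ, Jet.map_v]

theorem map_μ_v (i j : Fin 4) : φ (a.μ i j).v = ((a.map φ).μ i j).v := by rw [map_μ, Jet.map_v]

end Atoms

/-! ### Nondegeneracy -/

section

variable {Λ : ℝ} {H : ℂ → ℝ} {ρ : ℝ → ℝ} {K : Set (Fin 4 → ℝ)} {δ : ℝ}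

/-- The zeros of p₀ on K form a compact set lying in U < 0, so they stay at a positive distance from
the wave front. -/
theorem exists_isRange (hK : IsCompact K) (hKM : K ⊆ lorentzDomain Λ H)
    (hK0 : ∀ p ∈ K, 0 < p 0 → bgFactor Λ (zCoord p) ≠ 0) : ∃ δ, IsRange Λ K δ := by
  have hbg : Continuous fun p : Fin 4 → ℝ => bgFactor Λ (zCoord p) :=
    (continuous_bgFactor Λ).comp continuous_zCoord
  have h0 : Continuous fun p : Fin 4 → ℝ => p 0 := continuous_apply 0
  have hK1 : IsCompact (K ∩ {p | bgFactor Λ (zCoord p) = 0}) :=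
    hK.inter_right (isClosed_eq hbg continuous_const)
  have hneg : ∀ p ∈ K ∩ {p | bgFactor Λ (zCoord p) = 0}, p 0 < 0 := by
    rintro p ⟨hp, hz⟩
    by_contra! hU
    rcases hU.eq_or_lt with hU | hU
    -- On U = 0 the denominator P equals p₀, so a zero of p₀ there is excluded by the domain.
    · refine (hKM hp).1 ?_
      rw [P, ← hU, uPlus, max_self]
      rw [Set.mem_ofPred_eq, bgFactor] at hz
      linarith
    · exact hK0 p hp hU hz
  obtain ⟨δ, hδ0, hδ1, hδ⟩ : ∃ δ > 0, δ ≤ 1 ∧ ∀ p ∈ K, -δ ≤ p 0 → bgFactor Λ (zCoord p) ≠ 0 := by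
    rcases (K ∩ {p | bgFactor Λ (zCoord p) = 0}).eq_empty_or_nonempty with he | hne
    · exact ⟨1, one_pos, le_rfl, fun p hp _ hz => (he ▸ (⟨hp, hz⟩ : p ∈ K ∩ {p | bgFactor Λ (zCoord p) = 0}) :
        p ∈ (∅ : Set _))⟩
    · obtain ⟨m, hm, hmax⟩ := hK1.exists_isMaxOn hne h0.continuousOn
      have hm0 := hneg m hm
      -- m 0 < 0 is the largest U at a zero of p₀; half its distance to 0 leaves a strict gap.
      refine ⟨min 1 (-m 0 / 2), lt_min one_pos (by linarith), min_le_left _ _,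
        fun p hp hU hz => ?_⟩
      have h1 : p 0 ≤ m 0 := hmax ⟨hp, hz⟩
      have h2 := min_le_right 1 (-m 0 / 2)
      linarith
  refine ⟨δ, hδ0, hδ1, hδ, ?_⟩
  have hK2 : IsCompact (K ∩ {p | -δ ≤ p 0}) := hK.inter_right (isClosed_le continuous_const h0)
  obtain ⟨C, hC⟩ := hK2.exists_bound_of_continuousOn
    (hbg.continuousOn.inv₀ fun p hp => hδ p hp.1 hp.2)
  exact ⟨C, fun p hp hU => hC p ⟨hp, hU⟩⟩

theorem exists_le_of_near (hK : IsCompact K) {f : (Fin 4 → ℝ) → ℝ} (hf : ContinuousOn f K)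
    (hpos : ∀ p ∈ K, 0 < f p) {g : ℝ → (Fin 4 → ℝ) → ℝ} {δ : ℝ}
    (h : ∃ C, ∀ x : Param K δ, |g x.eps x.pt - f x.pt| ≤ C * x.eps) (hδ : 0 < δ) :
    ∃ δ' > 0, δ' ≤ δ ∧ ∃ c > 0, ∀ x : Param K δ', c ≤ g x.eps x.pt := by
  obtain ⟨C, hC⟩ := h
  rcases K.eq_empty_or_nonempty with rfl | hne
  · exact ⟨δ, hδ, le_rfl, 1, one_pos, fun x => absurd x.pt_mem (Set.notMem_empty _)⟩
  obtain ⟨m, hm, hmin⟩ := hK.exists_isMinOn hne hf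
  have hm0 := hpos m hm
  -- With this δ' the error C ε is at most half the minimum of f on K.
  refine ⟨min δ (f m / (2 * (|C| + 1))), lt_min hδ (by positivity), min_le_left _ _, f m / 2,
    by positivity, fun x => ?_⟩
  have h1 := hC ⟨x.1, x.eps_pos, x.eps_le.trans (min_le_left _ _), x.pt_mem⟩
  change |g x.eps x.pt - f x.pt| ≤ C * x.eps at h1
  have h2 : f m ≤ f x.pt := hmin x.pt_mem
  have h3 := x.eps_le.trans (min_le_right _ _)
  rw [le_div_iff₀ (by positivity)] at h3
  have h4 : C * x.eps ≤ f m / 2 := by nlinarith [le_abs_self C, x.eps_pos]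
  linarith [(abs_le.mp h1).1]

theorem IsLorentzian.det_ne_zero {M : Matrix (Fin 4) (Fin 4) ℝ} (h : IsLorentzian M) :
    M.det ≠ 0 := by
  obtain ⟨S, -, hS⟩ := h
  intro h0
  have := congrArg Matrix.det hS
  rw [Matrix.det_mul, Matrix.det_mul, h0, Matrix.det_diagonal] at this
  simp [Fin.prod_univ_four] at this

theorem det_halfMetric (w s c : ℝ) (z : ℂ) : (halfMetric H w s c z).det =
    -(1 / 4) * (halfMetric H w s c z 2 2 * halfMetric H w s c z 3 3
      - halfMetric H w s c z 2 3 ^ 2) := by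
  simp [halfMetric, Matrix.det_succ_row_zero, Fin.sum_univ_succ, Fin.succAbove]
  ring

/-- Half the wave metric before the conformal change. -/
def halfWave (H : ℂ → ℝ) (p : Fin 4 → ℝ) : Matrix (Fin 4) (Fin 4) ℝ :=
  halfMetric H (uPlus (p 0)) (uPlus (p 0) ^ 2) 0 (zCoord p)

/-- The transverse determinant is (det S)² and the first entry is a sum of squares, hence both are
nonnegative; the Lorentzian signature gives a nonzero determinant, hence positivity. -/
theorem halfWave_pos (hH : IsC31Loc H) {p : Fin 4 → ℝ} (hp : p ∈ lorentzDomain Λ H) :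
    0 < halfWave H p 2 2 ∧ 0 < halfWave H p 2 2 * halfWave H p 3 3 - halfWave H p 2 3 ^ 2 := by
  have h := hp.2.det_ne_zero
  rw [waveMetric_eq hH, Matrix.det_smul, Matrix.det_smul, det_halfMetric] at h
  have h1 : halfWave H p 2 2 * halfWave H p 3 3 - halfWave H p 2 3 ^ 2 ≠ 0 := by
    intro h0
    apply h
    change _ * (_ * (_ * (halfWave H p 2 2 * halfWave H p 3 3 - halfWave H p 2 3 ^ 2))) = 0
    rw [h0]
    ring
  have e1 : halfWave H p 2 2 = (1 + uPlus (p 0) * M11 H (zCoord p)) ^ 2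
      + (uPlus (p 0) * M12 H (zCoord p)) ^ 2 := by
    simp [halfWave, halfMetric]
    ring
  have e2 : halfWave H p 2 2 * halfWave H p 3 3 - halfWave H p 2 3 ^ 2 =
      ((1 + uPlus (p 0) * M11 H (zCoord p)) * (1 + uPlus (p 0) * M22 H (zCoord p))
        - (uPlus (p 0) * M12 H (zCoord p)) ^ 2) ^ 2 := by
    simp [halfWave, halfMetric]
    ring
  have h2 : 0 < halfWave H p 2 2 * halfWave H p 3 3 - halfWave H p 2 3 ^ 2 := by
    refine lt_of_le_of_ne ?_ h1.symm
    rw [e2]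
    positivity
  refine ⟨lt_of_le_of_ne (by rw [e1]; positivity) fun h0 => ?_, h2⟩
  rw [← h0] at h2
  nlinarith [sq_nonneg (halfWave H p 2 3)]

variable (hH : IsC31Loc H) (hρ : IsMollifier ρ) (hK : IsCompact K) (hδ : IsRange Λ K δ)

theorem IsRange.lt_or_ne (hδ : IsRange Λ K δ) (x : Param K δ) :
    x.pt 0 < -x.eps ∨ bgFactor Λ (zCoord x.pt) ≠ 0 := by
  rcases lt_or_ge (x.pt 0) (-x.eps) with h | h
  · exact Or.inl h
  · exact Or.inr (hδ.ne_zero _ x.pt_mem (by linarith [x.eps_le]))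

theorem realAtoms_PJ_v (ε : ℝ) (p : Fin 4 → ℝ) : (realAtoms Λ H ρ ε p).PJ.v = PEps Λ H ρ ε p := by
  rw [Atoms.PJ_v, PEps]
  simp only [realAtoms, zCoord, Complex.normSq_mk, pow_two]

theorem limit_PJ_v (ε : ℝ) (p : Fin 4 → ℝ) (Q k11 k12 k22 : ℝ) :
    (((realAtoms Λ H ρ ε p).withInv Q k11 k12 k22).limit (uPlus (p 0)) (uPlus (p 0) ^ 2)).PJ.v =
      P Λ H p := by
  rw [Atoms.PJ_v, P]
  simp only [realAtoms, Atoms.withInv, Atoms.limit, zCoord, Complex.normSq_mk, pow_two]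

theorem limit_μ_v (ε : ℝ) (p : Fin 4 → ℝ) (Q k11 k12 k22 : ℝ) (i j : Fin 4) :
    ((((realAtoms Λ H ρ ε p).withInv Q k11 k12 k22).limit (uPlus (p 0))
      (uPlus (p 0) ^ 2)).μ i j).v = halfWave H p i j := by
  have hc : (((realAtoms Λ H ρ ε p).withInv Q k11 k12 k22).limit (uPlus (p 0))
      (uPlus (p 0) ^ 2)).cJ.v = 0 := by
    simp [Atoms.cJ, Atoms.limit, Jet.ofU]
  rw [halfWave, ← hc]
  fin_cases i <;> fin_cases j <;> rfl

include hρ hK hδ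

/-- Modulo O(ε) the mollified functions become U⁺ and (U⁺)² and the corrections disappear. The atom
θ stays, since values of the metric do not involve it. -/
theorem map_modSmall_eq_limit {Q k11 k12 k22 : bdd (Param K δ)} {a : Atoms (bdd (Param K δ))}
    (ha : ∀ x, a.map (ev x) =
      (realAtoms Λ H ρ x.eps x.pt).withInv (ev x Q) (ev x k11) (ev x k12) (ev x k22))
    {w : bdd (Param K δ)} (hw : ∀ x, ev x w = uPlus (x.pt 0)) :
    a.map (modSmall Param.eps) = (a.limit w (w ^ 2)).map (modSmall Param.eps) := by
  have hκ := fun ε (h : 0 < ε) => isCorrector_kappaEps hρ h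
  have hζ := fun ε (h : 0 < ε) => isCorrector_zetaEps hρ h
  have hι := fun ε (h : 0 < ε) => isCorrector_iotaEps hρ h
  have w1 : modSmall Param.eps a.w = modSmall Param.eps w := by
    refine modSmall_eq.mpr ⟨1, fun x => ?_⟩
    rw [hw, show ev x a.w = _ from congrArg Atoms.w (ha x), one_mul]
    exact abs_mollify_uPlus_sub hρ x.eps_pos (x.pt 0)
  have s1 : modSmall Param.eps a.s = modSmall Param.eps (a.w ^ 2) := by
    refine modSmall_eq.mpr ⟨2, fun x => ?_⟩
    rw [map_pow, show ev x a.w = _ from congrArg Atoms.w (ha x),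
      show ev x a.s = _ from congrArg Atoms.s (ha x)]
    exact abs_mollify_uPlus_sq_sub hρ x.eps_pos (x.eps_le.trans hδ.le_one) (x.pt 0)
  have z : ∀ {f : bdd (Param K δ)} {F : Param K δ → ℝ}, (∀ x, ev x f = F x) →
      (∃ C, ∀ x, |F x| ≤ C * x.eps) → modSmall Param.eps f = 0 := by
    intro f F hf hF
    rw [modSmall_eq_zero]
    simpa only [hf] using hF
  ext <;> simp only [Atoms.map, Atoms.limit, map_zero]
  · exact w1
  · rw [s1, map_pow, map_pow, w1]
  · exact z (fun x => congrArg Atoms.κ (ha x)) (IsCorrector.bound hδ hK hκ)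
  · exact z (fun x => congrArg Atoms.κ1 (ha x)) (IsCorrector.bound_deriv hκ)
  · exact z (fun x => congrArg Atoms.ζ (ha x)) (IsCorrector.bound hδ hK hζ)
  · exact z (fun x => congrArg Atoms.ζ1 (ha x)) (IsCorrector.bound_deriv hζ)
  · exact z (fun x => congrArg Atoms.ι (ha x)) (IsCorrector.bound hδ hK hι)
  · exact z (fun x => congrArg Atoms.ι1 (ha x)) (IsCorrector.bound_deriv hι)

include hH

/-- The denominator and the metric before the conformal change converge at rate `ε`. -/
theorem exists_modSmall_eq : ∃ (Pa Pb : bdd (Param K δ)) (m n : Fin 4 → Fin 4 → bdd (Param K δ)),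
    (∀ x, ev x Pa = PEps Λ H ρ x.eps x.pt) ∧ (∀ x, ev x Pb = P Λ H x.pt) ∧
    (∀ x i j, ev x (m i j) = halfApprox Λ H ρ x.eps x.pt i j) ∧
    (∀ x i j, ev x (n i j) = halfWave H x.pt i j) ∧
    modSmall Param.eps Pa = modSmall Param.eps Pb ∧
    ∀ i j, modSmall Param.eps (m i j) = modSmall Param.eps (n i j) := by
  -- The denominator and the unscaled metric do not involve the reciprocals, so zero placeholders
  -- do.
  obtain ⟨a, ha⟩ := exists_atoms hH hρ hK hδ 0 0 0 0
  set w : bdd (Param K δ) := ⟨fun x => uPlus (x.pt 0),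
    mem_bdd_of_continuous hK (continuous_uPlus.comp (continuous_apply 0))⟩
  have hw : ∀ x, ev x w = uPlus (x.pt 0) := fun x => rfl
  have hq := map_modSmall_eq_limit hρ hK hδ ha hw
  have hb : ∀ x, (a.limit w (w ^ 2)).map (ev x) = _ := fun x => by
    rw [Atoms.map_limit, ha, map_pow, hw]
  refine ⟨a.PJ.v, (a.limit w (w ^ 2)).PJ.v, fun i j => (a.μ i j).v,
    fun i j => ((a.limit w (w ^ 2)).μ i j).v, fun x => ?_, fun x => ?_, fun x i j => ?_,
    fun x i j => ?_, ?_, fun i j => ?_⟩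
  · rw [Atoms.map_PJ_v, ha, Atoms.withInv_PJ, realAtoms_PJ_v]
  · rw [Atoms.map_PJ_v, hb, limit_PJ_v]
  · rw [Atoms.map_μ_v, ha, Atoms.withInv_μ, halfApprox_eq hH hρ x.eps_pos (hδ.lt_or_ne x)]
  · rw [Atoms.map_μ_v, hb, limit_μ_v]
  · rw [Atoms.map_PJ_v, hq, Atoms.map_PJ_v]
  · rw [Atoms.map_μ_v, hq, Atoms.map_μ_v]

omit hρ hK hδ in
theorem continuous_P : Continuous (P Λ H) := by
  have h1 := (contDiff_G hH).continuous.comp continuous_zCoord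
  have h2 := Complex.continuous_normSq.comp continuous_zCoord
  have h3 := continuous_uPlus.comp (continuous_apply (A := fun _ : Fin 4 => ℝ) 0)
  simp only [Function.comp_def] at h1 h2 h3
  unfold P
  fun_prop

omit hρ hK hδ in
theorem continuous_halfWave (i j : Fin 4) : Continuous fun p => halfWave H p i j := by
  have h1 := (contDiff_M11 hH).continuous.comp continuous_zCoord
  have h2 := (contDiff_M12 hH).continuous.comp continuous_zCoord
  have h4 := (contDiff_M22 hH).continuous.comp continuous_zCoord
  have h3 := continuous_uPlus.comp (continuous_apply (A := fun _ : Fin 4 => ℝ) 0)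
  simp only [Function.comp_def] at h1 h2 h3 h4
  fin_cases i <;> fin_cases j <;> simp only [halfWave, halfMetric] <;> simp <;> fun_prop

/-- The regularised metrics are uniformly nondegenerate on `K`. -/
theorem exists_nondegenerate (hKM : K ⊆ lorentzDomain Λ H) :
    ∃ δ' > 0, δ' ≤ δ ∧ ∃ c > 0, ∀ x : Param K δ', c ≤ |PEps Λ H ρ x.eps x.pt| ∧
      c ≤ transDet Λ H ρ x.eps x.pt ∧ c ≤ halfApprox Λ H ρ x.eps x.pt 2 2 := by
  obtain ⟨Pa, Pb, m, n, hPa, hPb, hm, hn, hP, hmn⟩ := exists_modSmall_eq hH hρ hK hδ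
  have near : ∀ {f g : bdd (Param K δ)}, modSmall Param.eps f = modSmall Param.eps g →
      ∃ C, ∀ x : Param K δ, |ev x f - ev x g| ≤ C * x.eps := fun h => modSmall_eq.mp h
  have hD : modSmall Param.eps (m 2 2 * m 3 3 - m 2 3 ^ 2) =
      modSmall Param.eps (n 2 2 * n 3 3 - n 2 3 ^ 2) := by
    simp only [map_sub, map_mul, map_pow, hmn]
  have n1 := near hP
  have n2 := near hD
  have n3 := near (hmn 2 2)
  simp only [map_sub, map_mul, map_pow, hPa, hPb, hm, hn] at n1 n2 n3
  have hc := fun i j => continuous_halfWave hH i j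
  obtain ⟨d1, hd1, hle1, c1, hc1, h1⟩ := exists_le_of_near hK
    (continuous_P (Λ := Λ) hH).abs.continuousOn
    (fun p hp => abs_pos.mpr (hKM hp).1) (g := fun ε p => |PEps Λ H ρ ε p|)
    (n1.imp fun C hC x => (abs_abs_sub_abs_le _ _).trans (hC x)) hδ.pos
  obtain ⟨d2, hd2, hle2, c2, hc2, h2⟩ := exists_le_of_near hK
    (((hc 2 2).mul (hc 3 3)).sub ((hc 2 3).pow 2)).continuousOn
    (fun p hp => (halfWave_pos hH (hKM hp)).2) (g := transDet Λ H ρ) n2 hδ.pos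
  obtain ⟨d3, hd3, hle3, c3, hc3, h3⟩ := exists_le_of_near hK (hc 2 2).continuousOn
    (fun p hp => (halfWave_pos hH (hKM hp)).1) (g := fun ε p => halfApprox Λ H ρ ε p 2 2)
    n3 hδ.pos
  refine ⟨min d1 (min d2 d3), lt_min hd1 (lt_min hd2 hd3), (min_le_left _ _).trans hle1,
    min c1 (min c2 c3), lt_min hc1 (lt_min hc2 hc3), fun x => ?_⟩
  have hx := x.eps_le
  rw [le_min_iff, le_min_iff] at hx
  exact ⟨(min_le_left _ _).trans (h1 ⟨x.1, x.eps_pos, hx.1, x.pt_mem⟩),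
    (min_le_right _ _).trans ((min_le_left _ _).trans (h2 ⟨x.1, x.eps_pos, hx.2.1, x.pt_mem⟩)),
    (min_le_right _ _).trans ((min_le_right _ _).trans (h3 ⟨x.1, x.eps_pos, hx.2.2, x.pt_mem⟩))⟩

end

end

section

/-! ### Estimates of order `ε` -/

section

variable {Λ : ℝ} {H : ℂ → ℝ} {ρ : ℝ → ℝ} {K : Set (Fin 4 → ℝ)} {δ c : ℝ}

/-- The regularised metrics are uniformly nondegenerate. -/
structure IsNondegenerate (Λ : ℝ) (H : ℂ → ℝ) (ρ : ℝ → ℝ) (K : Set (Fin 4 → ℝ)) (δ c : ℝ) :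
    Prop where
  pos : 0 < c
  PEps : ∀ x : Param K δ, c ≤ |PEps Λ H ρ x.eps x.pt|
  transDet : ∀ x : Param K δ, c ≤ transDet Λ H ρ x.eps x.pt
  halfApprox : ∀ x : Param K δ, c ≤ halfApprox Λ H ρ x.eps x.pt 2 2

variable (hH : IsC31Loc H) (hρ : IsMollifier ρ) (hK : IsCompact K) (hδ : IsRange Λ K δ)
  (hc : IsNondegenerate Λ H ρ K δ c)

theorem mem_bdd_inv {X : Type*} {f : X → ℝ} (hc : 0 < c) (hf : ∀ x, c ≤ |f x|) :
    (fun x => (f x)⁻¹) ∈ bdd X :=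
  ⟨c⁻¹, fun x => by
    rw [abs_inv]
    exact inv_anti₀ hc (hf x)⟩

include hc

theorem IsNondegenerate.PEps_ne_zero (x : Param K δ) : IPPWave.PEps Λ H ρ x.eps x.pt ≠ 0 :=
  abs_pos.mp (hc.pos.trans_le (hc.PEps x))

theorem IsNondegenerate.transDet_ne_zero (x : Param K δ) :
    IPPWave.transDet Λ H ρ x.eps x.pt ≠ 0 :=
  (hc.pos.trans_le (hc.transDet x)).ne'

include hH hρ hK hδ

/-- The regularised metrics converge at rate `ε`. -/
theorem exists_metric_bound (hKM : K ⊆ lorentzDomain Λ H) (i j : Fin 4) :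
    ∃ C, ∀ x : Param K δ, |approxMetric Λ H ρ x.eps x.pt i j - waveMetric Λ H x.pt i j| ≤
      C * x.eps := by
  obtain ⟨Pa, Pb, m, n, hPa, hPb, hm, hn, hP, hmn⟩ := exists_modSmall_eq hH hρ hK hδ
  set Qa : bdd (Param K δ) := ⟨_, mem_bdd_inv hc.pos hc.PEps⟩
  obtain ⟨C, hC⟩ := hK.exists_bound_of_continuousOn
    ((continuous_P (Λ := Λ) hH).continuousOn.inv₀ fun p hp => (hKM hp).1)
  set Qb : bdd (Param K δ) := ⟨fun x => (P Λ H x.pt)⁻¹, C, fun x => hC _ x.pt_mem⟩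
  have hQa : ∀ x, ev x Qa = (PEps Λ H ρ x.eps x.pt)⁻¹ := fun x => rfl
  have hQb : ∀ x, ev x Qb = (P Λ H x.pt)⁻¹ := fun x => rfl
  have h1 : Pa * Qa = 1 := bdd_ext fun x => by
    rw [map_mul, hPa, hQa, map_one, mul_inv_cancel₀ (hc.PEps_ne_zero x)]
  have h2 : Pb * Qb = 1 := bdd_ext fun x => by
    rw [map_mul, hPb, hQb, map_one, mul_inv_cancel₀ (hKM x.pt_mem).1]
  -- Both are inverses of the same element of the quotient, and inverses are unique.
  have hQ : modSmall Param.eps Qa = modSmall Param.eps Qb := by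
    have e1 := congrArg (modSmall Param.eps) h1
    have e2 := congrArg (modSmall Param.eps) h2
    rw [map_mul, map_one] at e1 e2
    rw [hP] at e1
    linear_combination modSmall Param.eps Qb * e1 - modSmall Param.eps Qa * e2
  have key : modSmall Param.eps (Qa ^ 2 * (2 * m i j)) =
      modSmall Param.eps (Qb ^ 2 * (2 * n i j)) := by
    simp only [map_mul, map_pow, hQ, hmn]
  obtain ⟨C, hC⟩ := modSmall_eq.mp key
  refine ⟨C, fun x => ?_⟩
  have e1 : approxMetric Λ H ρ x.eps x.pt i j = ev x (Qa ^ 2 * (2 * m i j)) := by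
    rw [map_mul, map_mul, map_pow, hQa, hm, map_ofNat, approxMetric_eq hH, inv_pow, ← one_div]
    rfl
  have e2 : waveMetric Λ H x.pt i j = ev x (Qb ^ 2 * (2 * n i j)) := by
    rw [map_mul, map_mul, map_pow, hQb, hn, map_ofNat, waveMetric_eq hH, inv_pow, ← one_div]
    rfl
  rw [e1, e2]
  exact hC x

omit hK hδ in
theorem realAtoms_inv (x : Param K δ) (hδ : IsRange Λ K δ) :
    (realAtoms Λ H ρ x.eps x.pt).PJ.v * (realAtoms Λ H ρ x.eps x.pt).Q = 1 ∧
    2 * ((realAtoms Λ H ρ x.eps x.pt).h11J.v * (realAtoms Λ H ρ x.eps x.pt).k11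
      + (realAtoms Λ H ρ x.eps x.pt).h12J.v * (realAtoms Λ H ρ x.eps x.pt).k12) = 1 ∧
    (realAtoms Λ H ρ x.eps x.pt).h11J.v * (realAtoms Λ H ρ x.eps x.pt).k12
      + (realAtoms Λ H ρ x.eps x.pt).h12J.v * (realAtoms Λ H ρ x.eps x.pt).k22 = 0 ∧
    (realAtoms Λ H ρ x.eps x.pt).h12J.v * (realAtoms Λ H ρ x.eps x.pt).k11
      + (realAtoms Λ H ρ x.eps x.pt).h22J.v * (realAtoms Λ H ρ x.eps x.pt).k12 = 0 ∧
    2 * ((realAtoms Λ H ρ x.eps x.pt).h12J.v * (realAtoms Λ H ρ x.eps x.pt).k12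
      + (realAtoms Λ H ρ x.eps x.pt).h22J.v * (realAtoms Λ H ρ x.eps x.pt).k22) = 1 := by
  have hh := halfApprox_eq hH hρ x.eps_pos (hδ.lt_or_ne x)
  have e1 : (realAtoms Λ H ρ x.eps x.pt).h11J.v = halfApprox Λ H ρ x.eps x.pt 2 2 := (hh 2 2).symm
  have e2 : (realAtoms Λ H ρ x.eps x.pt).h12J.v = halfApprox Λ H ρ x.eps x.pt 2 3 := (hh 2 3).symm
  have e3 : (realAtoms Λ H ρ x.eps x.pt).h22J.v = halfApprox Λ H ρ x.eps x.pt 3 3 := (hh 3 3).symm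
  have hD : transDet Λ H ρ x.eps x.pt * (2 * transDet Λ H ρ x.eps x.pt)⁻¹ = 1 / 2 := by
    have := hc.transDet_ne_zero x
    field_simp
  rw [realAtoms_PJ_v, e1, e2, e3]
  refine ⟨mul_inv_cancel₀ (hc.PEps_ne_zero x), ?_, ?_, ?_, ?_⟩ <;> simp only [realAtoms] <;>
    rw [transDet] at * <;> set D := (2 * _ : ℝ)⁻¹
  · linear_combination 2 * hD
  · ring
  · ring
  · linear_combination 2 * hD

/-- The atoms as bounded functions. -/
theorem exists_atoms_eq : ∃ a : Atoms (bdd (Param K δ)),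
    ∀ x, a.map (ev x) = realAtoms Λ H ρ x.eps x.pt := by
  obtain ⟨Pa, Pb, m, n, hPa, hPb, hm, hn, hP, hmn⟩ := exists_modSmall_eq hH hρ hK hδ
  set Qa : bdd (Param K δ) := ⟨_, mem_bdd_inv hc.pos hc.PEps⟩
  set D : bdd (Param K δ) := ⟨fun x => (2 * transDet Λ H ρ x.eps x.pt)⁻¹,
    mem_bdd_inv hc.pos fun x => by
      have := hc.transDet x
      have := hc.pos
      rw [abs_of_pos (by linarith)]
      linarith⟩
  have hD : ∀ x, ev x D = (2 * transDet Λ H ρ x.eps x.pt)⁻¹ := fun x => rfl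
  have hQa : ∀ x, ev x Qa = (PEps Λ H ρ x.eps x.pt)⁻¹ := fun x => rfl
  obtain ⟨a, ha⟩ := exists_atoms hH hρ hK hδ Qa (D * m 3 3) (D * -m 2 3) (D * m 2 2)
  refine ⟨a, fun x => ?_⟩
  rw [ha, map_mul, map_mul, map_mul, map_neg, hm, hm, hm, hD, hQa]
  rfl

/-- The approximate relations come from the estimates of order ε on the mollified functions and
correctors. The inverse relations hold exactly before passing to the quotient, and the second
derivatives of the correctors vanish by the definition of `realAtoms`. -/
theorem isReduced_atoms {a : Atoms (bdd (Param K δ))}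
    (ha : ∀ x, a.map (ev x) = realAtoms Λ H ρ x.eps x.pt) :
    (a.map (modSmall Param.eps)).IsReduced := by
  have hκ := fun ε (h : 0 < ε) => isCorrector_kappaEps hρ h
  have hζ := fun ε (h : 0 < ε) => isCorrector_zetaEps hρ h
  have hι := fun ε (h : 0 < ε) => isCorrector_iotaEps hρ h
  have z : ∀ {f : bdd (Param K δ)} {F : Param K δ → ℝ}, (∀ x, ev x f = F x) →
      (∃ C, ∀ x, |F x| ≤ C * x.eps) → modSmall Param.eps f = 0 := by
    intro f F hf hF
    rw [modSmall_eq_zero]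
    simpa only [hf] using hF
  have z0 : ∀ {f : bdd (Param K δ)}, (∀ x, ev x f = 0) → modSmall Param.eps f = 0 :=
    fun hf => z hf ⟨0, fun x => by simp⟩
  have e : ∀ {f g : bdd (Param K δ)}, (∀ x, ev x f = ev x g) →
      modSmall Param.eps f = modSmall Param.eps g := fun h => congrArg _ (bdd_ext h)
  have hw : ∀ x, ev x a.w = mollify ρ x.eps uPlus (x.pt 0) := fun x => congrArg Atoms.w (ha x)
  have hθ : ∀ x, ev x a.θ = mollify ρ x.eps heaviside (x.pt 0) := fun x => congrArg Atoms.θ (ha x)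
  have hs : ∀ x, ev x a.s = mollify ρ x.eps (fun u => uPlus u ^ 2) (x.pt 0) :=
    fun x => congrArg Atoms.s (ha x)
  have hU : ∀ x, ev x a.U = x.pt 0 := fun x => congrArg Atoms.U (ha x)
  have hi := fun x => realAtoms_inv hH hρ hc x hδ
  simp only [← ha] at hi
  refine ⟨?_, z (fun x => congrArg Atoms.κ (ha x)) (IsCorrector.bound hδ hK hκ),
    z (fun x => congrArg Atoms.κ1 (ha x)) (IsCorrector.bound_deriv hκ),
    z0 fun x => congrArg Atoms.κ2 (ha x),
    z (fun x => congrArg Atoms.ζ (ha x)) (IsCorrector.bound hδ hK hζ),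
    z (fun x => congrArg Atoms.ζ1 (ha x)) (IsCorrector.bound_deriv hζ),
    z0 fun x => congrArg Atoms.ζ2 (ha x),
    z (fun x => congrArg Atoms.ι (ha x)) (IsCorrector.bound hδ hK hι),
    z (fun x => congrArg Atoms.ι1 (ha x)) (IsCorrector.bound_deriv hι),
    z0 fun x => congrArg Atoms.ι2 (ha x), ?_, ?_, ?_, ?_, ?_, ?_, ?_, ?_⟩
  · have := e (f := 2 * a.half) (g := 1) fun x => by
      rw [map_mul, map_ofNat, map_one, show ev x a.half = 1 / 2 from congrArg Atoms.half (ha x)]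
      norm_num
    rwa [map_mul, map_ofNat, map_one] at this
  · have := (modSmall_eq (e := Param.eps) (f := a.s) (g := a.w ^ 2)).mpr ⟨2, fun x => by
      rw [map_pow, hs, hw]
      exact abs_mollify_uPlus_sq_sub hρ x.eps_pos (x.eps_le.trans hδ.le_one) (x.pt 0)⟩
    rwa [map_pow] at this
  · have := (modSmall_eq (e := Param.eps) (f := a.w * a.θ) (g := a.w)).mpr ⟨1, fun x => by
      rw [map_mul, hθ, hw, one_mul]
      exact abs_mollify_uPlus_mul_sub hρ x.eps_pos (x.pt 0)⟩
    rwa [map_mul] at this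
  · have := (modSmall_eq (e := Param.eps) (f := a.U * a.θ) (g := a.w)).mpr ⟨2, fun x => by
      rw [map_mul, hθ, hw, hU]
      exact abs_mul_mollify_heaviside_sub hρ x.eps_pos (x.pt 0)⟩
    rwa [map_mul] at this
  · have := e (f := a.PJ.v * a.Q) (g := 1) fun x => by
      rw [map_mul, map_one, ← (hi x).1, Atoms.map_PJ, Jet.map_v]
      rfl
    rwa [map_mul, map_one, ← Jet.map_v, ← Atoms.map_PJ] at this
  · have := e (f := 2 * (a.h11J.v * a.k11 + a.h12J.v * a.k12)) (g := 1) fun x => by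
      rw [map_mul, map_add, map_mul, map_mul, map_one, map_ofNat, ← (hi x).2.1, Atoms.map_h11J,
        Atoms.map_h12J, Jet.map_v, Jet.map_v]
      rfl
    rwa [map_mul, map_add, map_mul, map_mul, map_one, map_ofNat, ← Jet.map_v, ← Jet.map_v,
      ← Atoms.map_h11J, ← Atoms.map_h12J] at this
  · have := e (f := a.h11J.v * a.k12 + a.h12J.v * a.k22) (g := 0) fun x => by
      rw [map_add, map_mul, map_mul, map_zero, ← (hi x).2.2.1, Atoms.map_h11J,
        Atoms.map_h12J, Jet.map_v, Jet.map_v]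
      rfl
    rwa [map_add, map_mul, map_mul, map_zero, ← Jet.map_v, ← Jet.map_v,
      ← Atoms.map_h11J, ← Atoms.map_h12J] at this
  · have := e (f := a.h12J.v * a.k11 + a.h22J.v * a.k12) (g := 0) fun x => by
      rw [map_add, map_mul, map_mul, map_zero, ← (hi x).2.2.2.1, Atoms.map_h12J,
        Atoms.map_h22J, Jet.map_v, Jet.map_v]
      rfl
    rwa [map_add, map_mul, map_mul, map_zero, ← Jet.map_v, ← Jet.map_v,
      ← Atoms.map_h12J, ← Atoms.map_h22J] at this
  · have := e (f := 2 * (a.h12J.v * a.k12 + a.h22J.v * a.k22)) (g := 1) fun x => by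
      rw [map_mul, map_add, map_mul, map_mul, map_one, map_ofNat, ← (hi x).2.2.2.2, Atoms.map_h12J,
        Atoms.map_h22J, Jet.map_v, Jet.map_v]
      rfl
    rwa [map_mul, map_add, map_mul, map_mul, map_one, map_ofNat, ← Jet.map_v, ← Jet.map_v,
      ← Atoms.map_h12J, ← Atoms.map_h22J] at this

/-- The Einstein equations hold up to order `ε`, except for the component `UU`. -/
theorem exists_ricJ_bound {i j : Fin 4} (hij : ¬(i = 0 ∧ j = 0)) :
    ∃ C, ∀ x : Param K δ, |(realAtoms Λ H ρ x.eps x.pt).ricJ i j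
      - Λ * (realAtoms Λ H ρ x.eps x.pt).gJ i j| ≤ C * x.eps := by
  obtain ⟨a, ha⟩ := exists_atoms_eq hH hρ hK hδ hc
  have h := (isReduced_atoms hH hρ hK hδ hc ha).ricJ_eq i j hij
  rw [Atoms.map_ricJ, Atoms.map_gJ] at h
  have h' : modSmall Param.eps (a.ricJ i j) = modSmall Param.eps (6 * a.L * a.gJ i j) := by
    rw [h, map_mul, map_mul, map_ofNat]
    rfl
  obtain ⟨C, hC⟩ := modSmall_eq.mp h'
  refine ⟨C, fun x => ?_⟩
  have := hC x
  rw [map_mul, map_mul, map_ofNat, ← Atoms.map_ricJ, ← Atoms.map_gJ, ha,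
    show ev x a.L = Λ / 6 from congrArg Atoms.L (ha x)] at this
  convert this using 3
  ring

end

end

section

/-! ### The component `UU` of the Ricci tensor -/

section

variable {Λ : ℝ} {H : ℂ → ℝ} {ρ : ℝ → ℝ} {K : Set (Fin 4 → ℝ)} {δ c : ℝ}

theorem abs_rhoEps_mul_le (hρ : IsMollifier ρ) {ε : ℝ} (hε : 0 < ε) {u g B : ℝ}
    (h : |u| ≤ ε → |g| ≤ B) : |rhoEps ρ ε u * g| ≤ rhoEps ρ ε u * B := by
  rcases le_total |u| ε with hu | hu
  · rw [abs_mul, abs_of_nonneg (rhoEps_nonneg hρ hε u)]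
    exact mul_le_mul_of_nonneg_left (h hu) (rhoEps_nonneg hρ hε u)
  · rw [rhoEps_eq_zero hρ hε hu, zero_mul, zero_mul, abs_zero]

/-- On its support ρ_ε is at most a constant over ε, so one power of ε in g gives boundedness; the
next lemma uses two powers to get O(ε). -/
theorem exists_rhoEps_mul_le (hρ : IsMollifier ρ) {g : Param K δ → ℝ} (A : ℝ)
    (h : ∀ x : Param K δ, |x.pt 0| ≤ x.eps → |g x| ≤ A * x.eps) :
    ∃ C, ∀ x : Param K δ, |rhoEps ρ x.eps (x.pt 0) * g x| ≤ C := by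
  obtain ⟨C, hC0, hC⟩ := exists_rhoEps_bound hρ
  refine ⟨|A| * C, fun x => (abs_rhoEps_mul_le hρ x.eps_pos (h x)).trans ?_⟩
  have h1 := hC _ x.eps_pos (x.pt 0)
  have h2 := mul_nonneg (rhoEps_nonneg hρ x.eps_pos (x.pt 0)) x.eps_pos.le
  nlinarith [le_abs_self A, abs_nonneg A]

theorem exists_rhoEps_mul_le_eps (hρ : IsMollifier ρ) {g : Param K δ → ℝ} (A : ℝ)
    (h : ∀ x : Param K δ, |x.pt 0| ≤ x.eps → |g x| ≤ A * x.eps ^ 2) :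
    ∃ C, ∀ x : Param K δ, |rhoEps ρ x.eps (x.pt 0) * g x| ≤ C * x.eps := by
  obtain ⟨C, hC0, hC⟩ := exists_rhoEps_bound hρ
  refine ⟨|A| * C, fun x => (abs_rhoEps_mul_le hρ x.eps_pos (h x)).trans ?_⟩
  have h1 := hC _ x.eps_pos (x.pt 0)
  have h2 := mul_nonneg (rhoEps_nonneg hρ x.eps_pos (x.pt 0)) x.eps_pos.le
  have h3 : rhoEps ρ x.eps (x.pt 0) * x.eps * A ≤ |A| * C := by
    nlinarith [le_abs_self A, abs_nonneg A]
  have h4 := mul_le_mul_of_nonneg_right h3 x.eps_pos.le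
  linarith

theorem abs_mollify_uPlus_le (hρ : IsMollifier ρ) {ε : ℝ} (hε : 0 < ε) {u : ℝ} (hu : |u| ≤ ε) :
    |mollify ρ ε uPlus u| ≤ ε := by
  rw [abs_of_nonneg (mollify_uPlus_nonneg hρ hε u)]
  exact mollify_uPlus_le hρ hε ((le_abs_self u).trans hu)

theorem IsCorrector.abs_le_sq {ε : ℝ} (hε : 0 < ε) {a f : ℝ → ℝ} (h : IsCorrector ε a f) {u : ℝ}
    (hu : |u| ≤ ε) : |a u| ≤ 4 * ε ^ 2 := by
  refine (h.abs_le u).trans ?_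
  nlinarith

/-- The cut-off reciprocal of p₀ is a true inverse on the support of ρ_ε. -/
theorem realAtoms_p0 (hδ : IsRange Λ K δ) (hρ : IsMollifier ρ) (x : Param K δ) :
    rhoEps ρ x.eps (x.pt 0) *
      ((realAtoms Λ H ρ x.eps x.pt).p0J.v * (realAtoms Λ H ρ x.eps x.pt).p0i - 1) = 0 := by
  have e1 : (realAtoms Λ H ρ x.eps x.pt).p0J.v = bgFactor Λ (zCoord x.pt) := by
    simp [Atoms.p0J, Atoms.normJ, Jet.coord, realAtoms, bgFactor, zCoord, Complex.normSq_mk]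
  have e2 : (realAtoms Λ H ρ x.eps x.pt).p0i = bgInv Λ x.eps x.pt := rfl
  rw [e1, e2, bgInv]
  rcases lt_or_ge (x.pt 0) (-x.eps) with h | h
  · rw [rhoEps_eq_zero_of_le hρ x.eps_pos h.le, zero_mul]
  · rw [if_neg h.not_gt, mul_inv_cancel₀ (hδ.ne_zero _ x.pt_mem (by linarith [x.eps_le])), sub_self,
      mul_zero]

variable (hH : IsC31Loc H) (hρ : IsMollifier ρ) (hK : IsCompact K) (hδ : IsRange Λ K δ)
  (hc : IsNondegenerate Λ H ρ K δ c)

/-- The function `restUU` of the atoms at a point. -/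
def restAt (Λ : ℝ) (H : ℂ → ℝ) (ρ : ℝ → ℝ) (ε : ℝ) (p : Fin 4 → ℝ) : ℝ :=
  (realAtoms Λ H ρ ε p).restUU (rhoEps ρ ε (p 0) * mollify ρ ε uPlus (p 0)) (sigmaEps ρ ε (p 0))
    (rhoEps ρ ε (p 0) * p 0) (rhoEps ρ ε (p 0) * (realAtoms Λ H ρ ε p).cJ.v)
    (rhoEps ρ ε (p 0) * mollify ρ ε (fun u => uPlus u ^ 2) (p 0))

include hH hρ hK hδ hc

/-- The products ρ_ε w and ρ_ε U are merely bounded, but become O(ε) after one more factor w or U;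
ρ_ε c and ρ_ε s are O(ε) at once. These are the hypotheses of `restUU_eq_zero` in the quotient. -/
theorem exists_restAt_bound :
    ∃ C, ∀ x : Param K δ, |restAt Λ H ρ x.eps x.pt| ≤ C * x.eps := by
  obtain ⟨a, ha⟩ := exists_atoms_eq hH hρ hK hδ hc
  have hred := isReduced_atoms hH hρ hK hδ hc ha
  have hκ := fun ε (h : 0 < ε) => isCorrector_kappaEps hρ h
  have hζ := fun ε (h : 0 < ε) => isCorrector_zetaEps hρ h
  have hι := fun ε (h : 0 < ε) => isCorrector_iotaEps hρ h
  have hw : ∀ x, ev x a.w = mollify ρ x.eps uPlus (x.pt 0) := fun x => congrArg Atoms.w (ha x)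
  have hU : ∀ x, ev x a.U = x.pt 0 := fun x => congrArg Atoms.U (ha x)
  have bw : ∀ x : Param K δ, |x.pt 0| ≤ x.eps → |mollify ρ x.eps uPlus (x.pt 0)| ≤ x.eps :=
    fun x => abs_mollify_uPlus_le hρ x.eps_pos
  have sq : ∀ (x : Param K δ) {a b : ℝ}, |a| ≤ x.eps → |b| ≤ x.eps → |a * b| ≤ 1 * x.eps ^ 2 := by
    intro x a b h1 h2
    rw [abs_mul, one_mul, pow_two]
    exact mul_le_mul h1 h2 (abs_nonneg _) x.eps_pos.le
  set r1 : bdd (Param K δ) := ⟨fun x => rhoEps ρ x.eps (x.pt 0) * mollify ρ x.eps uPlus (x.pt 0),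
    exists_rhoEps_mul_le hρ 1 fun x hx => by simpa using bw x hx⟩
  set rU : bdd (Param K δ) := ⟨fun x => rhoEps ρ x.eps (x.pt 0) * x.pt 0,
    exists_rhoEps_mul_le hρ 1 fun x hx => by simpa using hx⟩
  have small : ∀ {f : bdd (Param K δ)} {F : Param K δ → ℝ}
      (_ : ∀ x, ev x f = rhoEps ρ x.eps (x.pt 0) * F x) (A : ℝ)
      (_ : ∀ x : Param K δ, |x.pt 0| ≤ x.eps → |F x| ≤ A * x.eps ^ 2),
      modSmall Param.eps f = 0 := by
    intro f F hf A hA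
    rw [modSmall_eq_zero]
    simpa only [hf] using exists_rhoEps_mul_le_eps hρ A hA
  have sκ := exists_rhoEps_mul_le_eps (K := K) (δ := δ) hρ 4 fun x hx =>
    (hκ _ x.eps_pos).abs_le_sq x.eps_pos hx
  have sζ := exists_rhoEps_mul_le_eps (K := K) (δ := δ) hρ 4 fun x hx =>
    (hζ _ x.eps_pos).abs_le_sq x.eps_pos hx
  have sι := exists_rhoEps_mul_le_eps (K := K) (δ := δ) hρ 4 fun x hx =>
    (hι _ x.eps_pos).abs_le_sq x.eps_pos hx
  have bs : ∀ x : Param K δ, |x.pt 0| ≤ x.eps →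
      |mollify ρ x.eps (fun u => uPlus u ^ 2) (x.pt 0)| ≤ 2 * x.eps ^ 2 := fun x hx => by
    rw [abs_of_nonneg (mollify_uPlus_sq_nonneg hρ x.eps_pos _)]
    exact mollify_uPlus_sq_le hρ x.eps_pos ((le_abs_self _).trans hx)
  set rκ : bdd (Param K δ) := ⟨_, mem_bdd_of_small hδ sκ⟩
  set rζ : bdd (Param K δ) := ⟨_, mem_bdd_of_small hδ sζ⟩
  set rι : bdd (Param K δ) := ⟨_, mem_bdd_of_small hδ sι⟩
  set rs : bdd (Param K δ) := ⟨_, mem_bdd_of_small hδ (exists_rhoEps_mul_le_eps hρ 2 bs)⟩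
  have mκ : modSmall Param.eps rκ = 0 := modSmall_eq_zero.mpr sκ
  have mζ : modSmall Param.eps rζ = 0 := modSmall_eq_zero.mpr sζ
  have mι : modSmall Param.eps rι = 0 := modSmall_eq_zero.mpr sι
  have ms : modSmall Param.eps rs = 0 := small (fun x => rfl) 2 bs
  have e1 : ∀ x, ev x r1 = rhoEps ρ x.eps (x.pt 0) * mollify ρ x.eps uPlus (x.pt 0) := fun x => rfl
  have eU : ∀ x, ev x rU = rhoEps ρ x.eps (x.pt 0) * x.pt 0 := fun x => rfl
  -- ρ_ε alone need not be bounded uniformly in ε, so ρ_ε c is built from the products ρ_ε κ, ρ_ε ζ,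
  -- ρ_ε ι.
  set rc : bdd (Param K δ) := a.AJ.v * rκ + a.nJ.v * rζ + a.EJ.v * rι with hrc
  have mc : modSmall Param.eps rc = 0 := by
    simp only [hrc, map_add, map_mul, mκ, mζ, mι, mul_zero, add_zero]
  have p0v : ∀ x, ev x (a.p0J.v * a.p0i) =
      (realAtoms Λ H ρ x.eps x.pt).p0J.v * (realAtoms Λ H ρ x.eps x.pt).p0i := fun x => by
    rw [map_mul, ← ha, Atoms.map_p0J, Jet.map_v]
    rfl
  have h1p : r1 * (a.p0J.v * a.p0i) = r1 := bdd_ext fun x => by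
    have := realAtoms_p0 (H := H) hδ hρ x
    rw [map_mul, e1, p0v]
    linear_combination mollify ρ x.eps uPlus (x.pt 0) * this
  have hUp : rU * (a.p0J.v * a.p0i) = rU := bdd_ext fun x => by
    have := realAtoms_p0 (H := H) hδ hρ x
    rw [map_mul, eU, p0v]
    linear_combination x.pt 0 * this
  have key : modSmall Param.eps (a.restUU r1 (a.θ ^ 2 - a.θ) rU rc rs) = 0 := by
    rw [← Atoms.map_restUU, mc, ms, map_sub, map_pow]
    refine hred.restUU_eq_zero ?_ ?_ ?_ ?_ ?_ ?_
    · refine (map_mul _ r1 a.w).symm.trans (small (fun x => ?_) 1 fun x hx => sq x (bw x hx) (bw x hx))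
      rw [map_mul, e1, hw, mul_assoc]
    · refine (map_mul _ r1 a.U).symm.trans (small (fun x => ?_) 1 fun x hx => sq x (bw x hx) hx)
      rw [map_mul, e1, hU, mul_assoc]
    · refine (map_mul _ rU a.w).symm.trans (small (fun x => ?_) 1 fun x hx => sq x hx (bw x hx))
      rw [map_mul, eU, hw, mul_assoc]
    · refine (map_mul _ rU a.U).symm.trans (small (fun x => ?_) 1 fun x hx => sq x hx hx)
      rw [map_mul, eU, hU, mul_assoc]
    · rw [Atoms.map_p0J, Jet.map_v]
      exact ((map_mul _ _ _).trans (congrArg _ (map_mul _ _ _))).symm.trans (congrArg _ h1p)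
    · rw [Atoms.map_p0J, Jet.map_v]
      exact ((map_mul _ _ _).trans (congrArg _ (map_mul _ _ _))).symm.trans (congrArg _ hUp)
  obtain ⟨C, hC⟩ := modSmall_eq_zero.mp key
  refine ⟨C, fun x => ?_⟩
  have h := hC x
  have hz : ev x (a.θ ^ 2 - a.θ) = sigmaEps ρ x.eps (x.pt 0) := by
    rw [map_sub, map_pow, show ev x a.θ = _ from congrArg Atoms.θ (ha x)]
    rfl
  have hcv : ev x rc = rhoEps ρ x.eps (x.pt 0) * (realAtoms Λ H ρ x.eps x.pt).cJ.v := by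
    rw [hrc, map_add, map_add, map_mul, map_mul, map_mul, ← Jet.map_v, ← Jet.map_v, ← Jet.map_v,
      ← Atoms.map_AJ, ← Atoms.map_nJ, ← Atoms.map_EJ, ha]
    change _ * (rhoEps ρ x.eps (x.pt 0) * _) + _ * (rhoEps ρ x.eps (x.pt 0) * _)
      + _ * (rhoEps ρ x.eps (x.pt 0) * _) = _
    simp only [Atoms.cJ, Jet.add_v, Jet.mul_v, Jet.ofU]
    change _ = rhoEps ρ x.eps (x.pt 0) * (_ * kappaEps ρ x.eps (x.pt 0)
      + _ * zetaEps ρ x.eps (x.pt 0) + _ * iotaEps ρ x.eps (x.pt 0))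
    ring
  rw [← Atoms.map_restUU, hz, hcv, e1, eU, ha] at h
  exact h

omit hK in
theorem ricJ_fullAtoms_zero_zero (x : Param K δ) : (fullAtoms Λ H ρ x.eps x.pt).ricJ 0 0 =
    rhoEps ρ x.eps (x.pt 0) * (-(M11 H (zCoord x.pt) + M22 H (zCoord x.pt))
      - 2 * (Λ / 6) * G H (zCoord x.pt) * bgInv Λ x.eps x.pt) + restAt Λ H ρ x.eps x.pt := by
  obtain ⟨h1, h2, h3, h4, h5⟩ := realAtoms_inv hH hρ hc x hδ
  rw [fullAtoms, mul_comm (mollify _ _ _ _), mul_comm (x.pt 0)]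
  exact Atoms.ricJ_zero_zero_withSecond rfl rfl rfl rfl (realAtoms_p0 hδ hρ x) h1 h2 h3 h4 h5

-- The term dropped is ρ_ε ≥ 0 times the quantity of the curvature hypothesis. For U < -ε, where
-- that hypothesis may say nothing, ρ_ε is zero.
omit hK in
theorem restAt_le_ricJ (hcond : ∀ z : ℂ, bgFactor Λ z ≠ 0 →
    0 ≤ -2 * HZZb H z - Λ * G H z / (3 * bgFactor Λ z)) (x : Param K δ) :
    restAt Λ H ρ x.eps x.pt ≤ (fullAtoms Λ H ρ x.eps x.pt).ricJ 0 0 := by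
  rw [ricJ_fullAtoms_zero_zero hH hρ hδ hc]
  refine le_add_of_nonneg_left ?_
  rcases lt_or_ge (x.pt 0) (-x.eps) with h | h
  · rw [rhoEps_eq_zero_of_le hρ x.eps_pos h.le, zero_mul]
  · have hb := hδ.ne_zero _ x.pt_mem (by linarith [x.eps_le])
    refine mul_nonneg (rhoEps_nonneg hρ x.eps_pos _) ((hcond _ hb).trans_eq ?_)
    rw [HZZb_eq hH, bgInv, if_neg h.not_gt]
    field_simp
    ring

end

end

section

/-! ### Signature, regularity and the Ricci bound -/

theorem isLorentzian_halfMetric {H : ℂ → ℝ} {w s c k : ℝ} {z : ℂ} (hk : 0 < k)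
    (h1 : 0 < halfMetric H w s c z 2 2)
    (h2 : 0 < halfMetric H w s c z 2 2 * halfMetric H w s c z 3 3
      - halfMetric H w s c z 2 3 ^ 2) : IsLorentzian (k • halfMetric H w s c z) := by
  set a := halfMetric H w s c z 2 2 with ha
  set b := halfMetric H w s c z 2 3 with hb
  set d := halfMetric H w s c z 3 3 with hd
  have hM : halfMetric H w s c z =
      !![0, -(1 / 2), 0, 0; -(1 / 2), 0, 0, 0; 0, 0, a, b; 0, 0, b, d] := by
    ext i j
    fin_cases i <;> fin_cases j <;> rfl
  have sq : ∀ {x : ℝ}, 0 < x → (√x)⁻¹ * (√x)⁻¹ * x = 1 := fun hx => by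
    rw [← mul_inv, Real.mul_self_sqrt hx.le, inv_mul_cancel₀ hx.ne']
  obtain ⟨α, hα⟩ : ∃ α : ℝ, α * α * k = 1 := ⟨_, sq hk⟩
  obtain ⟨β, hβ⟩ : ∃ β : ℝ, β * β * (k * a) = 1 := ⟨_, sq (mul_pos hk h1)⟩
  obtain ⟨γ, hγ⟩ : ∃ γ : ℝ, γ * γ * (k * a * (a * d - b ^ 2)) = 1 :=
    ⟨_, sq (mul_pos (mul_pos hk h1) h2)⟩
  -- The columns are ∂_U + ∂_V and ∂_U - ∂_V, rescaled, followed by Gram–Schmidt applied to ∂_x,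
  -- ∂_y.
  set S : Matrix (Fin 4) (Fin 4) ℝ :=
    !![α, α, 0, 0; α, -α, 0, 0; 0, 0, β, -γ * b; 0, 0, 0, γ * a]
  have hS : Sᵀ * (k • halfMetric H w s c z) * S = Matrix.diagonal ![-1, 1, 1, 1] := by
    rw [hM]
    ext i j
    fin_cases i <;> fin_cases j <;>
      simp [S, Matrix.mul_apply, Fin.sum_univ_four, Matrix.diagonal] <;>
      first | ring1 | exact Or.inl (by ring1) | exact Or.inr (by ring1) | linear_combination hα | linear_combination -hα | linear_combination hβ |
        linear_combination hγ
  refine ⟨S, ?_, hS⟩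
  rw [isUnit_iff_ne_zero]
  intro h0
  have := congrArg Matrix.det hS
  rw [Matrix.det_mul, h0, mul_zero, Matrix.det_diagonal] at this
  simp [Fin.prod_univ_four] at this

/-- Only a lower bound is needed on the diagonal entry 00, as X₀² ≥ 0. The other entries are handled
by 2|xy| ≤ x² + y²; summed over the sixteen pairs this gives the factor 4. -/
theorem quadratic_ge {T : Matrix (Fin 4) (Fin 4) ℝ} {B : ℝ} (h0 : -B ≤ T 0 0)
    (h : ∀ i j, ¬(i = 0 ∧ j = 0) → |T i j| ≤ B) (X : Fin 4 → ℝ) :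
    -(4 * B) * (X ⬝ᵥ X) ≤ X ⬝ᵥ (T *ᵥ X) := by
  have key : ∀ i j, -B * ((X i ^ 2 + X j ^ 2) / 2) ≤ X i * (T i j * X j) := by
    intro i j
    by_cases hij : i = 0 ∧ j = 0
    · rw [hij.1, hij.2]
      nlinarith [sq_nonneg (X 0)]
    · obtain ⟨h1, h2⟩ := abs_le.mp (h i j hij)
      nlinarith [sq_nonneg (X i - X j), sq_nonneg (X i + X j),
        mul_nonneg (by linarith : 0 ≤ B + T i j) (sq_nonneg (X i + X j)),
        mul_nonneg (by linarith : 0 ≤ B - T i j) (sq_nonneg (X i - X j))]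
  calc -(4 * B) * (X ⬝ᵥ X) = ∑ i, ∑ j, -B * ((X i ^ 2 + X j ^ 2) / 2) := by
        simp only [dotProduct, Fin.sum_univ_four]
        ring
    _ ≤ ∑ i, ∑ j, X i * (T i j * X j) :=
        Finset.sum_le_sum fun i _ => Finset.sum_le_sum fun j _ => key i j
    _ = X ⬝ᵥ (T *ᵥ X) := by simp only [dotProduct, Matrix.mulVec, Finset.mul_sum]

theorem contDiff_one_of_hasDerivAt {f f' : ℝ → ℝ} (h : ∀ u, HasDerivAt f (f' u) u)
    (hc : Continuous f') : ContDiff ℝ 1 f := by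
  rw [contDiff_one_iff_deriv, show deriv f = f' from funext fun u => (h u).deriv]
  exact ⟨fun u => (h u).differentiableAt, hc⟩

theorem IsCorrector.contDiff {ε : ℝ} {a f : ℝ → ℝ} (h : IsCorrector ε a f) : ContDiff ℝ 1 a :=
  contDiff_one_of_hasDerivAt h.hasDerivAt
    (continuous_iff_continuousAt.mpr fun u => (h.hasDerivAt_deriv u).continuousAt)

section

variable {Λ : ℝ} {H : ℂ → ℝ} {ρ : ℝ → ℝ} {K : Set (Fin 4 → ℝ)} {δ c : ℝ}
variable (hH : IsC31Loc H) (hρ : IsMollifier ρ) (hK : IsCompact K) (hδ : IsRange Λ K δ)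
  (hc : IsNondegenerate Λ H ρ K δ c)

theorem contDiff_zCoord {n : ℕ∞} : ContDiff ℝ n zCoord := by
  have h : zCoord = zL := funext fun p => (zL_apply p).symm
  rw [h]
  exact zL.contDiff

include hH hρ

/-- C¹ regularity is claimed also where D³H is not differentiable, so it cannot be read off `HasJet`
for the correction. -/
theorem contDiffAt_corr {ε : ℝ} (hε : 0 < ε) {p : Fin 4 → ℝ}
    (hp : p 0 < -ε ∨ bgFactor Λ (zCoord p) ≠ 0) : ContDiffAt ℝ 1 (corr Λ H ρ ε) p := by
  by_cases h0 : p 0 < -ε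
  · exact contDiffAt_const.congr_of_eventuallyEq (corr_eventuallyEq_zero hρ hε h0)
  · have hz0 := hp.resolve_left h0
    have h11 := ((contDiff_M11 hH).comp contDiff_zCoord).contDiffAt (x := p)
    have h12 := ((contDiff_M12 hH).comp contDiff_zCoord).contDiffAt (x := p)
    have h22 := ((contDiff_M22 hH).comp contDiff_zCoord).contDiffAt (x := p)
    have hG := (((contDiff_G hH).of_le (by norm_num : (1 : WithTop ℕ∞) ≤ 2)).comp
      contDiff_zCoord).contDiffAt (x := p)
    have hκ := ((isCorrector_kappaEps hρ hε).contDiff.comp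
      (contDiff_apply ℝ ℝ (0 : Fin 4))).contDiffAt (x := p)
    have hζ := ((isCorrector_zetaEps hρ hε).contDiff.comp
      (contDiff_apply ℝ ℝ (0 : Fin 4))).contDiffAt (x := p)
    have hι := ((isCorrector_iotaEps hρ hε).contDiff.comp
      (contDiff_apply ℝ ℝ (0 : Fin 4))).contDiffAt (x := p)
    have hV := (contDiff_apply ℝ ℝ (1 : Fin 4) (n := 1)).contDiffAt (x := p)
    have hb := hasJet_p0J (Λ := Λ) (H := H) (ρ := ρ) (ε := ε) p
    have hi := hb.contDiffAt.inv hz0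
    simp only [Function.comp_def] at h11 h12 h22 hG hκ hζ hι
    have hn := ((h11.mul h11).add (contDiffAt_const (c := (2 : ℝ)).mul (h12.mul h12))).add
      (h22.mul h22)
    have h := ((((contDiffAt_const (c := (2 : ℝ)).mul hn).add
      (contDiffAt_const (c := -2 * (Λ / 6) ^ 2).mul ((hG.mul hG).mul (hi.mul hi)))).mul hκ).add
      (hn.mul hζ)).add ((contDiffAt_const (c := -2 * (Λ / 6) ^ 2).mul
        ((hG.mul hV).mul (hi.mul hi))).mul hι)
    refine h.congr_of_eventuallyEq ?_
    filter_upwards [hb.contDiffAt.continuousAt.eventually_ne hz0] with q hq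
    rw [corr, coeffA_eq hH hq, coeffB_eq hH, coeffE_eq]
    rfl

theorem isC1At_approxMetric {ε : ℝ} (hε : 0 < ε) {p : Fin 4 → ℝ}
    (hp : p 0 < -ε ∨ bgFactor Λ (zCoord p) ≠ 0) (hP : PEps Λ H ρ ε p ≠ 0) :
    IsC1At (approxMetric Λ H ρ ε) p := by
  intro i j
  have h11 := ((contDiff_M11 hH).comp contDiff_zCoord).contDiffAt (x := p)
  have h12 := ((contDiff_M12 hH).comp contDiff_zCoord).contDiffAt (x := p)
  have h22 := ((contDiff_M22 hH).comp contDiff_zCoord).contDiffAt (x := p)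
  have hw := ((contDiff_one_of_hasDerivAt (hasDerivAt_mollify_uPlus hρ hε)
    (continuous_mollify_heaviside hρ hε)).comp (contDiff_apply ℝ ℝ (0 : Fin 4))).contDiffAt
    (x := p)
  have hs := ((contDiff_one_of_hasDerivAt (hasDerivAt_mollify_uPlus_sq hρ hε)
    (continuous_const.mul (continuous_mollify_uPlus hρ hε))).comp
    (contDiff_apply ℝ ℝ (0 : Fin 4))).contDiffAt (x := p)
  have hcorr := contDiffAt_corr hH hρ hε hp
  have jP := (hasJet_PJ (Λ := Λ) hH hρ hε p).contDiffAt
  simp only [Function.comp_def] at h11 h12 h22 hw hs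
  have hh : ContDiffAt ℝ 1 (fun q => halfApprox Λ H ρ ε q i j) p := by
    have one := contDiffAt_const (c := (1 : ℝ)) (𝕜 := ℝ) (n := 1) (x := p)
    have two := contDiffAt_const (c := (2 : ℝ)) (𝕜 := ℝ) (n := 1) (x := p)
    have e1 := ((one.add hcorr).add (two.mul (hw.mul h11))).add
      (hs.mul ((h11.mul h11).add (h12.mul h12)))
    have e2 := (two.mul (hw.mul h12)).add (hs.mul ((h11.add h22).mul h12))
    have e3 := ((one.add hcorr).add (two.mul (hw.mul h22))).add
      (hs.mul ((h12.mul h12).add (h22.mul h22)))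
    fin_cases i <;> fin_cases j <;> first
      | exact contDiffAt_const (c := (0 : ℝ))
      | exact contDiffAt_const (c := (-(1 / 2) : ℝ))
      | exact e1
      | exact e2
      | exact e3
  have h := ((contDiffAt_const (c := (1 : ℝ))).div (jP.pow 2) (pow_ne_zero 2 hP)).mul
    ((contDiffAt_const (c := (2 : ℝ))).mul hh)
  refine h.congr_of_eventuallyEq (Eventually.of_forall fun q => ?_)
  simp only [approxMetric_eq hH, Matrix.smul_apply, smul_eq_mul, halfApprox]
  rfl

omit hρ in
theorem isLorentzian_approxMetric {ε : ℝ} {p : Fin 4 → ℝ} (hP : PEps Λ H ρ ε p ≠ 0)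
    (h1 : 0 < halfApprox Λ H ρ ε p 2 2) (h2 : 0 < transDet Λ H ρ ε p) :
    IsLorentzian (approxMetric Λ H ρ ε p) := by
  rw [approxMetric_eq hH, smul_smul]
  exact isLorentzian_halfMetric (by positivity) h1 h2

theorem isTwiceDifferentiableAt_approxMetric {ε : ℝ} (hε : 0 < ε) {p : Fin 4 → ℝ}
    (hz : DifferentiableAt ℝ (iteratedFDeriv ℝ 3 H) (zCoord p))
    (hp : p 0 < -ε ∨ bgFactor Λ (zCoord p) ≠ 0) (hP : PEps Λ H ρ ε p ≠ 0) :
    IsTwiceDifferentiableAt (approxMetric Λ H ρ ε) p := fun i j =>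
  (hasJet_approxMetric hH hρ hε hz hp hP i j).differentiableAt

include hK hδ hc

/-- The constant is uniform over K. Any B ≥ Cε is allowed, so that a strictly positive bound can be
chosen afterwards. -/
theorem exists_ricciGEAt (hcond : ∀ z : ℂ, bgFactor Λ z ≠ 0 →
    0 ≤ -2 * HZZb H z - Λ * G H z / (3 * bgFactor Λ z)) :
    ∃ C, ∀ x : Param K δ, DifferentiableAt ℝ (iteratedFDeriv ℝ 3 H) (zCoord x.pt) →
      ∀ B, C * x.eps ≤ B → RicciGEAt (approxMetric Λ H ρ x.eps) Λ B x.pt := by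
  obtain ⟨C0, h0⟩ := exists_restAt_bound hH hρ hK hδ hc
  have h1 : ∀ i j, ∃ C, ∀ x : Param K δ, ¬(i = 0 ∧ j = 0) →
      |(realAtoms Λ H ρ x.eps x.pt).ricJ i j - Λ * (realAtoms Λ H ρ x.eps x.pt).gJ i j| ≤
        C * x.eps := by
    intro i j
    by_cases hij : i = 0 ∧ j = 0
    · exact ⟨0, fun x h => absurd hij h⟩
    · exact (exists_ricJ_bound hH hρ hK hδ hc hij).imp fun C hC x _ => hC x
  choose C hC using h1
  set D := |C0| + ∑ i, ∑ j, |C i j| with hD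
  have hD0 : C0 ≤ D := (le_abs_self _).trans (le_add_of_nonneg_right (by positivity))
  have hDij : ∀ i j, C i j ≤ D := fun i j => by
    refine (le_abs_self _).trans (le_trans ?_ (le_add_of_nonneg_left (abs_nonneg C0)))
    refine le_trans ?_ (Finset.single_le_sum (f := fun i => ∑ j, |C i j|)
      (fun i _ => by positivity) (Finset.mem_univ i))
    exact Finset.single_le_sum (f := fun j => |C i j|) (fun j _ => by positivity)
      (Finset.mem_univ j)
  refine ⟨4 * D, fun x hz B hB X => ?_⟩
  have hp := hδ.lt_or_ne x
  have hP := hc.PEps_ne_zero x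
  have hR := ricci_approxMetric hH hρ x.eps_pos hz hp hP (hc.transDet_ne_zero x)
  have hg := approxMetric_apply hH hρ x.eps_pos hp
  have key := quadratic_ge (T := ricci (approxMetric Λ H ρ x.eps) x.pt
    - Λ • approxMetric Λ H ρ x.eps x.pt) (B := D * x.eps) ?_ ?_ X
  · rw [Matrix.sub_mulVec, dotProduct_sub, Matrix.smul_mulVec, dotProduct_smul, smul_eq_mul] at key
    have hX : 0 ≤ X ⬝ᵥ X := by
      simp only [dotProduct, Fin.sum_univ_four]
      nlinarith [mul_self_nonneg (X 0), mul_self_nonneg (X 1), mul_self_nonneg (X 2),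
        mul_self_nonneg (X 3)]
    nlinarith
  · rw [Matrix.sub_apply, Matrix.smul_apply, hR, hg,
      show (realAtoms Λ H ρ x.eps x.pt).gJ 0 0 = 0 by simp [Atoms.gJ, Atoms.μ], smul_zero, sub_zero]
    refine le_trans ?_ (restAt_le_ricJ hH hρ hδ hc hcond x)
    have h2 := (abs_le.mp (h0 x)).1
    nlinarith [x.eps_pos]
  · intro i j hij
    rw [Matrix.sub_apply, Matrix.smul_apply, hR, hg, fullAtoms, Atoms.ricJ_withSecond _ _ _ _ _ hij,
      smul_eq_mul]
    exact (hC i j x hij).trans (mul_le_mul_of_nonneg_right (hDij i j) x.eps_pos.le)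

end

end

section

/-! ### Differentiability almost everywhere -/

/-- Rademacher's theorem for locally Lipschitz functions. -/
theorem ae_differentiableAt_of_locallyLipschitz {E F : Type*} [NormedAddCommGroup E]
    [NormedSpace ℝ E] [FiniteDimensional ℝ E] [MeasurableSpace E] [BorelSpace E]
    [NormedAddCommGroup F] [NormedSpace ℝ F] [FiniteDimensional ℝ F] (μ : Measure E)
    [μ.IsAddHaarMeasure] {f : E → F} (hf : LocallyLipschitz f) :
    ∀ᵐ x ∂μ, DifferentiableAt ℝ f x := by
  choose C t ht hC using hf
  obtain ⟨s, hs, hcov⟩ := TopologicalSpace.countable_cover_nhds (f := fun x => interior (t x))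
    fun x => interior_mem_nhds.mpr (ht x)
  have h1 : ∀ x ∈ s, ∀ᵐ y ∂μ, y ∈ interior (t x) → DifferentiableAt ℝ f y := fun x _ => by
    filter_upwards [((hC x).mono interior_subset).ae_differentiableWithinAt_of_mem (μ := μ)]
      with y hy hyt
    exact (hy hyt).differentiableAt (isOpen_interior.mem_nhds hyt)
  filter_upwards [(ae_ball_iff hs).mpr h1] with y hy
  have : y ∈ ⋃ x ∈ s, interior (t x) := hcov ▸ Set.mem_univ y
  obtain ⟨x, hx, hyx⟩ := Set.mem_iUnion₂.mp this
  exact hy x hx hyx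

/-- Rademacher's theorem on ℂ, pulled back to ℝ⁴: preimages of null sets under a surjective linear
map are null. -/
theorem ae_differentiableAt_third {H : ℂ → ℝ} (hH : IsC31Loc H) :
    ∀ᵐ p : Fin 4 → ℝ, DifferentiableAt ℝ (iteratedFDeriv ℝ 3 H) (zCoord p) := by
  have hsurj : Function.Surjective zL := fun z =>
    ⟨![0, 0, z.re, z.im], by rw [zL_apply]; apply Complex.ext <;> simp [zCoord]⟩
  have : FiniteDimensional ℝ (ContinuousMultilinearMap ℝ (fun _ : Fin 3 => ℂ) ℝ) :=
    FiniteDimensional.of_injective (ContinuousMultilinearMap.toMultilinearMapLinear (R' := ℝ) (A := ℝ)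
      (M₁ := fun _ : Fin 3 => ℂ) (M₂ := ℝ))
      ContinuousMultilinearMap.toMultilinearMap_injective
  have h := ae_differentiableAt_of_locallyLipschitz (volume : Measure ℂ) hH.2
  have := (ae_comp_linearMap_mem_iff zL.toLinearMap (volume : Measure (Fin 4 → ℝ))
    (volume : Measure ℂ) hsurj (measurableSet_of_differentiableAt ℝ (iteratedFDeriv ℝ 3 H))).mpr h
  filter_upwards [this] with p hp
  rwa [← zL_apply]

end

end IPPWave

end

/-! ### The main theorem -/

open IPPWave in
theorem mainTheorem9 (Λ : ℝ) (H : ℂ → ℝ) (hH : IPPWave.IsC31Loc H)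
    (hcond : ∀ z : ℂ, IPPWave.bgFactor Λ z ≠ 0 →
      0 ≤ -2 * IPPWave.HZZb H z - Λ * IPPWave.G H z / (3 * IPPWave.bgFactor Λ z))
    (ρ : ℝ → ℝ) (hρ : IPPWave.IsMollifier ρ)
    (K : Set (Fin 4 → ℝ)) (hK : IsCompact K) (hKM : K ⊆ IPPWave.lorentzDomain Λ H)
    (hK0 : ∀ p ∈ K, 0 < p 0 → IPPWave.bgFactor Λ (IPPWave.zCoord p) ≠ 0) :
    (∀ i j : Fin 4, TendstoUniformlyOn
      (fun (ε : ℝ) (p : Fin 4 → ℝ) => IPPWave.approxMetric Λ H ρ ε p i j)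
      (fun p => IPPWave.waveMetric Λ H p i j) (𝓝[>] (0 : ℝ)) K) ∧
    (∀ᵐ p : Fin 4 → ℝ, DifferentiableAt ℝ (iteratedFDeriv ℝ 3 H) (IPPWave.zCoord p)) ∧
    ∃ c : ℝ → ℝ, (∀ ε, 0 < c ε) ∧ Tendsto c (𝓝[>] (0 : ℝ)) (𝓝 0) ∧
      ∀ᶠ ε in 𝓝[>] (0 : ℝ), ∀ p ∈ K,
        IPPWave.IsLorentzian (IPPWave.approxMetric Λ H ρ ε p) ∧
        IPPWave.IsC1At (IPPWave.approxMetric Λ H ρ ε) p ∧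
        (DifferentiableAt ℝ (iteratedFDeriv ℝ 3 H) (IPPWave.zCoord p) →
          IPPWave.IsTwiceDifferentiableAt (IPPWave.approxMetric Λ H ρ ε) p ∧
          IPPWave.RicciGEAt (IPPWave.approxMetric Λ H ρ ε) Λ (c ε) p) := by
  obtain ⟨δ₀, hδ₀⟩ := exists_isRange hK hKM hK0
  obtain ⟨δ, hδ_pos, hδ_le, c₀, hc₀, hnd⟩ := exists_nondegenerate hH hρ hK hδ₀ hKM
  have hδ := hδ₀.mono hδ_pos hδ_le
  have hc : IsNondegenerate Λ H ρ K δ c₀ :=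
    ⟨hc₀, fun x => (hnd x).1, fun x => (hnd x).2.1, fun x => (hnd x).2.2⟩
  have hev : ∀ᶠ ε in 𝓝[>] (0 : ℝ), 0 < ε ∧ ε ≤ δ :=
    mem_of_superset (Ioc_mem_nhdsGT hδ_pos) fun ε hε => hε
  refine ⟨fun i j => ?_, ae_differentiableAt_third hH, ?_⟩
  · obtain ⟨C, hC⟩ := exists_metric_bound hH hρ hK hδ hc hKM i j
    rw [Metric.tendstoUniformlyOn_iff]
    intro η hη
    have hsmall : ∀ᶠ ε in 𝓝[>] (0 : ℝ), C * ε < η := by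
      have : Tendsto (fun ε : ℝ => C * ε) (𝓝[>] 0) (𝓝 (C * 0)) :=
        ((continuous_const.mul continuous_id).tendsto 0).mono_left nhdsWithin_le_nhds
      rw [mul_zero] at this
      exact this.eventually (gt_mem_nhds hη)
    filter_upwards [hev, hsmall] with ε hε hε' p hp
    rw [dist_comm, Real.dist_eq]
    exact (hC ⟨(ε, p), hε.1, hε.2, hp⟩).trans_lt hε'
  · obtain ⟨C, hC⟩ := exists_ricciGEAt hH hρ hK hδ hc hcond
    -- The summand 1 keeps the constant positive even if C = 0; the value for ε ≤ 0 only serves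
    -- positivity.
    refine ⟨fun ε => if 0 < ε then (|C| + 1) * ε else 1, fun ε => ?_, ?_, ?_⟩
    · dsimp only
      split_ifs with hε
      · positivity
      · exact one_pos
    · have : Tendsto (fun ε : ℝ => (|C| + 1) * ε) (𝓝[>] 0) (𝓝 ((|C| + 1) * 0)) :=
        ((continuous_const.mul continuous_id).tendsto 0).mono_left nhdsWithin_le_nhds
      rw [mul_zero] at this
      refine this.congr' ?_
      filter_upwards [hev] with ε hε
      exact (if_pos hε.1).symm
    · filter_upwards [hev] with ε hε p hp
      set x : Param K δ := ⟨(ε, p), hε.1, hε.2, hp⟩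
      have hbg : p 0 < -ε ∨ bgFactor Λ (zCoord p) ≠ 0 := hδ.lt_or_ne x
      have hP : PEps Λ H ρ ε p ≠ 0 := hc.PEps_ne_zero x
      refine ⟨isLorentzian_approxMetric hH hP (hc₀.trans_le (hc.halfApprox x))
        (hc₀.trans_le (hc.transDet x)), isC1At_approxMetric hH hρ hε.1 hbg hP, fun hz =>
        ⟨isTwiceDifferentiableAt_approxMetric hH hρ hε.1 hz hbg hP, hC x hz _ ?_⟩⟩
      rw [if_pos hε.1]
      exact mul_le_mul_of_nonneg_right (by linarith [le_abs_self C]) hε.1.le
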